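/- Let $\mathbb F_q$ be a finite field with $q$ elements and let $X=X^n\subset\mathbb P^{n+1}$ be a nonsingular hypersurface of degree $d\ge 2$ and dimension $n\ge 1$ defined over $\mathbb F_q$ (nonsingular at all points over the algebraic closure). Let $N_q(X)$ be the number of $\mathbb F_q$-points of $X$, let $N_q(\mathbb P^N)=q^N+\dots+q+1$, and let $k_X$ be the maximal dimension of an $\mathbb F_q$-linear subspace of $\mathbb P^{n+1}$ contained in $X$ (as a variety, i.e. over the algebraic closure), with $k_X=0$ if $X$ has no $\mathbb F_q$-point. Put $$\Theta^{d,q}_{n,k}=\begin{cases}(d-1)q^{k}N_q(\mathbb P^{n-k})+N_q(\mathbb P^{k}) & \text{if } 0<k\le n,\\ (d-1)q^n+(d-2)N_q(\mathbb P^{n-1})+1 & \text{if } k=0.\end{cases}$$ Then $N_q(X)\le\Theta^{d,q}_{n,k_X}$, and equality holds if and only if one of the following occurs (projective equivalence being over $\mathbb F_q$): 1. $n=1$, $d=2$, $k_X=0$ and $X$ is projectively equivalent to the nonsingular plane conic $X_0^2+X_1^2+X_2^2=0$ if $q$ is odd, $X_0^2+X_1X_2=0$ if $q$ is even; 2. $n=2$,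 $d=2$, $k_X=0$ and $X$ is projectively equivalent to an elliptic quadric surface $\alpha X_0^2+X_0X_1+X_1^2+X_2X_3=0$ for some $\alpha\in\mathbb F_q$ with $\alpha+\alpha^2+\alpha^4+\dots+\alpha^{2^{r-1}}=1$ if $q=2^r$, and with $1-4\alpha$ a non-square if $q$ is odd; 3. $n\ge 2$ is even, $k_X=n/2$ and one of the following holds: - (a) $d=q+1$ and $X$ is a space-filling hypersurface $(X_0,\dots,X_{n+1})\,A\,{}^t(X_0^q,\dots,X_{n+1}^q)=0$, where $A=(a_{ij})$ is an $(n+2)\times(n+2)$ matrix over $\mathbb F_q$ with ${}^tA=-A$, $a_{ii}=0$ for all $i$, and $\det A\ne 0$; - (b) $q$ is a square, $d=\sqrt q+1$ and $X$ is projectively equivalent to the Hermitian hypersurface $X_0^{\sqrt q+1}+X_1^{\sqrt q+1}+\dots+X_{n+1}^{\sqrt q+1}=0$; - (c) $d=2$ and $X$ is projectively equivalent to the hyperbolic quadric $X_0X_1+X_2X_3+\dots+X_nX_{n+1}=0$. -/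

import Mathlib

/-! Hypersurfaces `X^n ⊂ ℙ^{n+1}` over a finite field `K = 𝔽_q`, given by a form
`F` in the `n + 2` variables `X_0, …, X_{n+1}`. -/

namespace FqHypersurface

open MvPolynomial

noncomputable section

/-- `N_q(X)`: the number of `K`-rational points of the hypersurface `F = 0` in `ℙ^{n+1}(K)`.
For a form `F` the condition does not depend on the chosen representative. -/
def numPoints {K : Type*} [Field K] {n : ℕ} (F : MvPolynomial (Fin (n + 2)) K) : ℕ :=
  Nat.card {p : Projectivization K (Fin (n + 2) → K) // eval p.rep F = 0}

/-- The hypersurface `F = 0` is nonsingular: at none of its geometric points do all the partial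
derivatives of `F` vanish. -/
def IsNonsingular {K : Type*} [Field K] {n : ℕ} (F : MvPolynomial (Fin (n + 2)) K) : Prop :=
  ∀ x : Fin (n + 2) → AlgebraicClosure K, x ≠ 0 → aeval x F = 0 →
    ∃ i, aeval x (pderiv i F) ≠ 0

/-- The `K`-linear subspace `ℙ(V)` is contained in the hypersurface `F = 0` as a variety, that is,
all geometric points of `ℙ(V)` (not only the `K`-rational ones) lie on `F = 0`. -/
def ContainsLinear {K : Type*} [Field K] {n : ℕ} (F : MvPolynomial (Fin (n + 2)) K)
    (V : Submodule K (Fin (n + 2) → K)) : Prop :=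
  ∀ x ∈ Submodule.span (AlgebraicClosure K)
      ((fun (v : Fin (n + 2) → K) (i : Fin (n + 2)) => algebraMap K (AlgebraicClosure K) (v i)) ''
        (V : Set (Fin (n + 2) → K))),
    aeval x F = 0

/-- The invariant `k_X`: the maximal (projective) dimension `h` of a `K`-linear subspace `ℙ^h`
contained in `F = 0`. The set is bounded by `n + 1`; if it is empty, i.e. if there is no rational
point, then `sSup ∅ = 0`, so that `k_X = 0` means that there is no `K`-line on the hypersurface. -/
def thasInvariant {K : Type*} [Field K] {n : ℕ} (F : MvPolynomial (Fin (n + 2)) K) : ℕ :=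
  sSup {h : ℕ | ∃ V : Submodule K (Fin (n + 2) → K),
    Module.finrank K V = h + 1 ∧ ContainsLinear F V}

/-- `N_q(ℙ^N) = q^N + ⋯ + q + 1`. -/
def projCount (q N : ℕ) : ℕ := ∑ i ∈ Finset.range (N + 1), q ^ i

/-- `Θ^{d,q}_{n,k}`, for `d ≥ 2`, `n ≥ 1` and `0 ≤ k ≤ n` (so that no subtraction truncates). -/
def theta (d q n k : ℕ) : ℕ :=
  if k = 0 then (d - 1) * q ^ n + (d - 2) * projCount q (n - 1) + 1
  else (d - 1) * q ^ k * projCount q (n - k) + projCount q k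

/-- The forms `F` and `G` define the same hypersurface. -/
def SameHypersurface {K : Type*} [Field K] {n : ℕ} (F G : MvPolynomial (Fin (n + 2)) K) : Prop :=
  ∃ c : K, c ≠ 0 ∧ F = C c * G

/-- The linear change of variables `X_i ↦ ∑_j M_{ij} X_j` applied to `F`. -/
def linSubst {K : Type*} [Field K] {n : ℕ} (M : Matrix (Fin (n + 2)) (Fin (n + 2)) K)
    (F : MvPolynomial (Fin (n + 2)) K) : MvPolynomial (Fin (n + 2)) K :=
  aeval (fun i => ∑ j, C (M i j) * X j) F

/-- Projective equivalence over `K`. -/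
def ProjEquiv {K : Type*} [Field K] {n : ℕ} (F G : MvPolynomial (Fin (n + 2)) K) : Prop :=
  ∃ M : Matrix.GeneralLinearGroup (Fin (n + 2)) K,
    SameHypersurface (linSubst (M : Matrix (Fin (n + 2)) (Fin (n + 2)) K) F) G

/-- `X_0² + X_1² + X_2²`, used for `n = 1` and `q` odd. -/
def sumSquaresConic (K : Type*) [Field K] (n : ℕ) : MvPolynomial (Fin (n + 2)) K :=
  X 0 ^ 2 + X 1 ^ 2 + X 2 ^ 2

/-- `X_0² + X_1 X_2`, used for `n = 1` and `q` even. -/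
def evenConic (K : Type*) [Field K] (n : ℕ) : MvPolynomial (Fin (n + 2)) K :=
  X 0 ^ 2 + X 1 * X 2

/-- `α X_0² + X_0 X_1 + X_1² + X_2 X_3`, used for `n = 2`. -/
def ellipticQuadric {K : Type*} [Field K] (n : ℕ) (α : K) : MvPolynomial (Fin (n + 2)) K :=
  C α * X 0 ^ 2 + X 0 * X 1 + X 1 ^ 2 + X 2 * X 3

/-- `(X_0, …, X_{n+1}) A ᵗ(X_0^q, …, X_{n+1}^q)`. -/
def spaceFilling {K : Type*} [Field K] {n : ℕ} (q : ℕ)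
    (A : Matrix (Fin (n + 2)) (Fin (n + 2)) K) : MvPolynomial (Fin (n + 2)) K :=
  ∑ i, ∑ j, C (A i j) * X i * X j ^ q

/-- `X_0^{s+1} + ⋯ + X_{n+1}^{s+1}`; the Hermitian form when `q = s²`. -/
def hermitianForm (K : Type*) [Field K] (n s : ℕ) : MvPolynomial (Fin (n + 2)) K :=
  ∑ i, X i ^ (s + 1)

/-- `X_0 X_1 + X_2 X_3 + ⋯ + X_n X_{n+1}`, used for `n` even; all indices are `< n + 2` then. -/
def hyperbolicQuadric (K : Type*) [Field K] (n : ℕ) : MvPolynomial (Fin (n + 2)) K :=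
  ∑ i ∈ Finset.range (n / 2 + 1), X (Fin.ofNat (n + 2) (2 * i)) * X (Fin.ofNat (n + 2) (2 * i + 1))

end

end FqHypersurface

/-! Points are counted on the affine cone, which has `(q - 1) * N_q(X) + 1` rational points. Suppose
`k = k_X > 0` and put `e = d - 1`. Choose coordinates `(x, y)` in which a linear subspace of maximal
dimension on `X` is `y = 0`, and let `G(x, y)` be the equation. Since `G(x, 0) = 0`, the polynomial
`G(x, v)` in `k + 1` variables has degree at most `e`. It is nonzero for `v ≠ 0`, since otherwise
`X` would contain the span of the subspace and `v`. Schwartz–Zippel allows it at most `e q^k` zeros,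
and summation over `v` gives the bound.

If equality holds, every `G(x, v)` attains the Schwartz–Zippel bound, hence is a product of `e`
parallel affine hyperplanes (`exists_eq_prod_of_zeroCount_eq`). Its leading part depends linearly on
`v` and is a constant times the `e`-th power of a linear form. Nonsingularity along `y = 0` says
that this linear system has no rational base point, and then `e` must be a power of the
characteristic, `n = 2k`, and coordinates exist in which `G(x, w^e) = ∏ (w·x - a)`, with `a` running
over `e` elements of `K` that depend on `w` (`IsExtremalNormal`). Three cases remain.

If `e = q`, the count says that `F` vanishes at all rational vectors; the combinatorial
Nullstellensatz then yields the alternating matrix. If `e = 1`, completing the form gives the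
hyperbolic quadric. If `1 < e < q`, let `f = q / e`. The derivative of `G` along `x_i` is `y_i^f`
times a factor `E` common to all `i`. If `E` vanished at the origin, `E` and the `y`-derivatives
would be too few polynomials to avoid a nontrivial common zero, which would be a singular point. So
`E` is a nonzero constant, `e = f` and `q = e²`. It follows that `G(x, v) = t^e + c t + D(v)` for a
linear form `t` in `x`; after scaling, its values lie in the subfield with `e` elements. Comparing
reduced polynomials shows that the form is Hermitian, and an orthonormal basis brings it to the
Fermat form.

If `k_X = 0`, the same count is made with lines through a rational point; directions in the tangent
hyperplane lose one more degree. For `d ≥ 3` equality is impossible: a tangent line at `P` would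
have to be tangent at each of its other points on `X` too, and these are already as many as the
degree permits without multiplicity. For `d = 2` Chevalley–Warning provides a point and equality
always holds. Splitting off a hyperbolic plane leaves an anisotropic form in `n` variables, so `n ≤
2`, and the two classical normal forms result.

Conversely, the hypersurfaces with `k_X = n / 2` in the list are counted directly. -/

namespace FqHypersurface

open MvPolynomial

noncomputable section

/-! ### Common zeros of few polynomials over an algebraically closed field -/

/-- The ideal of the origin in affine `N`-space has height at least `N`. -/
lemma le_height_vanishingIdeal_zero {k : Type*} [Field k] (N : ℕ) :
    (N : ℕ∞) ≤ (RingHom.ker (aeval (fun _ : Fin N => (0 : k)) : MvPolynomial (Fin N) k →ₐ[k] k)).height := by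
  classical
  -- `φ i` sets the first `i` variables to zero; the kernels form a strictly increasing chain of
  -- primes from `0` to the ideal of the origin.
  let φ : ℕ → (MvPolynomial (Fin N) k →ₐ[k] MvPolynomial (Fin N) k) := fun i =>
    aeval (fun j : Fin N => if (j : ℕ) < i then 0 else X j)
  have hp : ∀ i, (RingHom.ker (φ i)).IsPrime := fun i => RingHom.ker_isPrime _
  have hstep : ∀ i, i < N → RingHom.ker (φ i) < RingHom.ker (φ (i + 1)) := by
    intro i hi
    refine lt_of_le_of_ne ?_ ?_
    · have hcomp : (φ (i + 1)) = (φ (i + 1)).comp (φ i) := by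
        ext j : 1
        simp only [φ, AlgHom.comp_apply, aeval_X]
        by_cases h : (j : ℕ) < i
        · simp [h, Nat.lt_succ_of_lt h]
        · simp [h]
      intro p hpk
      rw [RingHom.mem_ker] at hpk ⊢
      rw [hcomp, AlgHom.comp_apply, hpk, map_zero]
    · intro h
      have h1 : (X ⟨i, hi⟩ : MvPolynomial (Fin N) k) ∈ RingHom.ker (φ (i + 1)) := by
        simp [φ, RingHom.mem_ker]
      rw [← h, RingHom.mem_ker] at h1
      simp [φ] at h1
  have key : ∀ i, i ≤ N → (i : ℕ∞) ≤ (RingHom.ker (φ i)).height := by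
    intro i
    induction i with
    | zero => intro _; simp
    | succ i ih =>
      intro hi
      have := Ideal.height_add_one_le_of_lt_of_isPrime (hstep i hi)
      push_cast
      exact le_trans (by gcongr; exact ih (by omega)) this
  have hN : RingHom.ker (φ N) = RingHom.ker (aeval (fun _ : Fin N => (0 : k)) : MvPolynomial (Fin N) k →ₐ[k] k) := by
    have : φ N = (Algebra.ofId k _).comp (aeval (fun _ : Fin N => (0 : k))) := by
      ext j : 1
      simp [φ]
    ext p
    rw [RingHom.mem_ker, RingHom.mem_ker, this]
    simp [Algebra.ofId_apply]
  rw [← hN]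
  exact key N le_rfl

/-- If the origin were the only common zero, the Nullstellensatz would make its ideal a minimal
prime over the ideal generated by the `f i`. Krull's height theorem then bounds its height by the
number of generators, whereas the height is at least `N`. -/
lemma exists_ne_zero_common_zero_fin {k : Type*} [Field k] [IsAlgClosed k] {N : ℕ} {ι : Type*}
    [Fintype ι] (hlt : Fintype.card ι < N) (f : ι → MvPolynomial (Fin N) k)
    (h0 : ∀ i, eval 0 (f i) = 0) : ∃ x : Fin N → k, x ≠ 0 ∧ ∀ i, eval x (f i) = 0 := by
  classical
  by_contra! hcon
  set s : Finset (MvPolynomial (Fin N) k) := Finset.univ.image f with hs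
  set m := RingHom.ker (aeval (fun _ : Fin N => (0 : k)) : MvPolynomial (Fin N) k →ₐ[k] k) with hm
  have hcoe : ∀ (x : Fin N → k) (p : MvPolynomial (Fin N) k), aeval x p = eval x p := fun x p => by
    rw [aeval_eq_eval]
  have hmp : m.IsPrime := RingHom.ker_isPrime _
  have hle : Ideal.span (s : Set (MvPolynomial (Fin N) k)) ≤ m := by
    rw [Ideal.span_le]
    intro p hp
    simp only [hs, Finset.coe_image, Finset.coe_univ, Set.image_univ, Set.mem_range] at hp
    obtain ⟨i, rfl⟩ := hp
    rw [SetLike.mem_coe, hm, RingHom.mem_ker, hcoe]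
    exact h0 i
  have hrad : m ≤ (Ideal.span (s : Set (MvPolynomial (Fin N) k))).radical := by
    rw [← vanishingIdeal_zeroLocus_eq_radical (K := k)]
    intro p hp
    rw [mem_vanishingIdeal_iff]
    intro x hx
    have hx0 : x = 0 := by
      by_contra hne
      obtain ⟨i, hi⟩ := hcon x hne
      apply hi
      rw [← hcoe]
      exact hx _ (Ideal.subset_span (by simp [hs]))
    subst hx0
    exact hp
  have hmin : m ∈ (Ideal.span (s : Set (MvPolynomial (Fin N) k))).minimalPrimes := by
    refine ⟨⟨hmp, hle⟩, fun J hJ _ => ?_⟩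
    exact hrad.trans ((Ideal.IsPrime.radical_le_iff hJ.1).2 hJ.2)
  have h1 := Ideal.height_le_card_of_mem_minimalPrimes_span_finset hmin
  have h2 := (le_height_vanishingIdeal_zero (k := k) N).trans h1
  have h3 : N ≤ s.card := by exact_mod_cast h2
  have h4 : s.card ≤ Fintype.card ι := Finset.card_image_le
  omega

/-- Over an algebraically closed field, fewer polynomials than variables, all vanishing at the
origin, have another common zero. -/
lemma exists_ne_zero_common_zero {k : Type*} [Field k] [IsAlgClosed k] {σ ι : Type*} [Fintype σ]
    [Fintype ι] (hlt : Fintype.card ι < Fintype.card σ) (f : ι → MvPolynomial σ k)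
    (h0 : ∀ i, eval 0 (f i) = 0) : ∃ x : σ → k, x ≠ 0 ∧ ∀ i, eval x (f i) = 0 := by
  let e := Fintype.equivFin σ
  obtain ⟨x, hx, hf⟩ := exists_ne_zero_common_zero_fin hlt (fun i => rename e (f i))
    (fun i => by rw [eval_rename]; exact h0 i)
  refine ⟨x ∘ e, fun h => hx ?_, fun i => by simpa [eval_rename] using hf i⟩
  ext j
  simpa using congrFun h (e.symm j)

/-! ### Polynomials vanishing at all rational vectors, and affine zero counts -/

/-- The number of zeros of `P` in the affine space `K^σ`. -/
def zeroCount {K : Type*} [Field K] {σ : Type*} (P : MvPolynomial σ K) : ℕ :=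
  Nat.card {x : σ → K // eval x P = 0}

section Vanishing

variable {K : Type*} [Field K] [Fintype K] {σ : Type*} [Fintype σ]

lemma prod_X_sub_C_univ {A : Type*} [CommRing A] [Algebra K A] (z : A) :
    ∏ c : K, (z - algebraMap K A c) = z ^ Fintype.card K - z := by
  classical
  have h : (Polynomial.X ^ Fintype.card K - Polynomial.X : Polynomial K)
      = ∏ c : K, (Polynomial.X - Polynomial.C c) := by
    have hm : (Polynomial.X ^ Fintype.card K - Polynomial.X : Polynomial K).Monic := by
      apply Polynomial.monic_X_pow_sub
      rw [Polynomial.degree_X]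
      exact_mod_cast Fintype.one_lt_card
    have hr := FiniteField.roots_X_pow_card_sub_X K
    have := Polynomial.prod_multiset_X_sub_C_of_monic_of_roots_card_eq hm (by
      rw [hr, FiniteField.X_pow_card_sub_X_natDegree_eq K Fintype.one_lt_card]; simp)
    rw [hr] at this
    exact this.symm
  have := congrArg (Polynomial.aeval z) h
  simpa [map_prod] using this.symm

/-- A polynomial of degree at most `q + r` vanishing on `K^σ` is a combination of the
`X_i^q - X_i` with coefficients of degree at most `r`. -/
lemma exists_eq_sum_mul_of_eval_eq_zero {P : MvPolynomial σ K} {r : ℕ}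
    (hdeg : P.totalDegree ≤ Fintype.card K + r) (hP : ∀ x, eval x P = 0) :
    ∃ h : σ → MvPolynomial σ K, (∀ i, (h i).totalDegree ≤ r) ∧
      P = ∑ i, h i * (X i ^ Fintype.card K - X i) := by
  classical
  obtain ⟨h, h1, h2⟩ := combinatorial_nullstellensatz_exists_linearCombination
    (fun _ : σ => (Finset.univ : Finset K)) (fun _ => Finset.univ_nonempty) P (fun x _ => hP x)
  have hprod : ∀ i : σ, ∏ s : K, ((X i : MvPolynomial σ K) - C s) = X i ^ Fintype.card K - X i :=
    fun i => prod_X_sub_C_univ (A := MvPolynomial σ K) (X i)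
  refine ⟨h, fun i => ?_, ?_⟩
  · by_cases h0 : h i = 0
    · simp [h0]
    have h3 := (h1 i).trans hdeg
    have hc : coeff (Finsupp.single i (Fintype.card K))
        ((X i : MvPolynomial σ K) ^ Fintype.card K - X i) ≠ 0 := by
      rw [coeff_sub, coeff_X_pow, if_pos rfl, coeff_X, if_neg]
      · simp
      · intro h
        have := Finsupp.single_injective i h
        exact absurd this.symm (Fintype.one_lt_card (α := K)).ne'
    have hd : Fintype.card K ≤ ((X i : MvPolynomial σ K) ^ Fintype.card K - X i).totalDegree := by
      have := le_totalDegree (mem_support_iff.2 hc)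
      simpa using this
    rw [hprod, totalDegree_mul_of_isDomain (fun h => hc (by rw [h, coeff_zero])) h0] at h3
    omega
  · rw [h2, Finsupp.linearCombination_apply, Finsupp.sum_fintype _ _ (by simp)]
    simp [hprod]

lemma eq_zero_of_degreeOf_lt {P : MvPolynomial σ K} (hdeg : ∀ i, P.degreeOf i < Fintype.card K)
    (hP : ∀ x, eval x P = 0) : P = 0 :=
  eq_zero_of_eval_zero_at_prod_finset P (fun _ => (Finset.univ : Finset K))
    (fun i => by simpa using hdeg i) (fun x _ => hP x)

lemma eq_zero_of_totalDegree_lt {P : MvPolynomial σ K} (hdeg : P.totalDegree < Fintype.card K)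
    (hP : ∀ x, eval x P = 0) : P = 0 := by
  refine eq_zero_of_degreeOf_lt (fun i => ?_) hP
  exact (degreeOf_le_totalDegree P i).trans_lt hdeg

/-- Homogeneity gains one degree over the general case: `a = q` is allowed. The borderline is
needed, for instance for quadratic forms over the field with two elements. -/
lemma eq_zero_of_isHomogeneous {K : Type*} [Field K] [Fintype K] {σ : Type*} {P : MvPolynomial σ K} {a : ℕ} (hh : P.IsHomogeneous a)
    (ha : a ≤ Fintype.card K) (hP : ∀ x, eval x P = 0) : P = 0 :=
  hh.eq_zero_of_forall_eval_eq_zero_of_le_card hP (by simpa using ha)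

lemma zeroCount_le {m e : ℕ} {f : MvPolynomial (Fin (m + 1)) K} (hf : f ≠ 0)
    (he : f.totalDegree ≤ e) : zeroCount f ≤ e * Fintype.card K ^ m := by
  classical
  have h := schwartz_zippel_totalDegree hf (Finset.univ : Finset K)
  have hq : (0 : ℚ≥0) < Fintype.card K := by exact_mod_cast Fintype.card_pos
  rw [Finset.card_univ, div_le_div_iff₀ (by positivity) hq, pow_succ, ← mul_assoc] at h
  have h' := le_of_mul_le_mul_right h hq
  have h2 : zeroCount f ≤ f.totalDegree * Fintype.card K ^ m := by
    have h3 : zeroCount f = (Finset.filter (fun x => eval x f = 0)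
        (Fintype.piFinset fun _ => (Finset.univ : Finset K))).card := by
      rw [zeroCount, Nat.card_eq_fintype_card, Fintype.card_subtype, Fintype.piFinset_univ]
    rw [h3]
    exact_mod_cast h'
  exact h2.trans (Nat.mul_le_mul_right _ he)

end Vanishing

/-! ### Division in `K[σ][z]` with control of the total degree -/

section Division

variable {K : Type*} [Field K] {σ : Type*}

/-- `p ∈ K[σ][z]` has total degree at most `D`. -/
def TotalDegreeLE (D : ℕ) (p : Polynomial (MvPolynomial σ K)) : Prop :=
  ∀ j, p.coeff j ≠ 0 → (p.coeff j).totalDegree + j ≤ D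

namespace TotalDegreeLE

variable {D E : ℕ} {p r : Polynomial (MvPolynomial σ K)}

lemma mono (h : TotalDegreeLE D p) (hDE : D ≤ E) : TotalDegreeLE E p :=
  fun j hj => (h j hj).trans hDE

lemma zero : TotalDegreeLE D (0 : Polynomial (MvPolynomial σ K)) := fun j hj => by simp at hj

lemma add (hp : TotalDegreeLE D p) (hr : TotalDegreeLE D r) : TotalDegreeLE D (p + r) := by
  intro j hj
  rw [Polynomial.coeff_add] at hj ⊢
  by_cases h1 : p.coeff j = 0
  · rw [h1, zero_add] at hj ⊢
    exact hr j hj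
  by_cases h2 : r.coeff j = 0
  · rw [h2, add_zero]
    exact hp j h1
  have := totalDegree_add (p.coeff j) (r.coeff j)
  have := hp j h1
  have := hr j h2
  omega

lemma neg (hp : TotalDegreeLE D p) : TotalDegreeLE D (-p) := by
  intro j hj
  rw [Polynomial.coeff_neg] at hj ⊢
  rw [totalDegree_neg]
  exact hp j (by simpa using hj)

lemma sub (hp : TotalDegreeLE D p) (hr : TotalDegreeLE D r) : TotalDegreeLE D (p - r) := by
  rw [sub_eq_add_neg]
  exact hp.add hr.neg

lemma mul (hp : TotalDegreeLE D p) (hr : TotalDegreeLE E r) : TotalDegreeLE (D + E) (p * r) := by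
  intro j hj
  rw [Polynomial.coeff_mul] at hj ⊢
  have key : ∀ x ∈ Finset.HasAntidiagonal.antidiagonal j, p.coeff x.1 * r.coeff x.2 ≠ 0 →
      (p.coeff x.1 * r.coeff x.2).totalDegree + j ≤ D + E := by
    intro x hx hne
    have h1 := hp x.1 (left_ne_zero_of_mul hne)
    have h2 := hr x.2 (right_ne_zero_of_mul hne)
    have h3 := totalDegree_mul (p.coeff x.1) (r.coeff x.2)
    have h4 := Finset.HasAntidiagonal.mem_antidiagonal.1 hx
    omega
  obtain ⟨x, hx, hne⟩ := Finset.exists_ne_zero_of_sum_ne_zero hj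
  have hjle : j ≤ D + E := by have := key x hx hne; omega
  have : (∑ x ∈ Finset.HasAntidiagonal.antidiagonal j, p.coeff x.1 * r.coeff x.2).totalDegree ≤ D + E - j := by
    apply totalDegree_finsetSum_le
    intro x hx
    by_cases h0 : p.coeff x.1 * r.coeff x.2 = 0
    · rw [h0, totalDegree_zero]; omega
    · have := key x hx h0; omega
  omega

lemma C {a : MvPolynomial σ K} (ha : a.totalDegree ≤ D) : TotalDegreeLE D (Polynomial.C a) := by
  intro j hj
  rw [Polynomial.coeff_C] at hj ⊢
  split_ifs at hj ⊢ with h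
  · omega
  · exact absurd rfl hj

lemma X : TotalDegreeLE 1 (Polynomial.X : Polynomial (MvPolynomial σ K)) := by
  intro j hj
  rw [Polynomial.coeff_X] at hj ⊢
  split_ifs at hj ⊢ with h
  · simp [← h]
  · exact absurd rfl hj

lemma one : TotalDegreeLE 0 (1 : Polynomial (MvPolynomial σ K)) := by
  have := C (σ := σ) (K := K) (D := 0) (a := 1) (by simp)
  simpa using this

lemma pow (hp : TotalDegreeLE D p) (n : ℕ) : TotalDegreeLE (n * D) (p ^ n) := by
  induction n with
  | zero => simpa using one
  | succ n ih => rw [pow_succ, Nat.succ_mul]; exact ih.mul hp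

lemma sum {ι : Type*} (s : Finset ι) (f : ι → Polynomial (MvPolynomial σ K))
    (h : ∀ i ∈ s, TotalDegreeLE D (f i)) : TotalDegreeLE D (∑ i ∈ s, f i) := by
  classical
  induction s using Finset.induction_on with
  | empty => simpa using zero
  | insert a s ha ih =>
    rw [Finset.sum_insert ha]
    exact (h a (by simp)).add (ih fun i hi => h i (by simp [hi]))

lemma prod_pow {ι : Type*} (s : Finset ι) (f : ι → Polynomial (MvPolynomial σ K)) (n : ι → ℕ)
    (h : ∀ i ∈ s, TotalDegreeLE 1 (f i)) : TotalDegreeLE (∑ i ∈ s, n i) (∏ i ∈ s, f i ^ n i) := by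
  classical
  induction s using Finset.induction_on with
  | empty => simpa using one
  | insert a s ha ih =>
    rw [Finset.prod_insert ha, Finset.sum_insert ha]
    refine TotalDegreeLE.mul ?_ (ih fun i hi => h i (by simp [hi]))
    simpa using (h a (by simp)).pow (n a)

lemma aeval {f : MvPolynomial σ K} (hf : f.totalDegree ≤ D)
    (g : σ → Polynomial (MvPolynomial σ K)) (hg : ∀ i, TotalDegreeLE 1 (g i)) :
    TotalDegreeLE D (MvPolynomial.aeval g f) := by
  rw [aeval_def, eval₂_eq]
  refine sum _ _ fun s hs => ?_
  have h1 : TotalDegreeLE (∑ i ∈ s.support, s i) (∏ i ∈ s.support, g i ^ s i) :=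
    prod_pow _ _ _ fun i _ => hg i
  have h2 := (C (σ := σ) (K := K) (D := 0) (a := MvPolynomial.C (coeff s f)) (by simp)).mul h1
  refine mono h2 ?_
  rw [zero_add]
  exact (le_totalDegree hs).trans hf

end TotalDegreeLE

/-- Division of `z^D` by a polynomial that is monic in `z` and has total degree `e`. -/
lemma exists_div_X_pow {e : ℕ} (he : 1 ≤ e) {g : Polynomial (MvPolynomial σ K)}
    (hg : TotalDegreeLE e g) (hg1 : g.coeff e = 1) (D : ℕ) :
    ∃ s r : Polynomial (MvPolynomial σ K), Polynomial.X ^ D = g * s + r ∧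
      (∀ j, e ≤ j → r.coeff j = 0) ∧ TotalDegreeLE D r := by
  induction D with
  | zero =>
    refine ⟨0, 1, by simp, fun j hj => ?_, TotalDegreeLE.one⟩
    rw [Polynomial.coeff_one, if_neg (by omega)]
  | succ D ih =>
    obtain ⟨s, r, h1, h2, h3⟩ := ih
    refine ⟨Polynomial.X * s + Polynomial.C (r.coeff (e - 1)),
      Polynomial.X * r - Polynomial.C (r.coeff (e - 1)) * g, ?_, ?_, ?_⟩
    · rw [pow_succ', h1]; ring
    · intro j hj
      obtain ⟨j, rfl⟩ : ∃ i, j = i + 1 := ⟨j - 1, by omega⟩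
      rw [Polynomial.coeff_sub, Polynomial.coeff_X_mul, Polynomial.coeff_C_mul]
      rcases Nat.eq_or_lt_of_le hj with h | h
      · rw [← h, hg1]
        simp [show e - 1 = j by omega]
      · have hgj : g.coeff (j + 1) = 0 := by
          by_contra hne
          have := hg _ hne
          omega
        rw [hgj, h2 j (by omega)]
        simp
    · refine TotalDegreeLE.sub ?_ ?_
      · rw [add_comm D 1]; exact TotalDegreeLE.X.mul h3
      · by_cases h0 : r.coeff (e - 1) = 0
        · rw [h0]; simpa using TotalDegreeLE.zero
        · have h4 := h3 _ h0
          refine ((TotalDegreeLE.C (D := D - (e - 1)) (by omega)).mul hg).mono ?_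
          omega

end Division

/-! ### Equality in the Schwartz–Zippel bound -/

/-- A monic divisor of a product of distinct linear factors is a subproduct. -/
lemma exists_eq_prod_of_monic_mul_eq {A ι : Type*} [CommRing A] [IsDomain A] [DecidableEq ι]
    (b : ι → A) (T : Finset ι) (g s : Polynomial A) (hg : g.Monic)
    (h : g * s = ∏ i ∈ T, (Polynomial.X - Polynomial.C (b i))) :
    ∃ S ⊆ T, g = ∏ i ∈ S, (Polynomial.X - Polynomial.C (b i)) := by
  induction T using Finset.induction_on generalizing g s with
  | empty =>
    refine ⟨∅, by simp, ?_⟩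
    rw [Finset.prod_empty] at h ⊢
    exact (hg.isUnit_iff).1 (IsUnit.of_mul_eq_one _ h)
  | insert a T ha ih =>
    rw [Finset.prod_insert ha] at h
    have hp := Polynomial.prime_X_sub_C (b a)
    rcases hp.dvd_or_dvd ⟨_, h⟩ with ⟨g', hg'⟩ | ⟨s', hs'⟩
    · rw [hg', mul_assoc] at h
      have hmon : g'.Monic := by
        rw [hg'] at hg
        exact (Polynomial.monic_X_sub_C _).of_mul_monic_left hg
      obtain ⟨S, hS, h'⟩ := ih g' s hmon (mul_left_cancel₀ hp.ne_zero h)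
      refine ⟨insert a S, Finset.insert_subset_insert _ hS, ?_⟩
      rw [Finset.prod_insert (fun hh => ha (hS hh)), hg', h']
    · rw [hs', mul_left_comm] at h
      obtain ⟨S, hS, hgS⟩ := ih g s' hg (mul_left_cancel₀ hp.ne_zero h)
      exact ⟨S, hS.trans (Finset.subset_insert _ _), hgS⟩

/-- The coefficient of `z^j` in `f(z w)` is the value at `w` of the degree `j` part of `f`. -/
lemma coeff_aeval_C_mul_X {K : Type*} [Field K] {σ : Type*} (w : σ → K) (f : MvPolynomial σ K)
    (j : ℕ) : (aeval (fun i => Polynomial.C (w i) * Polynomial.X) f : Polynomial K).coeff j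
      = eval w (homogeneousComponent j f) := by
  classical
  induction f using MvPolynomial.induction_on' with
  | monomial s a =>
    have h1 : (aeval (fun i => Polynomial.C (w i) * Polynomial.X) (monomial s a) : Polynomial K)
        = Polynomial.C (eval w (monomial s a)) * Polynomial.X ^ s.degree := by
      rw [aeval_monomial, eval_monomial, Finsupp.prod, Finsupp.prod]
      simp only [mul_pow, Finset.prod_mul_distrib, Finset.prod_pow_eq_pow_sum, map_mul, map_prod,
        map_pow]
      rw [← mul_assoc]
      rfl
    rw [h1, Polynomial.coeff_C_mul, Polynomial.coeff_X_pow,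
      homogeneousComponent_of_mem (isHomogeneous_monomial a (n := s.degree) rfl)]
    split_ifs <;> simp
  | add p q hp hq => simp [hp, hq]

/-- The linear form with coefficients `L`. -/
def linForm {K : Type*} [Field K] {σ : Type*} [Fintype σ] (L : σ → K) : MvPolynomial σ K :=
  ∑ i, C (L i) * X i

section LinForm

variable {K : Type*} [Field K] [Fintype K] {σ : Type*} [Fintype σ]

lemma linForm_pow_card (a : σ → K) :
    linForm a ^ Fintype.card K = ∑ i, C (a i) * X i ^ Fintype.card K := by
  have := map_sum (FiniteField.frobeniusAlgHom K (MvPolynomial σ K)) (fun i => C (a i) * X i)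
    Finset.univ
  simp only [FiniteField.coe_frobeniusAlgHom, mul_pow] at this
  rw [linForm, this]
  refine Finset.sum_congr rfl fun i _ => ?_
  rw [← map_pow, FiniteField.pow_card]

end LinForm

/-- A polynomial over `𝔽_q` attaining the Schwartz–Zippel bound is a product of parallel affine
hyperplanes. -/
theorem exists_eq_prod_of_zeroCount_eq {K : Type*} [Field K] [Fintype K] {m e : ℕ}
    {f : MvPolynomial (Fin (m + 1)) K} (hf : f ≠ 0) (hdeg : f.totalDegree ≤ e) (he : 1 ≤ e)
    (heq : e ≤ Fintype.card K) (hcount : zeroCount f = e * Fintype.card K ^ m) :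
    ∃ (c : K) (L : Fin (m + 1) → K) (S : Finset K), c ≠ 0 ∧ L ≠ 0 ∧ S.card = e ∧
      f = C c * ∏ a ∈ S, (linForm L - C a) := by
  classical
  set q := Fintype.card K with hq
  have hqpos : 0 < q := Fintype.card_pos
  have hq1 : 1 < q := Fintype.one_lt_card
  -- a direction in which the top form does not vanish
  obtain ⟨w, hw⟩ : ∃ w, eval w (homogeneousComponent e f) ≠ 0 := by
    by_contra! h
    have h0 := eq_zero_of_isHomogeneous (homogeneousComponent_isHomogeneous e f) heq h
    have hlt : f.totalDegree ≤ e - 1 := by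
      refine Finset.sup_le fun s hs => ?_
      by_contra hlt
      have h1 : s.degree ≤ e := (le_totalDegree hs).trans hdeg
      have h2 : s.degree = e := by
        have : e - 1 < s.degree := not_le.1 hlt
        omega
      have h3 := congrArg (coeff s) h0
      rw [coeff_homogeneousComponent, if_pos h2, coeff_zero] at h3
      exact mem_support_iff.1 hs h3
    have h2 := zeroCount_le hf hlt
    rw [hcount, ← hq] at h2
    have := Nat.le_of_mul_le_mul_right h2 (pow_pos hqpos m)
    omega
  set c := eval w (homogeneousComponent e f) with hc
  let g : Polynomial (MvPolynomial (Fin (m + 1)) K) :=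
    aeval (fun i => Polynomial.C (X i : MvPolynomial (Fin (m + 1)) K) + Polynomial.C (C (w i) : MvPolynomial (Fin (m + 1)) K) * Polynomial.X) f
  have hgW : TotalDegreeLE e g := by
    refine TotalDegreeLE.aeval hdeg _ fun i => TotalDegreeLE.add ?_ ?_
    · exact TotalDegreeLE.C (by simp)
    · simpa using (TotalDegreeLE.C (D := 0) (a := (C (w i) : MvPolynomial (Fin (m + 1)) K)) (by simp)).mul TotalDegreeLE.X
  have hspec : ∀ x : Fin (m + 1) → K, g.map (eval x) =
      aeval (fun i => Polynomial.C (x i) + Polynomial.C (w i) * Polynomial.X) f := by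
    intro x
    have : (Polynomial.mapRingHom (eval x)).comp
        (aeval (fun i => Polynomial.C (X i : MvPolynomial (Fin (m + 1)) K) + Polynomial.C (C (w i) : MvPolynomial (Fin (m + 1)) K) * Polynomial.X) :
          MvPolynomial (Fin (m + 1)) K →ₐ[K] Polynomial (MvPolynomial (Fin (m + 1)) K)).toRingHom =
        (aeval (fun i => Polynomial.C (x i) + Polynomial.C (w i) * Polynomial.X) :
          MvPolynomial (Fin (m + 1)) K →ₐ[K] Polynomial K).toRingHom := by
      apply MvPolynomial.ringHom_ext
      · intro a
        simp [MvPolynomial.algebraMap_eq, Polynomial.algebraMap_apply]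
      · intro i
        simp
    exact congrArg (fun φ => φ f) this
  -- The total degree of `g` is at most `e`, so the coefficient of `z^e` is a constant and can be
  -- read off at the origin.
  have hge : g.coeff e = C c := by
    have h0 : (g.coeff e).totalDegree = 0 := by
      by_cases h : g.coeff e = 0
      · simp [h]
      · have := hgW e h; omega
    rw [totalDegree_eq_zero_iff_eq_C] at h0
    have h1 : eval 0 (g.coeff e) = c := by
      rw [← Polynomial.coeff_map, hspec 0, hc, ← coeff_aeval_C_mul_X]
      simp
    rw [h0] at h1 ⊢
    rw [eval_C] at h1
    rw [h1]
  have heval : ∀ (x : Fin (m + 1) → K) (z : K),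
      (g.map (eval x)).eval z = eval (x + z • w) f := by
    intro x z
    rw [hspec]
    have : (Polynomial.aeval z : Polynomial K →ₐ[K] K).comp
        (aeval (fun i => Polynomial.C (x i) + Polynomial.C (w i) * Polynomial.X) :
          MvPolynomial (Fin (m + 1)) K →ₐ[K] Polynomial K) = aeval (x + z • w) := by
      apply MvPolynomial.algHom_ext
      intro i
      rw [AlgHom.comp_apply, aeval_X, aeval_X, map_add, map_mul, Polynomial.aeval_C,
        Polynomial.aeval_C, Polynomial.aeval_X]
      exact congrArg (x i + ·) (mul_comm _ _)
    have h1 := congrArg (fun φ => φ f) this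
    simp only [AlgHom.comp_apply, aeval_eq_eval] at h1
    rw [← h1, Polynomial.coe_aeval_eq_eval]
  have hdegx : ∀ x, (g.map (eval x)).natDegree ≤ e := by
    intro x
    rw [Polynomial.natDegree_le_iff_coeff_eq_zero]
    intro j hj
    rw [Polynomial.coeff_map]
    have : g.coeff j = 0 := by
      by_contra h
      have := hgW j h
      omega
    rw [this, map_zero]
  have hnex : ∀ x, g.map (eval x) ≠ 0 := by
    intro x h
    have := congrArg (fun p => p.coeff e) h
    simp only [Polynomial.coeff_map, hge, eval_C, Polynomial.coeff_zero] at this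
    exact hw this
  -- every line in direction `w` carries exactly `e` zeros
  let ν : (Fin (m + 1) → K) → ℕ := fun x =>
    (Finset.univ.filter fun z : K => eval (x + z • w) f = 0).card
  have hν : ∀ x, ν x ≤ e := by
    intro x
    refine le_trans ?_ (((g.map (eval x)).card_roots').trans (hdegx x))
    refine le_trans (Finset.card_le_card ?_) (Multiset.toFinset_card_le _)
    intro z hz
    rw [Multiset.mem_toFinset, Polynomial.mem_roots (hnex x), Polynomial.IsRoot, heval]
    simpa using hz
  -- Each of the `q` translations by `z • w` contributes all zeros of `f`. The total `q * (e * q ^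
  -- m)` makes the average of `ν` equal to its upper bound `e`.
  have hsum : ∑ x, ν x = ∑ _x : Fin (m + 1) → K, e := by
    have h1 : ∑ x, ν x = ∑ z : K, zeroCount f := by
      simp only [ν, Finset.card_filter]
      rw [Finset.sum_comm]
      refine Finset.sum_congr rfl fun z _ => ?_
      rw [zeroCount, Nat.card_eq_fintype_card, Fintype.card_subtype, Finset.card_filter]
      exact Fintype.sum_equiv (Equiv.addRight (z • w)) _ _ fun x => rfl
    rw [h1, hcount]
    simp [← hq]
    ring
  have hνe : ∀ x, ν x = e := fun x =>
    (Finset.sum_eq_sum_iff_of_le fun i _ => hν i).1 hsum x (Finset.mem_univ x)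
  -- division of `z^q - z`
  let g₁ : Polynomial (MvPolynomial (Fin (m + 1)) K) := Polynomial.C (C c⁻¹) * g
  have hcc : (C c⁻¹ : MvPolynomial (Fin (m + 1)) K) * C c = 1 := by rw [← C_mul, inv_mul_cancel₀ hw, C_1]
  have hg₁W : TotalDegreeLE e g₁ := by
    simpa using (TotalDegreeLE.C (D := 0) (a := (C c⁻¹ : MvPolynomial (Fin (m + 1)) K)) (by simp)).mul hgW
  have hg₁e : g₁.coeff e = 1 := by
    rw [Polynomial.coeff_C_mul, hge, hcc]
  have hgg₁ : g = Polynomial.C (C c) * g₁ := by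
    rw [← mul_assoc, ← Polynomial.C_mul, mul_comm (C c), hcc, Polynomial.C_1, one_mul]
  obtain ⟨s₁, r₁, hd₁, hr₁, hW₁⟩ := exists_div_X_pow he hg₁W hg₁e q
  obtain ⟨s₂, r₂, hd₂, hr₂, hW₂⟩ := exists_div_X_pow he hg₁W hg₁e 1
  set s := s₁ - s₂ with hs
  set r := r₁ - r₂ with hr
  have hdiv : Polynomial.X ^ q - Polynomial.X = g₁ * s + r := by
    rw [hd₁, ← pow_one (Polynomial.X : Polynomial (MvPolynomial (Fin (m + 1)) K)), hd₂]; ring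
  have hrW : TotalDegreeLE q r := hW₁.sub (hW₂.mono hqpos)
  have hrdeg : ∀ j, e ≤ j → r.coeff j = 0 := fun j hj => by
    rw [hr, Polynomial.coeff_sub, hr₁ j hj, hr₂ j hj, sub_zero]
  -- At a rational `x` the polynomial `g` has `e` distinct roots in `K`. They are roots of `z^q - z`
  -- as well, hence of the remainder, whose degree is less than `e`.
  have hrx : ∀ x, r.map (eval x) = 0 := by
    intro x
    by_contra hne
    have h1 : (r.map (eval x)).natDegree < e := by
      rw [Polynomial.natDegree_lt_iff_degree_lt hne, Polynomial.degree_lt_iff_coeff_zero]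
      intro j hj
      rw [Polynomial.coeff_map, hrdeg j hj, map_zero]
    have h2 : ν x ≤ (r.map (eval x)).natDegree := by
      refine le_trans ?_ ((r.map (eval x)).card_roots')
      refine le_trans (Finset.card_le_card ?_) (Multiset.toFinset_card_le _)
      intro z hz
      rw [Multiset.mem_toFinset, Polynomial.mem_roots hne, Polynomial.IsRoot]
      have hz0 : (g.map (eval x)).eval z = 0 := by rw [heval]; simpa using hz
      have h3 := congrArg (fun p => (p.map (eval x)).eval z) hdiv
      simp only [Polynomial.map_sub, Polynomial.map_pow, Polynomial.map_X, Polynomial.eval_sub,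
        Polynomial.eval_pow, Polynomial.eval_X, FiniteField.pow_card, sub_self, hq,
        Polynomial.map_add, Polynomial.map_mul, Polynomial.eval_add, Polynomial.eval_mul, g₁,
        hz0, mul_zero, zero_mul, zero_add] at h3
      exact h3.symm
    rw [hνe] at h2
    omega
  have hrj : ∀ j x, eval x (r.coeff j) = 0 := fun j x => by
    rw [← Polynomial.coeff_map, hrx, Polynomial.coeff_zero]
  -- The coefficient of `z^j` has degree at most `q - j` and vanishes at all rational vectors, so it
  -- is zero for `j ≥ 1`. For `j = 0` degree `q` is possible, and what survives is a `K`-combination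
  -- of the `X_i^q - X_i`, that is `ℓ^q - ℓ` with `ℓ` linear.
  have hrj0 : ∀ j, 1 ≤ j → r.coeff j = 0 := by
    intro j hj
    by_contra h
    have h1 := hrW j h
    exact h (eq_zero_of_totalDegree_lt (by omega) (hrj j))
  have hr0 : (r.coeff 0).totalDegree ≤ Fintype.card K + 0 := by
    by_cases h : r.coeff 0 = 0
    · simp [h]
    · have := hrW 0 h; omega
  obtain ⟨h, hh, hr0'⟩ := exists_eq_sum_mul_of_eval_eq_zero hr0 (hrj 0)
  have hh' : ∀ i, h i = C (coeff 0 (h i)) := fun i =>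
    totalDegree_eq_zero_iff_eq_C.1 (Nat.le_zero.1 (hh i))
  set a : Fin (m + 1) → K := fun i => coeff 0 (h i) with ha
  set ℓ : MvPolynomial (Fin (m + 1)) K := linForm a with hℓ
  have hr0'' : r.coeff 0 = ℓ ^ q - ℓ := by
    rw [hr0', hℓ, hq, linForm_pow_card, linForm, ← Finset.sum_sub_distrib]
    refine Finset.sum_congr rfl fun i _ => ?_
    conv_lhs => rw [hh' i]
    ring
  have hrC : r = Polynomial.C (ℓ ^ q - ℓ) := by
    ext1 j
    rw [Polynomial.coeff_C]
    split_ifs with hj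
    · rw [hj, hr0'']
    · exact hrj0 j (by omega)
  -- By additivity of the `q`-th power, `z^q - z - (ℓ^q - ℓ) = (z - ℓ)^q - (z - ℓ)`, a product of
  -- distinct linear factors in `z`; the monic divisor `g₁` is a subproduct.
  have hfac : g₁ * s = ∏ b ∈ (Finset.univ : Finset K), (Polynomial.X - Polynomial.C (ℓ + C b)) := by
    have h1 : g₁ * s = (Polynomial.X - Polynomial.C ℓ) ^ q - (Polynomial.X - Polynomial.C ℓ) := by
      have h2 : (Polynomial.X - Polynomial.C ℓ : Polynomial (MvPolynomial (Fin (m + 1)) K)) ^ q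
          = Polynomial.X ^ q - Polynomial.C ℓ ^ q :=
        map_sub (FiniteField.frobeniusAlgHom K (Polynomial (MvPolynomial (Fin (m + 1)) K))) _ _
      rw [h2, eq_sub_of_add_eq hdiv.symm, hrC, Polynomial.C_sub, Polynomial.C_pow]
      ring
    rw [h1, hq, ← prod_X_sub_C_univ]
    refine Finset.prod_congr rfl fun b _ => ?_
    rw [Polynomial.C_add, Polynomial.algebraMap_apply, MvPolynomial.algebraMap_eq]
    ring
  have hg₁deg : g₁.natDegree ≤ e := by
    rw [Polynomial.natDegree_le_iff_coeff_eq_zero]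
    intro j hj
    by_contra h
    have := hg₁W j h
    omega
  have hmon : g₁.Monic := Polynomial.monic_of_natDegree_le_of_coeff_eq_one e hg₁deg hg₁e
  obtain ⟨S, -, hS⟩ := exists_eq_prod_of_monic_mul_eq (fun b : K => ℓ + C b) _ g₁ s hmon hfac
  have hScard : S.card = e := by
    have h1 : g₁.natDegree = S.card := by
      rw [hS, Polynomial.natDegree_prod_of_monic _ _ fun b _ => Polynomial.monic_X_sub_C _]
      simp only [Polynomial.natDegree_X_sub_C, Finset.sum_const, smul_eq_mul, mul_one]
    have h2 : e ≤ g₁.natDegree := Polynomial.le_natDegree_of_ne_zero (by rw [hg₁e]; exact one_ne_zero)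
    omega
  have hfinal : f = C c * ∏ b ∈ S, (linForm (fun i => - a i) - C b) := by
    -- `g` is `f` along the generic line `x + z w`, so `z = 0` recovers `f`.
    have h1 : g.eval 0 = f := by
      have : ((Polynomial.evalRingHom (0 : MvPolynomial (Fin (m + 1)) K)).comp
          (aeval (fun i => Polynomial.C (X i : MvPolynomial (Fin (m + 1)) K) + Polynomial.C (C (w i) : MvPolynomial (Fin (m + 1)) K) * Polynomial.X) :
            MvPolynomial (Fin (m + 1)) K →ₐ[K] Polynomial (MvPolynomial (Fin (m + 1)) K)).toRingHom) = RingHom.id (MvPolynomial (Fin (m + 1)) K) := by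
        apply MvPolynomial.ringHom_ext
        · intro b
          simp [MvPolynomial.algebraMap_eq, Polynomial.algebraMap_apply]
        · intro i
          simp
      exact congrArg (fun φ => φ f) this
    rw [← h1, hgg₁, hS, Polynomial.eval_mul, Polynomial.eval_C, Polynomial.eval_prod]
    congr 1
    refine Finset.prod_congr rfl fun b _ => ?_
    have : (linForm (fun i => - a i) : MvPolynomial (Fin (m + 1)) K) = - ℓ := by
      simp [linForm, hℓ]
    rw [this]
    simp only [Polynomial.eval_sub, Polynomial.eval_X, Polynomial.eval_C]
    ring
  refine ⟨c, fun i => - a i, S, hw, fun h0 => ?_, hScard, hfinal⟩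
  -- If the linear form were zero, `f` would be a nonzero constant without zeros, against the
  -- positive count.
  have hconst : f = C (c * ∏ b ∈ S, (- b)) := by
    rw [hfinal, h0]
    simp [linForm]
  have hne : c * ∏ b ∈ S, (- b) ≠ 0 := fun h => hf (by rw [hconst, h, C_0])
  have h0' : zeroCount f = 0 := by
    rw [zeroCount, Nat.card_eq_zero]
    left
    refine ⟨fun x => hne ?_⟩
    have h1 := x.2
    generalize x.1 = y at h1
    rwa [hconst, eval_C] at h1
  rw [h0'] at hcount
  have : 0 < e * q ^ m := Nat.mul_pos he (pow_pos hqpos m)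
  omega

/-! ### Evaluation of forms, linear substitutions and equivalence -/

lemma aeval_smul_of_isHomogeneous {R A σ : Type*} [CommRing R] [CommRing A] [Algebra R A] {d : ℕ}
    {F : MvPolynomial σ R} (hF : F.IsHomogeneous d) (c : A) (x : σ → A) :
    aeval (c • x) F = c ^ d * aeval x F := by
  rw [aeval_def, aeval_def, eval₂_eq, eval₂_eq, Finset.mul_sum]
  refine Finset.sum_congr rfl fun s hs => ?_
  simp only [Pi.smul_apply, smul_eq_mul, mul_pow, Finset.prod_mul_distrib,
    Finset.prod_pow_eq_pow_sum]
  rw [← hF (mem_support_iff.1 hs), Finsupp.weight_apply, Finsupp.sum]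
  simp only [Pi.one_apply, smul_eq_mul, mul_one]
  ring

lemma eval_smul_of_isHomogeneous {R σ : Type*} [CommRing R] {d : ℕ}
    {F : MvPolynomial σ R} (hF : F.IsHomogeneous d) (c : R) (x : σ → R) :
    eval (c • x) F = c ^ d * eval x F := by
  simpa [aeval_eq_eval] using aeval_smul_of_isHomogeneous hF c x

lemma eval_zero_of_isHomogeneous {R σ : Type*} [CommRing R] {d : ℕ} (hd : d ≠ 0)
    {F : MvPolynomial σ R} (hF : F.IsHomogeneous d) : eval 0 F = 0 := by
  simpa [hd] using eval_smul_of_isHomogeneous hF 0 0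

section Substitution

variable {K : Type*} [Field K] {σ τ ρ : Type*} [Fintype τ] [Fintype σ] [Fintype ρ]

lemma aeval_linForm {A : Type*} [CommRing A] [Algebra K A] (L : σ → K) (x : σ → A) :
    aeval x (linForm L) = ∑ i, algebraMap K A (L i) * x i := by
  simp [linForm]

lemma eval_linForm (L x : σ → K) : eval x (linForm L) = L ⬝ᵥ x := by
  simp [linForm, dotProduct]

lemma isHomogeneous_linForm (L : σ → K) : (linForm L).IsHomogeneous 1 :=
  IsHomogeneous.sum _ _ _ fun i _ => isHomogeneous_C_mul_X (L i) i

/-- Substitution of the linear forms given by the rows of `M`. -/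
def lsub {σ : Type*} (M : Matrix σ τ K) : MvPolynomial σ K →ₐ[K] MvPolynomial τ K :=
  aeval fun i => linForm (M i)

lemma aeval_lsub {σ A : Type*} [CommRing A] [Algebra K A] (M : Matrix σ τ K) (x : τ → A)
    (F : MvPolynomial σ K) :
    aeval x (lsub M F) = aeval (fun i => ∑ j, algebraMap K A (M i j) * x j) F := by
  have : (aeval x).comp (lsub M) = aeval (fun i => ∑ j, algebraMap K A (M i j) * x j) := by
    apply MvPolynomial.algHom_ext
    intro i
    simp [lsub, aeval_linForm]
  exact congrArg (fun φ => φ F) this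

lemma eval_lsub {σ : Type*} (M : Matrix σ τ K) (x : τ → K) (F : MvPolynomial σ K) :
    eval x (lsub M F) = eval (M.mulVec x) F := by
  have := aeval_lsub M x F
  simp only [aeval_eq_eval] at this
  exact this

lemma lsub_linForm (M : Matrix σ τ K) (L : σ → K) :
    lsub M (linForm L) = linForm (Matrix.vecMul L M) := by
  simp only [lsub, linForm, map_sum, map_mul, algHom_C, aeval_X, algebraMap_eq, Finset.mul_sum,
    Matrix.vecMul, dotProduct, Finset.sum_mul]
  rw [Finset.sum_comm]
  refine Finset.sum_congr rfl fun j _ => Finset.sum_congr rfl fun i _ => by ring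

lemma lsub_lsub {σ : Type*} (M : Matrix σ τ K) (N : Matrix τ ρ K) (F : MvPolynomial σ K) :
    lsub N (lsub M F) = lsub (M * N) F := by
  have : (lsub N).comp (lsub M) = lsub (M * N) := by
    apply MvPolynomial.algHom_ext
    intro i
    rw [AlgHom.comp_apply]
    simp only [lsub, aeval_X]
    exact lsub_linForm N (M i)
  exact congrArg (fun φ => φ F) this

lemma lsub_one [DecidableEq σ] (F : MvPolynomial σ K) : lsub (1 : Matrix σ σ K) F = F := by
  have : lsub (1 : Matrix σ σ K) = AlgHom.id K _ := by
    apply MvPolynomial.algHom_ext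
    intro i
    simp [lsub, linForm, Matrix.one_apply]
  rw [this, AlgHom.id_apply]

lemma isHomogeneous_lsub {σ : Type*} {F : MvPolynomial σ K} {d : ℕ} (hF : F.IsHomogeneous d)
    (M : Matrix σ τ K) : (lsub M F).IsHomogeneous d := by
  have := hF.aeval (fun i => linForm (M i)) fun i => isHomogeneous_linForm (M i)
  rwa [one_mul] at this

lemma pderiv_lsub [DecidableEq τ] (M : Matrix σ τ K) (j : τ) (F : MvPolynomial σ K) :
    pderiv j (lsub M F) = ∑ i, C (M i j) * lsub M (pderiv i F) := by
  classical
  induction F using MvPolynomial.induction_on with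
  | C a => simp
  | add p q hp hq => simp [hp, hq, mul_add, Finset.sum_add_distrib]
  | mul_X p i hp =>
    have hX : pderiv j (lsub M (X i)) = C (M i j) := by
      simp [lsub, linForm, pderiv_X, Pi.single_apply]
    rw [map_mul, pderiv_mul, hp, hX]
    simp only [pderiv_mul, pderiv_X, map_add, map_mul, mul_add, Finset.sum_add_distrib,
      Finset.sum_mul]
    congr 1
    · exact Finset.sum_congr rfl fun k _ => by ring
    · rw [Finset.sum_eq_single i]
      · simp; ring
      · intro k _ hk
        simp [hk.symm]
      · simp

/-- Nonsingularity of `F = 0`, for an arbitrary set of variables. -/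
def Nonsing {σ : Type*} (F : MvPolynomial σ K) : Prop :=
  ∀ x : σ → AlgebraicClosure K, x ≠ 0 → aeval x F = 0 → ∃ i, aeval x (pderiv i F) ≠ 0

/-- `F` and `G` agree up to a linear change of variables and a scalar. -/
def LinEquivalent [DecidableEq σ] [DecidableEq τ] (F : MvPolynomial σ K)
    (G : MvPolynomial τ K) : Prop :=
  ∃ (M : Matrix σ τ K) (N : Matrix τ σ K), M * N = 1 ∧ N * M = 1 ∧
    ∃ c : K, c ≠ 0 ∧ lsub M F = C c * G

variable [DecidableEq σ] [DecidableEq τ] [DecidableEq ρ]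

lemma Nonsing.lsub {F : MvPolynomial σ K} (hF : Nonsing F) {M : Matrix σ τ K} {N : Matrix τ σ K}
    (hMN : M * N = 1) (hNM : N * M = 1) : Nonsing (lsub M F) := by
  intro x hx h0
  rw [aeval_lsub] at h0
  set φ := algebraMap K (AlgebraicClosure K)
  have hy : (fun i => ∑ j, φ (M i j) * x j) = (M.map φ).mulVec x := rfl
  have hne : (fun i => ∑ j, φ (M i j) * x j) ≠ 0 := by
    rw [hy]
    intro h
    apply hx
    have h1 : (N.map φ).mulVec ((M.map φ).mulVec x) = x := by
      rw [Matrix.mulVec_mulVec, ← Matrix.map_mul, hNM, Matrix.map_one _ (map_zero _) (map_one _),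
        Matrix.one_mulVec]
    rw [← h1, h, Matrix.mulVec_zero]
  obtain ⟨i, hi⟩ := hF _ hne h0
  by_contra! hcon
  apply hi
  set u : σ → AlgebraicClosure K := fun i => aeval (fun i => ∑ j, φ (M i j) * x j) (pderiv i F)
  have h2 : ∀ j, ∑ i, φ (M i j) * u i = 0 := by
    intro j
    have := hcon j
    rw [pderiv_lsub, map_sum] at this
    simpa only [map_mul, aeval_lsub, algHom_C] using this
  have h3 : Matrix.vecMul u (M.map φ) = 0 := by
    ext j
    rw [Matrix.vecMul, dotProduct, Pi.zero_apply, ← h2 j]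
    exact Finset.sum_congr rfl fun i _ => by simp [mul_comm]
  have h4 : Matrix.vecMul (Matrix.vecMul u (M.map φ)) (N.map φ) = u := by
    rw [Matrix.vecMul_vecMul, ← Matrix.map_mul, hMN, Matrix.map_one _ (map_zero _) (map_one _),
      Matrix.vecMul_one]
  rw [h3, Matrix.zero_vecMul] at h4
  exact (congrFun h4 i).symm

namespace LinEquivalent

variable {F : MvPolynomial σ K} {G : MvPolynomial τ K} {H : MvPolynomial ρ K}

lemma of_lsub {M : Matrix σ τ K} {N : Matrix τ σ K} (h₁ : M * N = 1) (h₂ : N * M = 1)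
    (F : MvPolynomial σ K) : LinEquivalent F (FqHypersurface.lsub M F) :=
  ⟨M, N, h₁, h₂, 1, one_ne_zero, by simp⟩

lemma of_C_mul {c : K} (hc : c ≠ 0) (F : MvPolynomial σ K) : LinEquivalent F (C c * F) :=
  ⟨1, 1, by simp, by simp, c⁻¹, inv_ne_zero hc, by
    rw [lsub_one, ← mul_assoc, ← C_mul, inv_mul_cancel₀ hc, C_1, one_mul]⟩

lemma symm (h : LinEquivalent F G) : LinEquivalent G F := by
  obtain ⟨M, N, h₁, h₂, c, hc, h⟩ := h
  refine ⟨N, M, h₂, h₁, c⁻¹, inv_ne_zero hc, ?_⟩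
  have := congrArg (FqHypersurface.lsub N) h
  rw [lsub_lsub, h₁, lsub_one, map_mul, algHom_C, algebraMap_eq] at this
  rw [this, ← mul_assoc, ← C_mul, inv_mul_cancel₀ hc, C_1, one_mul]

lemma trans (h : LinEquivalent F G) (h' : LinEquivalent G H) : LinEquivalent F H := by
  obtain ⟨M, N, h₁, h₂, c, hc, h⟩ := h
  obtain ⟨M', N', h₁', h₂', c', hc', h'⟩ := h'
  refine ⟨M * M', N' * N, ?_, ?_, c * c', mul_ne_zero hc hc', ?_⟩
  · rw [Matrix.mul_assoc, ← Matrix.mul_assoc M', h₁', Matrix.one_mul, h₁]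
  · rw [Matrix.mul_assoc, ← Matrix.mul_assoc N, h₂, Matrix.one_mul, h₂']
  · rw [← lsub_lsub, h, map_mul, h', algHom_C, algebraMap_eq, C_mul, mul_assoc]

lemma zeroCount_eq (h : LinEquivalent F G) : zeroCount F = zeroCount G := by
  obtain ⟨M, N, h₁, h₂, c, hc, h⟩ := h
  refine Nat.card_congr ?_
  refine Equiv.subtypeEquiv ⟨fun x => N.mulVec x, fun y => M.mulVec y, fun x => ?_, fun y => ?_⟩ ?_
  · show M.mulVec (N.mulVec x) = x
    rw [Matrix.mulVec_mulVec, h₁, Matrix.one_mulVec]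
  · show N.mulVec (M.mulVec y) = y
    rw [Matrix.mulVec_mulVec, h₂, Matrix.one_mulVec]
  · intro x
    have : c * eval (N.mulVec x) G = eval x F := by
      have := congrArg (eval (N.mulVec x)) h
      rw [eval_lsub, Matrix.mulVec_mulVec, h₁, Matrix.one_mulVec] at this
      rw [this, map_mul, eval_C]
    show eval x F = 0 ↔ eval (N.mulVec x) G = 0
    rw [← this, mul_eq_zero, or_iff_right hc]

end LinEquivalent

lemma projEquiv_iff {n : ℕ} {F G : MvPolynomial (Fin (n + 2)) K} :
    ProjEquiv F G ↔ LinEquivalent F G := by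
  constructor
  · rintro ⟨M, c, hc, h⟩
    exact ⟨M.1, M.2, M.3, M.4, c, hc, h⟩
  · rintro ⟨M, N, h₁, h₂, c, hc, h⟩
    exact ⟨⟨M, N, h₁, h₂⟩, c, hc, h⟩

end Substitution

/-! ### Projective points and the affine cone -/

section Count

variable {K : Type*} [Field K] [Fintype K] {n : ℕ}

/-- Every projective point has `q - 1` representatives, and the summand `1` is the origin. -/
lemma numPoints_mul_add_one {F : MvPolynomial (Fin (n + 2)) K} {d : ℕ} (hd : d ≠ 0)
    (hF : F.IsHomogeneous d) :
    numPoints F * (Fintype.card K - 1) + 1 = zeroCount F := by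
  classical
  let f : {p : Projectivization K (Fin (n + 2) → K) // eval p.rep F = 0} × Kˣ →
      {x : Fin (n + 2) → K // eval x F = 0 ∧ x ≠ 0} := fun pc =>
    ⟨(pc.2 : K) • pc.1.1.rep, by rw [eval_smul_of_isHomogeneous hF, pc.1.2, mul_zero],
      smul_ne_zero pc.2.ne_zero pc.1.1.rep_nonzero⟩
  have hf : Function.Bijective f := by
    constructor
    · rintro ⟨⟨p, hp⟩, c⟩ ⟨⟨p', hp'⟩, c'⟩ h
      have h1 : (c : K) • p.rep = (c' : K) • p'.rep := congrArg Subtype.val h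
      have h2 : p = p' := by
        rw [← p.mk_rep, ← p'.mk_rep, Projectivization.mk_eq_mk_iff]
        refine ⟨c⁻¹ * c', ?_⟩
        rw [mul_smul, Units.smul_def c', ← h1, ← Units.smul_def, inv_smul_smul]
      subst h2
      have h3 : (c : K) = c' := smul_left_injective K p.rep_nonzero h1
      rw [Units.ext h3]
    · rintro ⟨x, hx, hx0⟩
      obtain ⟨a, ha⟩ := Projectivization.exists_smul_eq_mk_rep K x hx0
      have h1 : ((a⁻¹ : Kˣ) : K) • (Projectivization.mk K x hx0).rep = x := by
        rw [← ha, ← Units.smul_def, inv_smul_smul]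
      refine ⟨⟨⟨Projectivization.mk K x hx0, ?_⟩, a⁻¹⟩, Subtype.ext h1⟩
      rw [← ha, Units.smul_def, eval_smul_of_isHomogeneous hF, hx, mul_zero]
  have h1 := Nat.card_congr (Equiv.ofBijective f hf)
  rw [Nat.card_prod, Nat.card_eq_fintype_card (α := Kˣ), Fintype.card_units] at h1
  rw [numPoints, h1, zeroCount, Nat.card_eq_fintype_card, Nat.card_eq_fintype_card,
    Fintype.card_subtype, Fintype.card_subtype]
  have h0 : (0 : Fin (n + 2) → K) ∈ Finset.univ.filter fun x => eval x F = 0 := by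
    rw [Finset.mem_filter]
    exact ⟨Finset.mem_univ _, eval_zero_of_isHomogeneous hd hF⟩
  rw [← Finset.card_erase_add_one h0]
  congr 2
  ext x
  simp [and_comm]

end Count

/-! ### Polynomials `G(x, y)` in two groups of variables -/

section Split

variable {K : Type*} [Field K] {α β : Type*}

/-- The specialization `G(x, v)` of `G(x, y)`. -/
def spec (v : β → K) : MvPolynomial (α ⊕ β) K →ₐ[K] MvPolynomial α K :=
  aeval (Sum.elim X (C ∘ v))

/-- The coefficient of the monomial `x^s` in `G(x, y)`, a polynomial in `y`. -/
def xcoeff (s : α →₀ ℕ) (G : MvPolynomial (α ⊕ β) K) : MvPolynomial β K :=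
  coeff s (sumAlgEquiv K α β G)

lemma spec_eq_map (v : β → K) (G : MvPolynomial (α ⊕ β) K) :
    spec v G = map (eval v) (sumAlgEquiv K α β G) := by
  have : (spec v : MvPolynomial (α ⊕ β) K →ₐ[K] MvPolynomial α K).toRingHom =
      (map (eval v)).comp (sumAlgEquiv K α β).toRingEquiv.toRingHom := by
    apply MvPolynomial.ringHom_ext
    · intro a
      simp [spec]
    · rintro (i | j)
      · simp [spec]
      · simp [spec]
  exact congrArg (fun φ => φ G) this

lemma coeff_spec (v : β → K) (s : α →₀ ℕ) (G : MvPolynomial (α ⊕ β) K) :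
    coeff s (spec v G) = eval v (xcoeff s G) := by
  rw [spec_eq_map, coeff_map, xcoeff]

lemma coeff_xcoeff (s : α →₀ ℕ) (t : β →₀ ℕ) (G : MvPolynomial (α ⊕ β) K) :
    coeff t (xcoeff s G) = coeff (Finsupp.sumElim s t) G := by
  classical
  rw [xcoeff]
  induction G using MvPolynomial.induction_on' with
  | add p q hp hq => simp [hp, hq]
  | monomial u a =>
    obtain ⟨s₀, t₀, rfl⟩ : ∃ (s₀ : α →₀ ℕ) (t₀ : β →₀ ℕ), u = Finsupp.sumElim s₀ t₀ :=
      ⟨_, _, (Finsupp.comapDomain_sumElim_comapDomain u).symm⟩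
    have hu : monomial (Finsupp.sumElim s₀ t₀) a
        = rename Sum.inl (monomial s₀ (1 : K)) * rename Sum.inr (monomial t₀ a) := by
      rw [rename_monomial, rename_monomial, monomial_mul, one_mul, Finsupp.sumElim_eq_add]
    have h1 : sumAlgEquiv K α β (rename Sum.inl (monomial s₀ (1 : K))) = monomial s₀ 1 := by
      have := DFunLike.congr_fun (sumAlgEquiv_comp_rename_inl (R := K) (S₁ := α) (S₂ := β))
        (monomial s₀ (1 : K))
      refine this.trans ?_
      rw [mapAlgHom_apply, map_monomial, map_one]
    have h2 : sumAlgEquiv K α β (rename Sum.inr (monomial t₀ a)) = C (monomial t₀ a) :=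
      DFunLike.congr_fun (sumAlgEquiv_comp_rename_inr (R := K) (S₁ := α) (S₂ := β))
        (monomial t₀ a)
    rw [coeff_monomial, hu, map_mul, h1, h2, mul_comm, C_mul_monomial, mul_one, coeff_monomial]
    by_cases hs : s₀ = s
    · subst hs
      rw [if_pos rfl, coeff_monomial]
      refine if_congr ⟨fun h => by rw [h], fun h => ?_⟩ rfl rfl
      ext j
      simpa using DFunLike.congr_fun h (Sum.inr j)
    · rw [if_neg hs, coeff_zero, if_neg]
      intro h
      apply hs
      ext i
      simpa using DFunLike.congr_fun h (Sum.inl i)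

lemma degree_sumElim (s : α →₀ ℕ) (t : β →₀ ℕ) :
    (Finsupp.sumElim s t : α ⊕ β →₀ ℕ).degree
      = s.degree + t.degree := by
  rw [Finsupp.sumElim_eq_add, map_add, Finsupp.degree_mapDomain, Finsupp.degree_mapDomain]

lemma ext_xcoeff {G G' : MvPolynomial (α ⊕ β) K} (h : ∀ s, xcoeff s G = xcoeff s G') : G = G' := by
  apply (sumAlgEquiv K α β).injective
  ext1 s
  exact h s

lemma isHomogeneous_xcoeff {G : MvPolynomial (α ⊕ β) K} {d : ℕ} (hG : G.IsHomogeneous d)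
    (s : α →₀ ℕ) : (xcoeff s G).IsHomogeneous (d - s.degree) := by
  intro t ht
  rw [coeff_xcoeff] at ht
  have h : (Finsupp.sumElim s t).degree = d := by
    by_contra hne
    exact ht (hG.coeff_eq_zero hne)
  refine (DFunLike.congr_fun Finsupp.degree_eq_weight_one t).symm.trans ?_
  rw [degree_sumElim] at h
  omega

lemma xcoeff_eq_zero_of_lt {G : MvPolynomial (α ⊕ β) K} {d : ℕ} (hG : G.IsHomogeneous d)
    {s : α →₀ ℕ} (hs : d < s.degree) : xcoeff s G = 0 := by
  ext t
  rw [coeff_xcoeff, coeff_zero]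
  apply hG.coeff_eq_zero
  rw [degree_sumElim]
  omega

lemma xcoeff_pderiv_inr (j : β) (s : α →₀ ℕ) (G : MvPolynomial (α ⊕ β) K) :
    xcoeff s (pderiv (Sum.inr j) G) = pderiv j (xcoeff s G) := by
  ext t
  rw [coeff_pderiv, coeff_xcoeff, coeff_xcoeff, coeff_pderiv, Finsupp.sumElim_inr]
  congr 2
  rw [← Finsupp.sumElim_zero_single, ← Finsupp.sumElim_add, add_zero]

lemma xcoeff_X_inr_pow_mul (j : β) (k : ℕ) (s : α →₀ ℕ) (G : MvPolynomial (α ⊕ β) K) :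
    xcoeff s (X (Sum.inr j) ^ k * G) = X j ^ k * xcoeff s G := by
  rw [xcoeff, map_mul, map_pow, sumAlgEquiv_X_inr, ← map_pow, coeff_C_mul, xcoeff]

lemma eval_spec (x : α → K) (v : β → K) (G : MvPolynomial (α ⊕ β) K) :
    eval x (spec v G) = eval (Sum.elim x v) G := by
  have : (aeval x : _ →ₐ[K] K).comp (spec v) = aeval (Sum.elim x v) := by
    apply MvPolynomial.algHom_ext
    rintro (i | j) <;> simp [spec]
  have := congrArg (fun φ => φ G) this
  simp only [AlgHom.comp_apply, aeval_eq_eval] at this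
  exact this

lemma spec_pderiv_inl (v : β → K) (i : α) (G : MvPolynomial (α ⊕ β) K) :
    spec v (pderiv (Sum.inl i) G) = pderiv i (spec v G) :=
  aeval_sumElim_pderiv_inl G v i

lemma zeroCount_eq_sum_spec [Fintype K] [Fintype α] [Fintype β] [DecidableEq β] (G : MvPolynomial (α ⊕ β) K) :
    zeroCount G = ∑ v : β → K, zeroCount (spec v G) := by
  classical
  simp only [zeroCount, eval_spec]
  rw [← Nat.card_sigma]
  refine Nat.card_congr ⟨fun z => ⟨fun j => z.1 (Sum.inr j), ⟨fun i => z.1 (Sum.inl i), ?_⟩⟩,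
    fun y => ⟨Sum.elim y.2.1 y.1, y.2.2⟩, fun z => ?_, fun y => ?_⟩
  · have h := z.2
    have h1 : (Sum.elim (fun i => z.1 (Sum.inl i)) fun j => z.1 (Sum.inr j)) = z.1 := by
      ext (i | j) <;> rfl
    rwa [h1]
  · apply Subtype.ext
    ext (i | j) <;> rfl
  · rfl

lemma eval_eq_sum_of_isHomogeneous_one [Fintype β] {A : MvPolynomial β K} (hA : A.IsHomogeneous 1)
    (v : β → K) : eval v A = ∑ j, v j * eval 0 (pderiv j A) := by
  have h := congrArg (eval v) hA.sum_X_mul_pderiv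
  rw [one_smul, map_sum] at h
  rw [← h]
  refine Finset.sum_congr rfl fun j _ => ?_
  have h0 : (pderiv j A).IsHomogeneous 0 := hA.pderiv
  rw [← totalDegree_zero_iff_isHomogeneous, totalDegree_eq_zero_iff_eq_C] at h0
  rw [map_mul, eval_X, h0, eval_C, eval_C]

/-- The coefficient of `y_j` in `G(x, y)`, when `G` is expanded in `y`. -/
def linPart (j : β) (G : MvPolynomial (α ⊕ β) K) : MvPolynomial α K :=
  spec 0 (pderiv (Sum.inr j) G)

variable {G : MvPolynomial (α ⊕ β) K} {e : ℕ}

lemma xcoeff_eq_zero_of_degree_eq (hG : G.IsHomogeneous (e + 1)) (h0 : spec 0 G = 0) {s : α →₀ ℕ}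
    (hs : s.degree = e + 1) : xcoeff s G = 0 := by
  have h1 := isHomogeneous_xcoeff hG s
  rw [hs, Nat.sub_self, ← totalDegree_zero_iff_isHomogeneous, totalDegree_eq_zero_iff_eq_C] at h1
  have h2 := coeff_spec 0 s G
  rw [h0, coeff_zero, h1, eval_C] at h2
  rw [h1, ← h2, C_0]

/-- The coefficient of a monomial of full degree in `x` is constant in `y`, so it is determined by
`G(x, 0)` and vanishes. This drop by one is the origin of the factor `d - 1` in the bound. -/
lemma totalDegree_spec_le (hG : G.IsHomogeneous (e + 1)) (h0 : spec 0 G = 0) (v : β → K) :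
    (spec v G).totalDegree ≤ e := by
  refine Finset.sup_le fun s hs => ?_
  rw [mem_support_iff, coeff_spec] at hs
  have h1 : s.degree ≤ e := by
    by_contra! h
    rcases Nat.eq_or_lt_of_le (Nat.succ_le_of_lt h) with h | h
    · rw [xcoeff_eq_zero_of_degree_eq hG h0 h.symm, map_zero] at hs
      exact hs rfl
    · rw [xcoeff_eq_zero_of_lt hG h, map_zero] at hs
      exact hs rfl
  exact h1

lemma isHomogeneous_linPart (hG : G.IsHomogeneous (e + 1)) (j : β) :
    (linPart j G).IsHomogeneous e := by
  have h1 : (pderiv (Sum.inr j) G).IsHomogeneous e := hG.pderiv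
  intro s hs
  rw [linPart, coeff_spec] at hs
  refine (DFunLike.congr_fun Finsupp.degree_eq_weight_one s).symm.trans ?_
  by_contra hne
  rcases lt_or_gt_of_ne hne with h | h
  · exact hs (eval_zero_of_isHomogeneous (by omega) (isHomogeneous_xcoeff h1 s))
  · exact hs (by rw [xcoeff_eq_zero_of_lt h1 h, map_zero])

/-- By homogeneity the coefficients of monomials of degree `e` in `x` are linear in `y`, so the
leading part of `G(x, v)` is a linear system parametrised by `v`. -/
lemma homogeneousComponent_spec [Fintype β] (hG : G.IsHomogeneous (e + 1)) (v : β → K) :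
    homogeneousComponent e (spec v G) = ∑ j, C (v j) * linPart j G := by
  ext s
  rw [coeff_homogeneousComponent, coeff_sum]
  simp only [coeff_C_mul]
  split_ifs with hs
  · rw [coeff_spec]
    have h1 := isHomogeneous_xcoeff hG s
    rw [hs, Nat.add_sub_cancel_left] at h1
    rw [eval_eq_sum_of_isHomogeneous_one h1]
    refine Finset.sum_congr rfl fun j _ => ?_
    rw [linPart, coeff_spec, xcoeff_pderiv_inr]
  · refine (Finset.sum_eq_zero fun j _ => ?_).symm
    rw [(isHomogeneous_linPart hG j).coeff_eq_zero hs, mul_zero]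

/-- At points of `y = 0` the derivatives along `x` vanish because `G(x, 0) = 0`; nonsingularity must
therefore be visible in the `y`-derivatives. In other words, the linear system of leading parts has
no rational base point. -/
lemma exists_eval_linPart_ne_zero (hns : Nonsing G) (h0 : spec 0 G = 0) {x : α → K} (hx : x ≠ 0) :
    ∃ j, eval x (linPart j G) ≠ 0 := by
  have key : ∀ P : MvPolynomial (α ⊕ β) K,
      aeval (fun k => algebraMap K (AlgebraicClosure K) (Sum.elim x 0 k)) P
        = algebraMap K (AlgebraicClosure K) (eval x (spec 0 P)) := by
    intro P
    rw [eval_spec]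
    exact aeval_algebraMap_apply _ _ _
  obtain ⟨i, hi⟩ := hns (fun k => algebraMap K (AlgebraicClosure K) (Sum.elim x 0 k)) (by
    intro h
    apply hx
    ext i
    have := congrFun h (Sum.inl i)
    simpa using this) (by rw [key, h0, map_zero, map_zero])
  rw [key] at hi
  rcases i with i | j
  · rw [spec_pderiv_inl, h0, map_zero, map_zero, map_zero] at hi
    exact absurd rfl hi
  · exact ⟨j, fun h => hi (by rw [linPart] at h; rw [h, map_zero])⟩

end Split

/-! ### Coordinates adapted to a linear subspace of the hypersurface -/

section Coordinates

variable {K : Type*} [Field K] {n : ℕ}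

lemma eq_zero_of_forall_aeval {σ : Type*} {P : MvPolynomial σ K}
    (h : ∀ x : σ → AlgebraicClosure K, aeval x P = 0) : P = 0 := by
  apply map_injective _ (algebraMap K (AlgebraicClosure K)).injective
  rw [map_zero]
  apply MvPolynomial.funext
  intro x
  rw [eval_map, map_zero]
  exact h x

/-- Containment is geometric: `F` vanishes at all points of the subspace over the algebraic closure,
which is an infinite field, so this amounts to the vanishing of a polynomial. -/
lemma containsLinear_range_iff {τ : Type*} [Fintype τ] (F : MvPolynomial (Fin (n + 2)) K)
    (B : Matrix (Fin (n + 2)) τ K) :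
    ContainsLinear F (LinearMap.range B.mulVecLin) ↔ lsub B F = 0 := by
  classical
  set φ := algebraMap K (AlgebraicClosure K) with hφ
  constructor
  · intro h
    apply eq_zero_of_forall_aeval
    intro x
    rw [aeval_lsub]
    apply h
    have : (fun i => ∑ j, φ (B i j) * x j) = ∑ j, x j • fun i => φ (B i j) := by
      ext i
      simp [Finset.sum_apply, mul_comm]
    rw [this]
    refine Submodule.sum_mem _ fun j _ => Submodule.smul_mem _ _ (Submodule.subset_span ?_)
    refine ⟨B.mulVec (Pi.single j 1), ⟨Pi.single j 1, rfl⟩, ?_⟩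
    ext i
    simp [hφ]
  · intro h x hx
    have hle : Submodule.span (AlgebraicClosure K)
        ((fun (v : Fin (n + 2) → K) (i : Fin (n + 2)) => φ (v i)) ''
          (LinearMap.range B.mulVecLin : Set (Fin (n + 2) → K)))
        ≤ LinearMap.range (B.map φ).mulVecLin := by
      rw [Submodule.span_le]
      rintro _ ⟨_, ⟨u, rfl⟩, rfl⟩
      refine ⟨fun j => φ (u j), ?_⟩
      ext i
      simp [Matrix.mulVec, dotProduct]
    obtain ⟨y, rfl⟩ := hle hx
    have := aeval_lsub B y F
    rw [h, map_zero] at this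
    exact this.symm

lemma Nonsing.ne_zero {σ : Type*} [Nonempty σ] {F : MvPolynomial σ K} (hF : Nonsing F) : F ≠ 0 := by
  rintro rfl
  obtain ⟨i, hi⟩ := hF (fun _ => 1) (fun h => one_ne_zero (congrFun h (Classical.arbitrary σ)))
    (map_zero _)
  simp at hi

lemma range_mulVecLin_submatrix_inl {α β : Type*} [Fintype α] [Fintype β]
    (M : Matrix (Fin (n + 2)) (α ⊕ β) K) (F : MvPolynomial (Fin (n + 2)) K) :
    lsub (M.submatrix id Sum.inl) F = spec 0 (lsub M F) := by
  have : lsub (M.submatrix id Sum.inl) = (spec 0).comp (lsub M) := by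
    apply MvPolynomial.algHom_ext
    intro i
    simp [lsub, linForm, spec]
  rw [this, AlgHom.comp_apply]

/-- Coordinates `(x, y)` adapted to a linear subspace contained in `F = 0`. -/
lemma exists_adapted_coordinates {F : MvPolynomial (Fin (n + 2)) K} {m N : ℕ} (hmN : m + N = n + 2)
    {V : Submodule K (Fin (n + 2) → K)} (hV : Module.finrank K V = m) (hFV : ContainsLinear F V) :
    ∃ (M : Matrix (Fin (n + 2)) (Fin m ⊕ Fin N) K) (M' : Matrix (Fin m ⊕ Fin N) (Fin (n + 2)) K),
      M * M' = 1 ∧ M' * M = 1 ∧ spec 0 (lsub M F) = 0 ∧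
      ∀ x, M.mulVec (Sum.elim x 0) ∈ V := by
  classical
  obtain ⟨W, hW⟩ := Submodule.exists_isCompl V
  have hWr : Module.finrank K W = N := by
    have := Submodule.finrank_add_eq_of_isCompl hW
    rw [hV, Module.finrank_fin_fun] at this
    omega
  let b := Module.finBasisOfFinrankEq K V hV
  let b' := Module.finBasisOfFinrankEq K W hWr
  let B : Module.Basis (Fin m ⊕ Fin N) K (Fin (n + 2) → K) :=
    (b.prod b').map (Submodule.prodEquivOfIsCompl V W hW)
  let S := Pi.basisFun K (Fin (n + 2))
  have hB : ∀ j, B (Sum.inl j) = b j := fun j => by simp [B]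
  have hrange : LinearMap.range ((S.toMatrix B).submatrix id Sum.inl).mulVecLin = V := by
    rw [Matrix.range_mulVecLin]
    have : Set.range ((S.toMatrix B).submatrix id Sum.inl).col = V.subtype '' (Set.range b) := by
      rw [← Set.range_comp]
      congr 1
      ext j i
      have := congrFun (hB j) i
      simpa [S, Module.Basis.toMatrix_apply, Matrix.col] using this
    rw [this, ← Submodule.map_span, b.span_eq, Submodule.map_top, Submodule.range_subtype]
  refine ⟨S.toMatrix B, B.toMatrix S, S.toMatrix_mul_toMatrix_flip B,
    B.toMatrix_mul_toMatrix_flip S, ?_, fun x => ?_⟩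
  · rw [← range_mulVecLin_submatrix_inl, ← containsLinear_range_iff, hrange]
    exact hFV
  · rw [← hrange]
    refine ⟨x, ?_⟩
    ext i
    simp [Matrix.mulVec, dotProduct]

/-- A point of the span of `y = 0` and `v` is `(x, t v)`. For `t = 0` it lies on `y = 0`; for `t ≠
0` homogeneity moves it to `(x / t, v)`. -/
lemma lsub_extend_eq_zero {m N d : ℕ} {G : MvPolynomial (Fin m ⊕ Fin N) K} (hG : G.IsHomogeneous d)
    (h0 : spec 0 G = 0) {v : Fin N → K} (hv : spec v G = 0) :
    lsub (Matrix.fromBlocks (1 : Matrix (Fin m) (Fin m) K) 0 0 (Matrix.replicateCol Unit v)) G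
      = 0 := by
  set φ := algebraMap K (AlgebraicClosure K) with hφ
  have key : ∀ (x : Fin m → AlgebraicClosure K) (u : Fin N → K),
      aeval (Sum.elim x (fun j => φ (u j))) G = aeval x (spec u G) := by
    intro x u
    have : (aeval x : MvPolynomial (Fin m) K →ₐ[K] AlgebraicClosure K).comp (spec u)
        = aeval (Sum.elim x (fun j => φ (u j))) := by
      apply MvPolynomial.algHom_ext
      rintro (i | j)
      · simp [spec]
      · simp [spec, hφ]
    rw [← this, AlgHom.comp_apply]
  apply eq_zero_of_forall_aeval
  intro z
  rw [aeval_lsub]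
  have hz : (fun i => ∑ j, φ (Matrix.fromBlocks (1 : Matrix (Fin m) (Fin m) K) 0 0
      (Matrix.replicateCol Unit v) i j) * z j)
      = Sum.elim (fun i => z (Sum.inl i)) (fun j => z (Sum.inr ()) * φ (v j)) := by
    ext (i | j)
    · simp [Matrix.one_apply, apply_ite φ]
    · simp [mul_comm]
  rw [hz]
  by_cases ht : z (Sum.inr ()) = 0
  · have h1 := key (fun i => z (Sum.inl i)) 0
    rw [h0, map_zero] at h1
    rw [← h1]
    congr 2
    ext j
    simp [ht]
  · have h1 : Sum.elim (fun i => z (Sum.inl i)) (fun j => z (Sum.inr ()) * φ (v j))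
        = z (Sum.inr ()) • Sum.elim (fun i => (z (Sum.inr ()))⁻¹ * z (Sum.inl i))
          (fun j => φ (v j)) := by
      ext (i | j)
      · simp [ht]
      · simp
    rw [h1, aeval_smul_of_isHomogeneous hG, key, hv, map_zero, mul_zero]

lemma bddAbove_thas (F : MvPolynomial (Fin (n + 2)) K) :
    BddAbove {h : ℕ | ∃ V : Submodule K (Fin (n + 2) → K),
      Module.finrank K V = h + 1 ∧ ContainsLinear F V} := by
  refine ⟨n + 1, ?_⟩
  rintro h ⟨V, hV, -⟩
  have := Submodule.finrank_le V
  rw [hV, Module.finrank_fin_fun] at this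
  omega

lemma le_thasInvariant {F : MvPolynomial (Fin (n + 2)) K} {h : ℕ}
    {V : Submodule K (Fin (n + 2) → K)} (hV : Module.finrank K V = h + 1)
    (hFV : ContainsLinear F V) : h ≤ thasInvariant F :=
  le_csSup (bddAbove_thas F) ⟨V, hV, hFV⟩

lemma exists_finrank_eq_of_pos {F : MvPolynomial (Fin (n + 2)) K} (h : 0 < thasInvariant F) :
    ∃ V : Submodule K (Fin (n + 2) → K),
      Module.finrank K V = thasInvariant F + 1 ∧ ContainsLinear F V := by
  refine Nat.sSup_mem ?_ (bddAbove_thas F)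
  by_contra hne
  rw [Set.not_nonempty_iff_eq_empty] at hne
  rw [thasInvariant, hne] at h
  simp at h

lemma le_of_containsLinear {F : MvPolynomial (Fin (n + 2)) K} (hF : F ≠ 0) {h : ℕ}
    {V : Submodule K (Fin (n + 2) → K)} (hV : Module.finrank K V = h + 1)
    (hFV : ContainsLinear F V) : h ≤ n := by
  by_contra hlt
  have h1 := Submodule.finrank_le V
  have h2 : V = ⊤ := by
    apply Submodule.eq_top_of_finrank_eq
    rw [Module.finrank_fin_fun] at h1 ⊢
    omega
  have h3 : LinearMap.range (1 : Matrix (Fin (n + 2)) (Fin (n + 2)) K).mulVecLin = ⊤ := by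
    rw [Matrix.mulVecLin_one, LinearMap.range_id]
  rw [h2, ← h3, containsLinear_range_iff, lsub_one] at hFV
  exact hF hFV

/-- In coordinates adapted to a maximal linear subspace no specialization `G(x, v)` vanishes. -/
lemma spec_ne_zero_of_maximal {F : MvPolynomial (Fin (n + 2)) K} {d N : ℕ} (hF : F.IsHomogeneous d)
    {M : Matrix (Fin (n + 2)) (Fin (thasInvariant F + 1) ⊕ Fin N) K}
    {M' : Matrix (Fin (thasInvariant F + 1) ⊕ Fin N) (Fin (n + 2)) K} (h' : M' * M = 1)
    (h0 : spec 0 (lsub M F) = 0) {v : Fin N → K} (hv : v ≠ 0) : spec v (lsub M F) ≠ 0 := by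
  intro hsv
  set T := Matrix.fromBlocks (1 : Matrix (Fin (thasInvariant F + 1)) (Fin (thasInvariant F + 1)) K)
    0 0 (Matrix.replicateCol Unit v)
  have h1 := lsub_extend_eq_zero (isHomogeneous_lsub hF M) h0 hsv
  rw [lsub_lsub, ← containsLinear_range_iff] at h1
  have hinj : Function.Injective (M * T).mulVecLin := by
    rw [← LinearMap.ker_eq_bot, LinearMap.ker_eq_bot']
    intro z hz
    have h2 : T.mulVec z = 0 := by
      have h3 := congrArg M'.mulVec hz
      rw [Matrix.mulVecLin_apply, Matrix.mulVec_mulVec, ← Matrix.mul_assoc, h', Matrix.one_mul,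
        Matrix.mulVec_zero] at h3
      exact h3
    obtain ⟨j, hj⟩ := Function.ne_iff.1 hv
    ext (i | u)
    · have := congrFun h2 (Sum.inl i)
      simpa [T, Matrix.mulVec, dotProduct, Matrix.one_apply] using this
    · have := congrFun h2 (Sum.inr j)
      simp only [Matrix.mulVec, dotProduct, T, Fintype.sum_sum_type, Matrix.fromBlocks_apply₂₁,
        Matrix.zero_apply, zero_mul, Finset.sum_const_zero, zero_add, Matrix.fromBlocks_apply₂₂,
        Matrix.replicateCol_apply, Finset.univ_unique, Finset.sum_singleton, Pi.zero_apply,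
        mul_eq_zero] at this
      exact this.resolve_left hj
  have h3 : Module.finrank K (LinearMap.range (M * T).mulVecLin) = thasInvariant F + 1 + 1 := by
    rw [LinearMap.finrank_range_of_inj hinj, Module.finrank_fintype_fun_eq_card]
    simp
  have := le_thasInvariant h3 h1
  omega

lemma containsLinear_span_singleton {F : MvPolynomial (Fin (n + 2)) K} {d : ℕ}
    (hF : F.IsHomogeneous d) {P : Fin (n + 2) → K} (hP : eval P F = 0) :
    ContainsLinear F (Submodule.span K {P}) := by
  have h1 : Submodule.span K {P} = LinearMap.range (Matrix.replicateCol Unit P).mulVecLin := by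
    rw [Matrix.range_mulVecLin]
    congr 1
    refine Set.eq_of_subset_of_subset ?_ ?_
    · rintro x rfl
      exact ⟨(), rfl⟩
    · rintro x ⟨u, rfl⟩
      rfl
  rw [h1, containsLinear_range_iff]
  apply eq_zero_of_forall_aeval
  intro z
  rw [aeval_lsub]
  have h2 : (fun i => ∑ j, algebraMap K (AlgebraicClosure K) (Matrix.replicateCol Unit P i j) * z j)
      = z () • fun i => algebraMap K (AlgebraicClosure K) (P i) := by
    ext i
    simp [mul_comm]
  have h3 : aeval (fun i => algebraMap K (AlgebraicClosure K) (P i)) F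
      = algebraMap K (AlgebraicClosure K) (aeval P F) := aeval_algebraMap_apply _ _ _
  have h4 : aeval P F = 0 := by rw [aeval_eq_eval]; exact hP
  rw [h2, aeval_smul_of_isHomogeneous hF, h3, h4, map_zero, mul_zero]

end Coordinates

/-! ### The bound when the hypersurface contains a line -/

section Bound

variable {K : Type*} [Field K] [Fintype K] {n : ℕ}

lemma projCount_mul_add_one (q N : ℕ) (hq : 1 ≤ q) : projCount q N * (q - 1) + 1 = q ^ (N + 1) := by
  obtain ⟨r, rfl⟩ : ∃ r, q = r + 1 := ⟨q - 1, by omega⟩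
  simpa [projCount] using geom_sum_mul_add r (N + 1)

/-- The right side is the affine form of the bound: `q^(k+1)` vectors of the subspace, and at most
`e q^k` zeros for each of the other values of `y`. Here `e = d - 1`; in `theta_zero_mul_add_one`
below, `e = d - 2`. -/
lemma theta_mul_add_one {e q n k : ℕ} (hq : 1 ≤ q) (hk : 0 < k) (hkn : k ≤ n) :
    theta (e + 1) q n k * (q - 1) + 1 = q ^ (k + 1) + (q ^ (n + 1 - k) - 1) * (e * q ^ k) := by
  rw [theta, if_neg hk.ne', Nat.add_sub_cancel, add_mul, add_assoc, projCount_mul_add_one q k hq,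
    mul_assoc _ (projCount q (n - k)), Nat.eq_sub_of_add_eq (projCount_mul_add_one q (n - k) hq),
    show n - k + 1 = n + 1 - k by omega]
  ring

lemma theta_zero_mul_add_one {e q n : ℕ} (hq : 1 ≤ q) (hn : 1 ≤ n) :
    theta (e + 2) q n 0 * (q - 1) + 1
      = q + (q ^ (n + 1) - q ^ n) * (e + 1) + (q ^ n - 1) * e := by
  have h1 := projCount_mul_add_one q (n - 1) hq
  rw [Nat.sub_add_cancel hn] at h1
  have h2 : q ^ (n + 1) - q ^ n = q ^ n * (q - 1) := by
    rw [Nat.mul_sub, mul_one, pow_succ]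
  rw [theta, if_pos rfl, h2, ← Nat.eq_sub_of_add_eq h1]
  obtain ⟨r, rfl⟩ : ∃ r, q = r + 1 := ⟨q - 1, by omega⟩
  simp only [Nat.add_sub_cancel, show e + 2 - 1 = e + 1 by omega]
  ring

variable {F : MvPolynomial (Fin (n + 2)) K} {d : ℕ}

lemma numPoints_le_iff (hd : d ≠ 0) (hF : F.IsHomogeneous d) (t : ℕ) :
    numPoints F ≤ t ↔ zeroCount F ≤ t * (Fintype.card K - 1) + 1 := by
  rw [← numPoints_mul_add_one hd hF, Nat.add_le_add_iff_right]
  have : 0 < Fintype.card K - 1 := by have := Fintype.one_lt_card (α := K); omega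
  exact (Nat.mul_le_mul_right_iff this).symm

lemma numPoints_eq_iff (hd : d ≠ 0) (hF : F.IsHomogeneous d) (t : ℕ) :
    numPoints F = t ↔ zeroCount F = t * (Fintype.card K - 1) + 1 := by
  rw [← numPoints_mul_add_one hd hF, Nat.add_right_cancel_iff]
  have : 0 < Fintype.card K - 1 := by have := Fintype.one_lt_card (α := K); omega
  exact (Nat.mul_left_inj this.ne').symm

lemma zeroCount_zero {σ : Type*} [Fintype σ] :
    zeroCount (0 : MvPolynomial σ K) = Fintype.card K ^ Fintype.card σ := by
  classical
  rw [zeroCount, Nat.card_congr (Equiv.subtypeUnivEquiv (by simp)), Nat.card_eq_fintype_card]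
  simp

open scoped Classical in
lemma zeroCount_eq_add_sum {m N : ℕ} {G : MvPolynomial (Fin m ⊕ Fin N) K} (h0 : spec 0 G = 0) :
    zeroCount G = Fintype.card K ^ m
      + ∑ v ∈ (Finset.univ : Finset (Fin N → K)).erase 0, zeroCount (spec v G) := by
  classical
  rw [zeroCount_eq_sum_spec, ← Finset.add_sum_erase _ _ (Finset.mem_univ 0), h0, zeroCount_zero]
  simp

/-- The bound for polynomials in coordinates adapted to a maximal linear subspace, and the
meaning of equality. -/
lemma zeroCount_le_and_eq_iff {m N e : ℕ} {G : MvPolynomial (Fin (m + 1) ⊕ Fin N) K}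
    (hG : G.IsHomogeneous (e + 1)) (h0 : spec 0 G = 0) (hne : ∀ v ≠ 0, spec v G ≠ 0) :
    zeroCount G ≤ Fintype.card K ^ (m + 1)
      + (Fintype.card K ^ N - 1) * (e * Fintype.card K ^ m) ∧
    (zeroCount G = Fintype.card K ^ (m + 1)
      + (Fintype.card K ^ N - 1) * (e * Fintype.card K ^ m) →
      ∀ v ≠ 0, zeroCount (spec v G) = e * Fintype.card K ^ m) := by
  classical
  have hle : ∀ v ∈ (Finset.univ : Finset (Fin N → K)).erase 0,
      zeroCount (spec v G) ≤ e * Fintype.card K ^ m := fun v hv =>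
    zeroCount_le (hne v (Finset.ne_of_mem_erase hv)) (totalDegree_spec_le hG h0 v)
  have hconst : (Fintype.card K ^ N - 1) * (e * Fintype.card K ^ m)
      = ∑ v ∈ (Finset.univ : Finset (Fin N → K)).erase 0, e * Fintype.card K ^ m := by
    rw [Finset.sum_const, Finset.card_erase_of_mem (Finset.mem_univ _), Finset.card_univ]
    simp
  rw [zeroCount_eq_add_sum h0, hconst]
  refine ⟨Nat.add_le_add_left (Finset.sum_le_sum hle) _, fun h v hv => ?_⟩
  exact (Finset.sum_eq_sum_iff_of_le hle).1 (Nat.add_left_cancel h) v (by simp [hv])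

end Bound

/-! ### The bound at a rational point -/

section Tangent

variable {K : Type*} [Field K]

lemma eq_zero_of_eval_one {T : MvPolynomial (Fin 1) K} {d : ℕ} (hT : T.IsHomogeneous d)
    (h : eval 1 T = 0) : T = 0 := by
  apply eq_zero_of_forall_aeval
  intro x
  have h1 : x = x 0 • fun i => algebraMap K (AlgebraicClosure K) ((1 : Fin 1 → K) i) := by
    ext i
    rw [Subsingleton.elim i 0]
    simp
  have h2 : aeval (fun i => algebraMap K (AlgebraicClosure K) ((1 : Fin 1 → K) i)) T
      = algebraMap K (AlgebraicClosure K) (aeval (1 : Fin 1 → K) T) := aeval_algebraMap_apply _ _ _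
  rw [aeval_eq_eval] at h2
  rw [h1, aeval_smul_of_isHomogeneous hT, h2]
  change _ * algebraMap _ _ (eval 1 T) = 0
  rw [h, map_zero, mul_zero]

lemma totalDegree_le_of_homogeneousComponent_eq_zero {σ : Type*} {f : MvPolynomial σ K} {e : ℕ}
    (hf : f.totalDegree ≤ e + 1) (h : homogeneousComponent (e + 1) f = 0) : f.totalDegree ≤ e := by
  refine Finset.sup_le fun s hs => ?_
  have h1 : s.degree ≤ e + 1 := (le_totalDegree hs).trans hf
  have h2 : s.degree ≠ e + 1 := by
    intro h2
    have h3 := congrArg (coeff s) h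
    rw [coeff_homogeneousComponent, if_pos h2, coeff_zero] at h3
    exact mem_support_iff.1 hs h3
  change s.degree ≤ e
  omega

lemma eval_aeval_X (s : K) (p : MvPolynomial (Fin 1) K) :
    (aeval (fun _ => (Polynomial.X : Polynomial K)) p).eval s = eval (fun _ => s) p := by
  have : (Polynomial.aeval s : Polynomial K →ₐ[K] K).comp
      (aeval (fun _ : Fin 1 => (Polynomial.X : Polynomial K))) = aeval (fun _ => s) := by
    apply MvPolynomial.algHom_ext
    intro i
    rw [AlgHom.comp_apply, aeval_X, aeval_X, Polynomial.aeval_X]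
  have h2 := congrArg (fun φ => φ p) this
  simp only [AlgHom.comp_apply, aeval_eq_eval] at h2
  rw [Polynomial.coe_aeval_eq_eval] at h2
  exact h2

lemma derivative_aeval_X (p : MvPolynomial (Fin 1) K) :
    Polynomial.derivative (aeval (fun _ => (Polynomial.X : Polynomial K)) p)
      = aeval (fun _ => (Polynomial.X : Polynomial K)) (pderiv 0 p) := by
  induction p using MvPolynomial.induction_on with
  | C a => simp
  | add p q hp hq => simp [hp, hq]
  | mul_X p i hp =>
    rw [Subsingleton.elim i 0]
    simp only [map_mul, aeval_X, Polynomial.derivative_mul, hp, Polynomial.derivative_X, pderiv_mul,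
      pderiv_X_self, map_add, map_one]

/-- The equation of the tangent hyperplane at the point `y = 0`, in coordinates `(x, y)`. -/
def tangentForm {N : ℕ} (G : MvPolynomial (Fin 1 ⊕ Fin N) K) : Fin N → K :=
  fun j => eval 1 (linPart j G)

variable {N e : ℕ} {G : MvPolynomial (Fin 1 ⊕ Fin N) K}

/-- With a single variable `x`, the coefficient of `x^(e+1)` in `G(x, v)` is the tangent form at
`v`, so tangent directions lose a second degree. -/
lemma totalDegree_spec_le_of_tangent (hG : G.IsHomogeneous (e + 2)) (h0 : spec 0 G = 0)
    {v : Fin N → K} (hv : tangentForm G ⬝ᵥ v = 0) : (spec v G).totalDegree ≤ e := by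
  refine totalDegree_le_of_homogeneousComponent_eq_zero (totalDegree_spec_le hG h0 v) ?_
  rw [homogeneousComponent_spec hG]
  refine eq_zero_of_eval_one (d := e + 1) ?_ ?_
  · exact IsHomogeneous.sum _ _ _ fun j _ => (isHomogeneous_linPart hG j).C_mul _
  · rw [← hv]
    simp [tangentForm, dotProduct, mul_comm]

lemma tangentForm_ne_zero (hns : Nonsing G) (h0 : spec 0 G = 0) : tangentForm G ≠ 0 := by
  obtain ⟨j, hj⟩ := exists_eval_linPart_ne_zero hns h0 (x := (1 : Fin 1 → K)) one_ne_zero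
  exact fun h => hj (congrFun h j)

open scoped Classical in
lemma card_filter_dotProduct_eq_zero [Fintype K] {m : ℕ} {a : Fin (m + 1) → K} (ha : a ≠ 0) :
    (Finset.univ.filter fun v : Fin (m + 1) → K => a ⬝ᵥ v = 0).card = Fintype.card K ^ m := by
  let φ : (Fin (m + 1) → K) →ₗ[K] K := dotProductBilin K K a
  have hφ : LinearMap.range φ = ⊤ := by
    rw [LinearMap.range_eq_top]
    obtain ⟨i, hi⟩ := Function.ne_iff.1 ha
    intro c
    refine ⟨Pi.single i ((a i)⁻¹ * c), ?_⟩
    simp only [φ, dotProductBilin_apply_apply, dotProduct_single]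
    rw [← mul_assoc, mul_inv_cancel₀ hi, one_mul]
  have h1 := LinearMap.finrank_range_add_finrank_ker φ
  rw [hφ, finrank_top, Module.finrank_self, Module.finrank_fin_fun] at h1
  have h2 : Module.finrank K (LinearMap.ker φ) = m := by omega
  have h3 := Module.card_eq_pow_finrank (K := K) (V := LinearMap.ker φ)
  rw [h2] at h3
  rw [← h3, ← Fintype.card_subtype]
  exact Fintype.card_congr (Equiv.refl _)

/-- The bound at a point, in adapted coordinates, with the meaning of equality. -/
lemma zeroCount_le_and_eq_of_point [Fintype K] {n : ℕ} {G : MvPolynomial (Fin 1 ⊕ Fin (n + 1)) K}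
    (hG : G.IsHomogeneous (e + 2)) (h0 : spec 0 G = 0) (hne : ∀ v ≠ 0, spec v G ≠ 0)
    (hns : Nonsing G) :
    zeroCount G ≤ Fintype.card K + (Fintype.card K ^ (n + 1) - Fintype.card K ^ n) * (e + 1)
      + (Fintype.card K ^ n - 1) * e ∧
    (zeroCount G = Fintype.card K + (Fintype.card K ^ (n + 1) - Fintype.card K ^ n) * (e + 1)
      + (Fintype.card K ^ n - 1) * e ↔
      ∀ v ≠ 0, (tangentForm G ⬝ᵥ v = 0 → zeroCount (spec v G) = e) ∧
        (tangentForm G ⬝ᵥ v ≠ 0 → zeroCount (spec v G) = e + 1)) := by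
  classical
  set a := tangentForm G with ha
  have ha0 : a ≠ 0 := tangentForm_ne_zero hns h0
  have hle : ∀ v ∈ (Finset.univ : Finset (Fin (n + 1) → K)).erase 0,
      zeroCount (spec v G) ≤ if a ⬝ᵥ v = 0 then e else e + 1 := by
    intro v hv
    have hv0 := hne v (Finset.ne_of_mem_erase hv)
    split_ifs with h
    · simpa using zeroCount_le hv0 (totalDegree_spec_le_of_tangent hG h0 h)
    · simpa using zeroCount_le hv0 (totalDegree_spec_le hG h0 v)
  have hsum : ∑ v ∈ (Finset.univ : Finset (Fin (n + 1) → K)).erase 0,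
      (if a ⬝ᵥ v = 0 then e else e + 1)
      = (Fintype.card K ^ (n + 1) - Fintype.card K ^ n) * (e + 1)
        + (Fintype.card K ^ n - 1) * e := by
    have hc := card_filter_dotProduct_eq_zero ha0
    rw [Finset.sum_ite, Finset.sum_const, Finset.sum_const, smul_eq_mul, smul_eq_mul, add_comm]
    congr 2
    · have h1 : (((Finset.univ : Finset (Fin (n + 1) → K)).erase 0).filter fun v => ¬ a ⬝ᵥ v = 0)
          = Finset.univ.filter fun v => ¬ a ⬝ᵥ v = 0 := by
        ext v
        simp only [Finset.mem_filter, Finset.mem_erase, Finset.mem_univ, and_true, true_and,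
          and_iff_right_iff_imp]
        rintro h rfl
        simp at h
      rw [h1]
      have h2 := Finset.card_filter_add_card_filter_not (s := (Finset.univ : Finset (Fin (n + 1) → K)))
        (fun v => a ⬝ᵥ v = 0)
      rw [hc, Finset.card_univ] at h2
      simp only [Fintype.card_pi, Finset.prod_const, Finset.card_univ, Fintype.card_fin] at h2
      omega
    · rw [← hc, Finset.filter_erase, Finset.card_erase_of_mem]
      simp
  rw [zeroCount_eq_add_sum h0, add_assoc, ← hsum, pow_one]
  refine ⟨Nat.add_le_add_left (Finset.sum_le_sum hle) _, ?_⟩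
  rw [Nat.add_left_cancel_iff, Finset.sum_eq_sum_iff_of_le hle]
  constructor
  · intro h v hv
    have := h v (by simp [hv])
    refine ⟨fun h => by rwa [if_pos h] at this, fun h => by rwa [if_neg h] at this⟩
  · intro h v hv
    have := h v (Finset.ne_of_mem_erase hv)
    split_ifs with h'
    · exact this.1 h'
    · exact this.2 h'

end Tangent

/-! ### Hypersurfaces without rational lines: the bound and its equality case -/

section LineFree

variable {K : Type*} [Field K] [Fintype K] {n e : ℕ} {F : MvPolynomial (Fin (n + 2)) K}

/-- Coordinates at a rational point of a hypersurface containing no line. -/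
lemma exists_point_coordinates {K : Type*} [Field K] {n e : ℕ}
    {F : MvPolynomial (Fin (n + 2)) K} (hF : F.IsHomogeneous (e + 2)) (hns : Nonsing F)
    (hk : thasInvariant F = 0) {P : Fin (n + 2) → K} (hP : P ≠ 0) (hFP : eval P F = 0) :
    ∃ (M : Matrix (Fin (n + 2)) (Fin 1 ⊕ Fin (n + 1)) K)
      (M' : Matrix (Fin 1 ⊕ Fin (n + 1)) (Fin (n + 2)) K),
      M * M' = 1 ∧ M' * M = 1 ∧ spec 0 (lsub M F) = 0 ∧ (∀ v ≠ 0, spec v (lsub M F) ≠ 0) ∧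
      Nonsing (lsub M F) ∧ ∃ p : K, p ≠ 0 ∧ M.mulVec (Sum.elim (fun _ => p) 0) = P := by
  have hr : Module.finrank K (Submodule.span K {P}) = 1 := finrank_span_singleton hP
  have hmN : 1 + (n + 1) = n + 2 := by omega
  obtain ⟨M, M', h₁, h₂, h0, hV⟩ := exists_adapted_coordinates hmN hr
    (containsLinear_span_singleton hF hFP)
  refine ⟨M, M', h₁, h₂, h0, fun v hv => ?_, hns.lsub h₁ h₂, ?_⟩
  · have key : ∀ k (M : Matrix (Fin (n + 2)) (Fin (k + 1) ⊕ Fin (n + 1)) K)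
        (M' : Matrix (Fin (k + 1) ⊕ Fin (n + 1)) (Fin (n + 2)) K), k = thasInvariant F →
        M' * M = 1 → spec 0 (lsub M F) = 0 → spec v (lsub M F) ≠ 0 := by
      rintro k M M' rfl h₂ h0
      exact spec_ne_zero_of_maximal hF h₂ h0 hv
    exact key 0 M M' hk.symm h₂ h0
  · obtain ⟨c, hc⟩ := Submodule.mem_span_singleton.1 (hV 1)
    have hc0 : c ≠ 0 := by
      rintro rfl
      rw [zero_smul] at hc
      have h3 := congrArg M'.mulVec hc
      rw [Matrix.mulVec_mulVec, h₂, Matrix.one_mulVec, Matrix.mulVec_zero] at h3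
      have := congrFun h3 (Sum.inl 0)
      simp at this
    refine ⟨c⁻¹, inv_ne_zero hc0, ?_⟩
    have : (Sum.elim (fun _ => c⁻¹) 0 : Fin 1 ⊕ Fin (n + 1) → K) =
        c⁻¹ • (Sum.elim 1 0 : Fin 1 ⊕ Fin (n + 1) → K) := by
      ext (i | j) <;> simp
    rw [this, Matrix.mulVec_smul, ← hc, inv_smul_smul₀ hc0]

lemma zeroCount_lsub {K : Type*} [Field K] {n : ℕ} {F : MvPolynomial (Fin (n + 2)) K} {m N : ℕ}
    {M : Matrix (Fin (n + 2)) (Fin m ⊕ Fin N) K}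
    {M' : Matrix (Fin m ⊕ Fin N) (Fin (n + 2)) K} (h₁ : M * M' = 1) (h₂ : M' * M = 1) :
    zeroCount (lsub M F) = zeroCount F :=
  (LinEquivalent.of_lsub h₁ h₂ F).zeroCount_eq.symm

/-- The number of zeros attaining the bound for hypersurfaces without lines. -/
def lineFreeBound (q n e : ℕ) : ℕ := q + (q ^ (n + 1) - q ^ n) * (e + 1) + (q ^ n - 1) * e

theorem zeroCount_le_of_point (hF : F.IsHomogeneous (e + 2)) (hns : Nonsing F)
    (hk : thasInvariant F = 0) {P : Fin (n + 2) → K} (hP : P ≠ 0) (hFP : eval P F = 0) :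
    zeroCount F ≤ lineFreeBound (Fintype.card K) n e := by
  obtain ⟨M, M', h₁, h₂, h0, hne, hns', -⟩ := exists_point_coordinates hF hns hk hP hFP
  rw [← zeroCount_lsub h₁ h₂]
  exact (zeroCount_le_and_eq_of_point (isHomogeneous_lsub hF M) h0 hne hns').1

/-- For quadrics without lines, the bound is attained as soon as there is a rational point. -/
theorem zeroCount_eq_of_point {F : MvPolynomial (Fin (n + 2)) K} (hF : F.IsHomogeneous 2)
    (hns : Nonsing F) (hk : thasInvariant F = 0) {P : Fin (n + 2) → K} (hP : P ≠ 0)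
    (hFP : eval P F = 0) : zeroCount F = lineFreeBound (Fintype.card K) n 0 := by
  classical
  obtain ⟨M, M', h₁, h₂, h0, hne, hns', -⟩ := exists_point_coordinates (e := 0) hF hns hk hP hFP
  have hG := isHomogeneous_lsub hF M
  rw [← zeroCount_lsub h₁ h₂]
  refine ((zeroCount_le_and_eq_of_point (e := 0) hG h0 hne hns').2).2 fun v hv => ⟨fun hv0 => ?_,
    fun hv0 => ?_⟩
  · have := zeroCount_le (hne v hv) (totalDegree_spec_le_of_tangent (e := 0) hG h0 hv0)
    omega
  · refine le_antisymm (by simpa using zeroCount_le (hne v hv) (totalDegree_spec_le (e := 1) hG h0 v))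
      ?_
    rw [zeroCount, Nat.one_le_iff_ne_zero, Nat.card_ne_zero]
    refine ⟨?_, inferInstance⟩
    set c := tangentForm (lsub M F) ⬝ᵥ v with hc
    have hdeg := totalDegree_spec_le (e := 1) hG h0 v
    -- In a transversal direction `G(x, v)` is an affine linear polynomial with slope `c ≠ 0`, hence
    -- has a root; in a tangent direction it is a nonzero constant.
    have h1 : ∀ t : K, eval (fun _ => t) (spec v (lsub M F)) = c * t + coeff 0 (spec v (lsub M F)) := by
      intro t
      have h2 := sum_homogeneousComponent (spec v (lsub M F))
      have h3 : ∑ i ∈ Finset.range 2, homogeneousComponent i (spec v (lsub M F))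
          = spec v (lsub M F) := by
        conv_rhs => rw [← h2]
        symm
        apply Finset.sum_subset
        · intro i hi
          simp only [Finset.mem_range] at hi ⊢
          omega
        · intro i _ hi
          apply homogeneousComponent_eq_zero
          simp only [Finset.mem_range] at hi
          omega
      conv_lhs => rw [← h3]
      rw [Finset.sum_range_succ, Finset.sum_range_one, homogeneousComponent_zero,
        homogeneousComponent_spec (e := 1) hG, map_add, eval_C, map_sum, add_comm]
      congr 1
      rw [hc, dotProduct, Finset.sum_mul]
      refine Finset.sum_congr rfl fun j _ => ?_
      have h4 : (fun _ => t : Fin 1 → K) = t • (1 : Fin 1 → K) := by ext; simp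
      rw [map_mul, eval_C, h4, eval_smul_of_isHomogeneous (isHomogeneous_linPart (e := 1) hG j),
        tangentForm]
      ring
    refine ⟨⟨fun _ => -(c⁻¹ * coeff 0 (spec v (lsub M F))), ?_⟩⟩
    rw [h1, mul_neg, ← mul_assoc, mul_inv_cancel₀ hv0, one_mul, neg_add_cancel]

/-- At a point of a hypersurface attaining the bound, a transversal line carries the maximal number
of points. -/
lemma card_line_of_zeroCount_eq (hF : F.IsHomogeneous (e + 2)) (hns : Nonsing F)
    (hk : thasInvariant F = 0) (heq : zeroCount F = lineFreeBound (Fintype.card K) n e)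
    {Q w : Fin (n + 2) → K} (hQ : Q ≠ 0) (hFQ : eval Q F = 0)
    (hT : ∑ i, w i * eval Q (pderiv i F) ≠ 0) (hw : ∀ c : K, w ≠ c • Q) :
    Nat.card {s : K // eval (s • Q + w) F = 0} = e + 1 := by
  classical
  obtain ⟨M, M', h₁, h₂, h0, hne, hns', p, hp, hpQ⟩ := exists_point_coordinates hF hns hk hQ hFQ
  have hG := isHomogeneous_lsub hF M
  rw [← zeroCount_lsub h₁ h₂] at heq
  have h1 := ((zeroCount_le_and_eq_of_point hG h0 hne hns').2).1 heq
  set y := M'.mulVec w with hy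
  have hMy : M.mulVec y = w := by rw [hy, Matrix.mulVec_mulVec, h₁, Matrix.one_mulVec]
  set v : Fin (n + 1) → K := fun j => y (Sum.inr j) with hv
  have hyv : y = Sum.elim (fun _ => y (Sum.inl 0)) v := by
    ext (i | j)
    · rw [Subsingleton.elim i 0]; rfl
    · rfl
  have hv0 : v ≠ 0 := by
    intro h
    refine hw (y (Sum.inl 0) * p⁻¹) ?_
    rw [← hpQ, ← Matrix.mulVec_smul, ← hMy, hyv, h]
    congr 1
    ext (i | j)
    · simp [mul_assoc, inv_mul_cancel₀ hp]
    · simp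
  -- By the chain rule the derivative of `F` at `Q` in the direction `w` is `p ^ (e + 1)` times the
  -- tangent form at `v`, the part of `w` along `Q` contributing nothing.
  have htan : tangentForm (lsub M F) ⬝ᵥ v ≠ 0 := by
    intro h
    apply hT
    have h2 : ∑ k, y k * eval (Sum.elim (fun _ => p) 0) (pderiv k (lsub M F))
        = ∑ i, w i * eval Q (pderiv i F) := by
      simp only [pderiv_lsub, map_sum, map_mul, eval_C, eval_lsub, hpQ]
      rw [← hMy]
      simp only [Matrix.mulVec, dotProduct, Finset.sum_mul, Finset.mul_sum]
      rw [Finset.sum_comm]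
      exact Finset.sum_congr rfl fun i _ => Finset.sum_congr rfl fun k _ => by ring
    rw [← h2, Fintype.sum_sum_type]
    have h3 : ∀ i : Fin 1, eval (Sum.elim (fun _ => p) 0) (pderiv (Sum.inl i) (lsub M F)) = 0 := by
      intro i
      rw [← eval_spec, spec_pderiv_inl, h0, map_zero, map_zero]
    have h4 : ∀ j, eval (Sum.elim (fun _ => p) 0) (pderiv (Sum.inr j) (lsub M F))
        = p ^ (e + 1) * tangentForm (lsub M F) j := by
      intro j
      rw [← eval_spec, tangentForm, ← eval_smul_of_isHomogeneous (isHomogeneous_linPart hG j)]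
      congr 2
      ext i
      simp
    simp only [h3, mul_zero, Finset.sum_const_zero, zero_add, h4]
    have h5 : ∑ x, y (Sum.inr x) * (p ^ (e + 1) * tangentForm (lsub M F) x)
        = p ^ (e + 1) * (tangentForm (lsub M F) ⬝ᵥ v) := by
      rw [dotProduct, Finset.mul_sum]
      exact Finset.sum_congr rfl fun j _ => by rw [hv]; ring
    rw [h5, h, mul_zero]
  rw [← (h1 v hv0).2 htan, zeroCount]
  refine Nat.card_congr (Equiv.subtypeEquiv ⟨fun s _ => s * p + y (Sum.inl 0),
    fun x => (x 0 - y (Sum.inl 0)) * p⁻¹, fun s => ?_, fun x => ?_⟩ fun s => ?_)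
  · simp [mul_assoc, mul_inv_cancel₀ hp]
  · ext i
    rw [Subsingleton.elim i 0]
    simp [mul_assoc, inv_mul_cancel₀ hp]
  · rw [Equiv.coe_fn_mk, eval_spec, eval_lsub]
    have : M.mulVec (Sum.elim (fun _ => s * p + y (Sum.inl 0)) v) = s • Q + w := by
      rw [← hpQ, ← hMy, ← Matrix.mulVec_smul, ← Matrix.mulVec_add]
      congr 1
      ext (i | j)
      · rw [Subsingleton.elim i 0]; simp
      · simp [hv]
    rw [this]

/-- A hypersurface of degree at least `3` without lines does not attain the bound. -/
theorem zeroCount_ne_of_line_free (hn : 1 ≤ n) (he : 1 ≤ e) (hF : F.IsHomogeneous (e + 2))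
    (hns : Nonsing F) (hk : thasInvariant F = 0) {P : Fin (n + 2) → K} (hP : P ≠ 0)
    (hFP : eval P F = 0) : zeroCount F ≠ lineFreeBound (Fintype.card K) n e := by
  classical
  intro heq
  obtain ⟨M, M', h₁, h₂, h0, hne, hns', -⟩ := exists_point_coordinates hF hns hk hP hFP
  have hG := isHomogeneous_lsub hF M
  set G := lsub M F with hGdef
  have heq' := heq
  rw [← zeroCount_lsub h₁ h₂] at heq'
  have h1 := ((zeroCount_le_and_eq_of_point hG h0 hne hns').2).1 heq'
  -- The tangent hyperplane has `q ^ n > 1` vectors, as `n ≥ 1`. The tangent line in the direction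
  -- `v` meets `X` in exactly `e` rational points other than the chosen point, and `e ≥ 1`.
  obtain ⟨v, hv0, hv⟩ : ∃ v : Fin (n + 1) → K, v ≠ 0 ∧ tangentForm G ⬝ᵥ v = 0 := by
    have hc := card_filter_dotProduct_eq_zero (tangentForm_ne_zero hns' h0)
    have hlt : 1 < (Finset.univ.filter fun v : Fin (n + 1) → K => tangentForm G ⬝ᵥ v = 0).card := by
      rw [hc]
      exact Nat.one_lt_pow (by omega) Fintype.one_lt_card
    obtain ⟨v, hv, hv0⟩ := Finset.exists_mem_ne hlt 0
    exact ⟨v, hv0, (Finset.mem_filter.1 hv).2⟩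
  have hcount := (h1 v hv0).1 hv
  -- the restriction of `F` to the line
  set h : Polynomial K := aeval (fun _ => Polynomial.X) (spec v G) with hh
  have heval : ∀ s, h.eval s = eval (Sum.elim (fun _ => s) v) G := by
    intro s
    rw [← eval_spec, hh, eval_aeval_X]
  have hdeg : h.natDegree ≤ e := by
    rw [hh, aeval_def, eval₂_eq]
    refine Polynomial.natDegree_sum_le_of_forall_le _ _ fun s hs => ?_
    refine (Polynomial.natDegree_C_mul_le _ _).trans ?_
    rw [Finset.prod_pow_eq_pow_sum, Polynomial.natDegree_X_pow]
    exact (le_totalDegree hs).trans (totalDegree_spec_le_of_tangent hG h0 hv)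
  have hh0 : h ≠ 0 := by
    intro hz
    refine hne v hv0 (eq_zero_of_forall_aeval fun x => ?_)
    have h2 := congrArg (Polynomial.aeval (x 0)) hz
    rw [map_zero, hh] at h2
    rw [← h2]
    have : (Polynomial.aeval (x 0) : Polynomial K →ₐ[K] AlgebraicClosure K).comp
        (aeval (fun _ : Fin 1 => (Polynomial.X : Polynomial K))) = aeval x := by
      apply MvPolynomial.algHom_ext
      intro i
      rw [AlgHom.comp_apply, aeval_X, aeval_X, Polynomial.aeval_X, Subsingleton.elim i 0]
    rw [← this, AlgHom.comp_apply]
  have hroots : h.roots.toFinset.card = e := by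
    rw [← hcount, zeroCount, ← Nat.card_eq_finsetCard]
    refine Nat.card_congr ⟨fun s => ⟨fun _ => s.1, ?_⟩, fun x => ⟨x.1 0, ?_⟩, fun s => rfl,
      fun x => ?_⟩
    · rw [eval_spec, ← heval]
      have := s.2
      rw [Multiset.mem_toFinset, Polynomial.mem_roots hh0] at this
      exact this
    · rw [Multiset.mem_toFinset, Polynomial.mem_roots hh0, Polynomial.IsRoot, heval, ← eval_spec]
      have h3 : (fun _ => x.1 0) = x.1 := by
        ext i
        rw [Subsingleton.elim i 0]
      rw [h3]
      exact x.2
    · apply Subtype.ext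
      ext i
      rw [Subsingleton.elim i 0]
  obtain ⟨s₀, hs₀⟩ : h.roots.toFinset.Nonempty := by
    rw [← Finset.card_pos]
    omega
  rw [Multiset.mem_toFinset] at hs₀
  have hs₀' : h.eval s₀ = 0 := (Polynomial.mem_roots hh0).1 hs₀
  set Q := M.mulVec (Sum.elim (fun _ => s₀) v) with hQdef
  set P' := M.mulVec (Sum.elim (1 : Fin 1 → K) 0) with hP'def
  have hinj : ∀ y, M'.mulVec (M.mulVec y) = y := fun y => by
    rw [Matrix.mulVec_mulVec, h₂, Matrix.one_mulVec]
  have hFQ : eval Q F = 0 := by rw [hQdef, ← eval_lsub, ← heval, hs₀']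
  have hFP' : eval P' F = 0 := by
    rw [hP'def, ← eval_lsub, ← eval_spec, h0, map_zero]
  have hQ0 : Q ≠ 0 := by
    intro h2
    have h3 := hinj (Sum.elim (fun _ => s₀) v)
    rw [← hQdef, h2, Matrix.mulVec_zero] at h3
    exact hv0 (funext fun j => (congrFun h3 (Sum.inr j)).symm)
  have hP'Q : ∀ c : K, P' ≠ c • Q := by
    intro c h2
    have h3 := congrArg M'.mulVec h2
    rw [hP'def, hQdef, Matrix.mulVec_smul, hinj, hinj] at h3
    have hc0 : c = 0 := by
      obtain ⟨j, hj⟩ := Function.ne_iff.1 hv0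
      have := congrFun h3 (Sum.inr j)
      simp only [Sum.elim_inr, Pi.zero_apply, Pi.smul_apply, smul_eq_mul] at this
      exact (mul_eq_zero.1 this.symm).resolve_right hj
    have := congrFun h3 (Sum.inl 0)
    simp [hc0] at this
  have hline : Nat.card {s : K // eval (s • Q + P') F = 0} = e := by
    rw [← hroots, ← Nat.card_eq_finsetCard]
    -- For `s ≠ 0` the point `s • Q + P'` has parameter `s₀ + s⁻¹` on the line. With `0⁻¹ = 0`, the
    -- value `s = 0`, which stands for `P'`, is matched with `s₀`, the parameter of `Q`; both points
    -- lie on `X`, so the counts agree.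
    refine Nat.card_congr (Equiv.subtypeEquiv ⟨fun s => s₀ + s⁻¹, fun t => (t - s₀)⁻¹,
      fun s => by simp, fun t => by simp⟩ fun s => ?_)
    rw [Equiv.coe_fn_mk, Multiset.mem_toFinset, Polynomial.mem_roots hh0, Polynomial.IsRoot]
    by_cases hs : s = 0
    · simp [hs, hs₀', hFP']
    · have h3 : s • Q + P' = s • M.mulVec (Sum.elim (fun _ => s₀ + s⁻¹) v) := by
        rw [hQdef, hP'def, ← Matrix.mulVec_smul, ← Matrix.mulVec_smul, ← Matrix.mulVec_add]
        congr 1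
        ext (i | j)
        · simp [mul_add, mul_inv_cancel₀ hs]
        · simp
      rw [h3, eval_smul_of_isHomogeneous hF, ← eval_lsub, heval, mul_eq_zero,
        or_iff_right (pow_ne_zero _ hs)]
  -- A line transversal at `Q` would carry `e + 1` zeros besides `Q`, but this one carries only `e`.
  have htan : ∑ i, P' i * eval Q (pderiv i F) = 0 := by
    by_contra hT
    have := card_line_of_zeroCount_eq hF hns hk heq hQ0 hFQ hT hP'Q
    omega
  have hder : h.derivative.eval s₀ = 0 := by
    have h3 : h.derivative.eval s₀ = eval (Sum.elim (fun _ => s₀) v) (pderiv (Sum.inl 0) G) := by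
      rw [hh, derivative_aeval_X, ← spec_pderiv_inl, ← eval_spec, eval_aeval_X]
    rw [h3, hGdef, pderiv_lsub, map_sum, ← htan]
    refine Finset.sum_congr rfl fun i _ => ?_
    rw [map_mul, eval_C, eval_lsub, hP'def]
    congr 1
    simp [Matrix.mulVec, dotProduct]
  -- Tangency at `Q` makes `s₀` a double root, while `e` distinct roots in degree at most `e` leave
  -- no room for multiplicities.
  have hmult : 1 < h.rootMultiplicity s₀ :=
    (Polynomial.one_lt_rootMultiplicity_iff_isRoot hh0).2 ⟨hs₀', hder⟩
  have hnodup : h.roots.Nodup := by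
    rw [← Multiset.toFinset_card_eq_card_iff_nodup]
    refine le_antisymm (Multiset.toFinset_card_le _) ?_
    rw [hroots]
    exact h.card_roots'.trans hdeg
  have := Multiset.nodup_iff_count_le_one.1 hnodup s₀
  rw [Polynomial.count_roots] at this
  omega

end LineFree

/-! ### Linear systems of powers of linear forms -/

section Power

variable {K : Type*} [Field K]

/-- Write `e = p^r k` with `p ∤ k`. If `k > 1`, the coefficient of `X^(p^r)` on the right is a
nonzero multiple of `k`, but on the left it is zero. -/
lemma exists_eq_prime_pow {p : ℕ} [Fact p.Prime] [CharP K p] {e : ℕ} (he : e ≠ 0)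
    {a b c α β : K} (hc : c ≠ 0) (hα : α ≠ 0) (hβ : β ≠ 0)
    (h : Polynomial.C a * Polynomial.X ^ e + Polynomial.C b
      = Polynomial.C c * (Polynomial.C α * Polynomial.X + Polynomial.C β) ^ e) :
    ∃ r, e = p ^ r := by
  have hp : p.Prime := Fact.out
  obtain ⟨r, k, hk, hrk⟩ := Nat.exists_eq_pow_mul_and_not_dvd he p hp.ne_one
  refine ⟨r, ?_⟩
  rcases Nat.lt_trichotomy k 1 with hk1 | rfl | hk1
  · have : k = 0 := by omega
    subst this
    simp at hk
  · rw [hrk, mul_one]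
  exfalso
  have hpr : 0 < p ^ r := pow_pos hp.pos r
  have hlt : p ^ r < e := by rw [hrk]; exact (Nat.lt_mul_iff_one_lt_right hpr).2 hk1
  have h1 : (Polynomial.C α * Polynomial.X + Polynomial.C β) ^ e = Polynomial.expand K (p ^ r)
      ((Polynomial.C (α ^ p ^ r) * Polynomial.X + Polynomial.C (β ^ p ^ r)) ^ k) := by
    rw [hrk, pow_mul, add_pow_char_pow, mul_pow, map_pow, map_add, map_mul, Polynomial.expand_X,
      Polynomial.expand_C, Polynomial.expand_C, map_pow, map_pow]
  have h2 := congrArg (fun P => Polynomial.coeff P (p ^ r)) h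
  simp only [h1, Polynomial.coeff_add, Polynomial.coeff_C_mul, Polynomial.coeff_X_pow,
    hlt.ne, if_false, Polynomial.coeff_C, hpr.ne', mul_zero, add_zero] at h2
  have h4 := Polynomial.coeff_expand_mul hpr
    ((Polynomial.C (α ^ p ^ r) * Polynomial.X + Polynomial.C (β ^ p ^ r)) ^ k) 1
  rw [one_mul] at h4
  rw [h4] at h2
  have h3 : ∀ a b : K, ((Polynomial.C a * Polynomial.X + Polynomial.C b) ^ k).coeff 1
      = k * b ^ (k - 1) * a := by
    intro a b
    have := Polynomial.coeff_derivative ((Polynomial.C a * Polynomial.X + Polynomial.C b) ^ k) 0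
    rw [Nat.cast_zero, zero_add, zero_add, mul_one] at this
    rw [← this, Polynomial.coeff_zero_eq_eval_zero, Polynomial.derivative_pow]
    simp
  rw [h3] at h2
  have hk0 : (k : K) ≠ 0 := by rwa [Ne, CharP.cast_eq_zero_iff K p]
  exact mul_ne_zero hc (mul_ne_zero (mul_ne_zero hk0 (pow_ne_zero _ (pow_ne_zero _ hβ)))
    (pow_ne_zero _ hα)) h2.symm

lemma aeval_line_linForm {σ : Type*} [Fintype σ] (L x y : σ → K) :
    aeval (fun k => Polynomial.C (x k) * Polynomial.X + Polynomial.C (y k)) (linForm L)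
      = Polynomial.C (L ⬝ᵥ x) * Polynomial.X + Polynomial.C (L ⬝ᵥ y) := by
  rw [aeval_linForm]
  simp only [dotProduct, map_sum, Finset.sum_mul, map_mul, ← Finset.sum_add_distrib,
    Polynomial.algebraMap_eq]
  refine Finset.sum_congr rfl fun i _ => ?_
  ring

lemma exists_dotProduct_eq_zero {m : ℕ} (hm : 1 ≤ m) (L : Fin (m + 1) → K) :
    ∃ y ≠ 0, L ⬝ᵥ y = 0 := by
  by_contra! h
  have hinj : Function.Injective (Matrix.mulVecLin (Matrix.of fun _ : Fin 1 => L)) := by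
    rw [← LinearMap.ker_eq_bot, LinearMap.ker_eq_bot']
    intro y hy
    by_contra hy0
    exact h y hy0 (congrFun hy 0)
  have := LinearMap.finrank_le_finrank_of_injective hinj
  simp at this
  omega

variable {m N e : ℕ} {T : (Fin N → K) →ₗ[K] MvPolynomial (Fin (m + 1)) K}

/-- A linear system of `e`-th powers of linear forms without base points, in at least two
variables, exists only if `e` is a power of the characteristic. -/
lemma exists_eq_prime_pow_of_linear_system {p : ℕ} [Fact p.Prime] [CharP K p] (hm : 1 ≤ m)
    (hN : 1 ≤ N) (he : e ≠ 0)
    (hT : ∀ v ≠ 0, ∃ (c : K) (L : Fin (m + 1) → K), c ≠ 0 ∧ L ≠ 0 ∧ T v = C c * linForm L ^ e)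
    (hker : ∀ x ≠ 0, ∃ j, eval x (T (Pi.single j 1)) ≠ 0) : ∃ r, e = p ^ r := by
  have hs : ∀ j : Fin N, (Pi.single j 1 : Fin N → K) ≠ 0 := fun j => by simp
  obtain ⟨j⟩ : Nonempty (Fin N) := ⟨⟨0, hN⟩⟩
  obtain ⟨c₁, L₁, hc₁, hL₁, hT₁⟩ := hT _ (hs j)
  -- On the plane spanned by `y`, where `L₁ = 0` and `L₂ ≠ 0`, and `x`, where the roles are
  -- exchanged, the two powers become `e`-th powers of independent coordinates. Their sum is again
  -- an `e`-th power up to a constant.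
  obtain ⟨y, hy, hL₁y⟩ := exists_dotProduct_eq_zero hm L₁
  obtain ⟨i, hi⟩ := hker y hy
  obtain ⟨c₂, L₂, hc₂, hL₂, hT₂⟩ := hT _ (hs i)
  have hij : i ≠ j := by
    rintro rfl
    rw [hT₁, map_mul, map_pow, eval_linForm, hL₁y, zero_pow he, mul_zero] at hi
    exact hi rfl
  have hL₂y : L₂ ⬝ᵥ y ≠ 0 := by
    intro h
    rw [hT₂, map_mul, map_pow, eval_linForm, h, zero_pow he, mul_zero] at hi
    exact hi rfl
  obtain ⟨x, hL₁x, hL₂x⟩ : ∃ x, L₁ ⬝ᵥ x ≠ 0 ∧ L₂ ⬝ᵥ x = 0 := by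
    obtain ⟨k, hk⟩ := Function.ne_iff.1 hL₁
    refine ⟨Pi.single k 1 - (L₂ k / (L₂ ⬝ᵥ y)) • y, ?_, ?_⟩
    · rw [dotProduct_sub, dotProduct_smul, hL₁y, dotProduct_single]
      simpa using hk
    · rw [dotProduct_sub, dotProduct_smul, dotProduct_single, smul_eq_mul, div_mul_cancel₀ _ hL₂y]
      simp
  have hne : (Pi.single j 1 + Pi.single i 1 : Fin N → K) ≠ 0 := by
    intro h
    have := congrFun h j
    simp [hij.symm] at this
  obtain ⟨c, L, hc, hL, hT₃⟩ := hT _ hne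
  rw [map_add, hT₁, hT₂] at hT₃
  have hx := congrArg (eval x) hT₃
  have hy' := congrArg (eval y) hT₃
  simp only [map_add, map_mul, map_pow, eval_C, eval_linForm, hL₂x, hL₁y, zero_pow he, mul_zero,
    add_zero, zero_add] at hx hy'
  have hα : L ⬝ᵥ x ≠ 0 := by
    intro h
    rw [h, zero_pow he, mul_zero] at hx
    exact mul_ne_zero hc₁ (pow_ne_zero _ hL₁x) hx
  have hβ : L ⬝ᵥ y ≠ 0 := by
    intro h
    rw [h, zero_pow he, mul_zero] at hy'
    exact mul_ne_zero hc₂ (pow_ne_zero _ hL₂y) hy'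
  have hpoly := congrArg
    (aeval fun k => Polynomial.C (x k) * Polynomial.X + Polynomial.C (y k)) hT₃
  simp only [map_add, map_mul, map_pow, aeval_line_linForm, hL₂x, hL₁y, map_zero, zero_mul,
    add_zero, zero_add, aeval_C, Polynomial.algebraMap_eq] at hpoly
  refine exists_eq_prime_pow he hc hα hβ (a := c₁ * (L₁ ⬝ᵥ x) ^ e) (b := c₂ * (L₂ ⬝ᵥ y) ^ e) ?_
  rw [← hpoly]
  simp only [map_mul, map_pow]
  ring

lemma linForm_smul {σ : Type*} [Fintype σ] (c : K) (L : σ → K) :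
    linForm (c • L) = C c * linForm L := by
  simp only [linForm, Finset.mul_sum, Pi.smul_apply, smul_eq_mul, map_mul, mul_assoc]

lemma linForm_single {σ : Type*} [Fintype σ] [DecidableEq σ] (i : σ) :
    linForm (Pi.single i 1 : σ → K) = X i := by
  rw [linForm, Finset.sum_eq_single i]
  · simp
  · intro j _ hj
    simp [hj]
  · simp

lemma linForm_pow_char_pow {p : ℕ} [Fact p.Prime] [CharP K p] {σ : Type*} [Fintype σ] (r : ℕ)
    (L : σ → K) : linForm L ^ p ^ r = ∑ i, C (L i ^ p ^ r) * X i ^ p ^ r := by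
  rw [linForm, sum_pow_char_pow]
  simp only [mul_pow, map_pow]

lemma exists_pow_char_pow_eq [Finite K] (p : ℕ) [Fact p.Prime] [CharP K p] (r : ℕ) (c : K) :
    ∃ a, a ^ p ^ r = c := by
  have : Function.Injective (iterateFrobenius K p r) := (iterateFrobenius K p r).injective
  obtain ⟨a, ha⟩ := (Finite.injective_iff_surjective.1 this) c
  exact ⟨a, ha⟩

/-- Constants are `p^r`-th powers, so each member is the power of one form `Λ v`. The map `Λ` is
injective, so `N ≤ m + 1` by counting elements, without `K`-linearity of `Λ`. Absence of base points
says that the `Λ` of the basis vectors have no common zero, so `m + 1 ≤ N`; they are then the new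
coordinates. -/
lemma exists_coordinates_of_linear_system [Fintype K] {p r : ℕ} [Fact p.Prime] [CharP K p]
    (hT : ∀ v ≠ 0, ∃ (c : K) (L : Fin (m + 1) → K), c ≠ 0 ∧ L ≠ 0 ∧
      T v = C c * linForm L ^ p ^ r)
    (hker : ∀ x ≠ 0, ∃ j, eval x (T (Pi.single j 1)) ≠ 0) :
    ∃ hN : N = m + 1, ∃ B B' : Matrix (Fin (m + 1)) (Fin (m + 1)) K, B * B' = 1 ∧ B' * B = 1 ∧
      ∀ j, lsub B (T (Pi.single j 1)) = X (Fin.cast hN j) ^ p ^ r := by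
  have hpr : p ^ r ≠ 0 := pow_ne_zero _ (Fact.out : p.Prime).ne_zero
  have hL : ∀ v, ∃ L, T v = linForm L ^ p ^ r := by
    intro v
    rcases eq_or_ne v 0 with rfl | hv
    · exact ⟨0, by simp [linForm, zero_pow hpr]⟩
    · obtain ⟨c, L, hc, -, h⟩ := hT v hv
      obtain ⟨a, rfl⟩ := exists_pow_char_pow_eq p r c
      exact ⟨a • L, by rw [h, linForm_smul, mul_pow, map_pow]⟩
  choose Λ hΛ using hL
  have hTinj : ∀ v, T v = 0 → v = 0 := by
    intro v hv
    by_contra hv0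
    obtain ⟨c, L, hc, hL0, h⟩ := hT v hv0
    obtain ⟨k, hk⟩ := Function.ne_iff.1 hL0
    have h1 := congrArg (eval (Pi.single k 1)) (h.symm.trans hv)
    rw [map_mul, map_pow, eval_C, eval_linForm, dotProduct_single, mul_one, map_zero] at h1
    exact mul_ne_zero hc (pow_ne_zero _ hk) h1
  have hinj : Function.Injective Λ := by
    intro v w hvw
    refine sub_eq_zero.1 (hTinj _ ?_)
    rw [map_sub, hΛ v, hΛ w, hvw, sub_self]
  have hle : N ≤ m + 1 := by
    have h1 := Fintype.card_le_of_injective Λ hinj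
    simp only [Fintype.card_fun, Fintype.card_fin] at h1
    exact (Nat.pow_le_pow_iff_right Fintype.one_lt_card).1 h1
  let A : Matrix (Fin N) (Fin (m + 1)) K := Matrix.of fun j => Λ (Pi.single j 1)
  have hA : Function.Injective A.mulVecLin := by
    rw [← LinearMap.ker_eq_bot, LinearMap.ker_eq_bot']
    intro x hx
    by_contra hx0
    obtain ⟨j, hj⟩ := hker x hx0
    rw [hΛ, map_pow, eval_linForm] at hj
    have : Λ (Pi.single j 1) ⬝ᵥ x = 0 := congrFun hx j
    rw [this, zero_pow hpr] at hj
    exact hj rfl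
  have hge : m + 1 ≤ N := by
    have := LinearMap.finrank_le_finrank_of_injective hA
    simpa using this
  obtain rfl : N = m + 1 := le_antisymm hle hge
  have hAu : IsUnit A := Matrix.mulVec_injective_iff_isUnit.1 hA
  have hAd : IsUnit A.det := (Matrix.isUnit_iff_isUnit_det A).1 hAu
  refine ⟨rfl, A⁻¹, A, Matrix.nonsing_inv_mul A hAd, Matrix.mul_nonsing_inv A hAd, fun j => ?_⟩
  have h1 : Matrix.vecMul (Λ (Pi.single j 1)) A⁻¹ = Pi.single j 1 := by
    have : Λ (Pi.single j 1) = A.row j := rfl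
    rw [this, ← Matrix.single_one_vecMul, Matrix.vecMul_vecMul, Matrix.mul_nonsing_inv A hAd,
      Matrix.vecMul_one]
  rw [hΛ, map_pow, lsub_linForm, h1, linForm_single, Fin.cast_eq_self]

end Power

/-! ### Normal form of an extremal hypersurface -/

section Normal

variable {K : Type*} [Field K]

lemma prod_linForm_sub_C {σ : Type*} (ℓ : MvPolynomial σ K) (S : Finset K) :
    ∏ a ∈ S, (ℓ - C a) = Polynomial.aeval ℓ (∏ a ∈ S, (Polynomial.X - Polynomial.C a)) := by
  rw [map_prod]
  refine Finset.prod_congr rfl fun a _ => ?_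
  rw [map_sub, Polynomial.aeval_X, Polynomial.aeval_C, algebraMap_eq]

lemma homogeneousComponent_prod_linForm {σ : Type*} [Fintype σ] (L : σ → K) (S : Finset K) :
    homogeneousComponent S.card (∏ a ∈ S, (linForm L - C a)) = linForm L ^ S.card := by
  have hmonic : (∏ a ∈ S, (Polynomial.X - Polynomial.C a)).Monic :=
    Polynomial.monic_prod_of_monic _ _ fun a _ => Polynomial.monic_X_sub_C a
  have hdeg : (∏ a ∈ S, (Polynomial.X - Polynomial.C a)).natDegree = S.card := by
    rw [Polynomial.natDegree_prod_of_monic _ _ fun a _ => Polynomial.monic_X_sub_C a]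
    simp
  rw [prod_linForm_sub_C, Polynomial.aeval_eq_sum_range, hdeg, map_sum,
    Finset.sum_eq_single S.card]
  · rw [← hdeg, hmonic.coeff_natDegree, one_smul, hdeg]
    have := (isHomogeneous_linForm L).pow S.card
    rw [one_mul] at this
    exact homogeneousComponent_of_mem this |>.trans (if_pos rfl)
  · intro i _ hi
    have := (isHomogeneous_linForm L).pow i
    rw [one_mul] at this
    rw [map_smul, homogeneousComponent_of_mem this, if_neg hi.symm, smul_zero]
  · simp

variable {α α' β : Type*} [Fintype α'] [Fintype β] [DecidableEq β]

lemma spec_lsub_fromBlocks (B : Matrix α α' K) (v : β → K) (G : MvPolynomial (α ⊕ β) K) :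
    spec v (lsub (Matrix.fromBlocks B 0 0 (1 : Matrix β β K)) G) = lsub B (spec v G) := by
  have : (spec v).comp (lsub (Matrix.fromBlocks B 0 0 (1 : Matrix β β K)))
      = (lsub B).comp (spec v : MvPolynomial (α ⊕ β) K →ₐ[K] _) := by
    apply MvPolynomial.algHom_ext
    rintro (i | j)
    · simp [spec, lsub, linForm]
    · simp [spec, lsub, linForm, Matrix.one_apply]
  exact congrArg (fun φ => φ G) this

lemma linPart_lsub_fromBlocks [Fintype α] [DecidableEq α'] (B : Matrix α α' K) (j : β)
    (G : MvPolynomial (α ⊕ β) K) :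
    linPart j (lsub (Matrix.fromBlocks B 0 0 (1 : Matrix β β K)) G) = lsub B (linPart j G) := by
  rw [linPart, linPart, ← spec_lsub_fromBlocks, pderiv_lsub, Fintype.sum_sum_type]
  simp only [Matrix.fromBlocks_apply₁₂, Matrix.fromBlocks_apply₂₂, Matrix.zero_apply, C_0, zero_mul,
    Finset.sum_const_zero, zero_add, Matrix.one_apply]
  rw [Finset.sum_eq_single j]
  · simp
  · intro i _ hi
    simp [hi]
  · simp

/-- The normal form of an extremal hypersurface of degree `e + 1` in coordinates adapted to a linear
subspace of maximal dimension. -/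
structure IsExtremalNormal {m : ℕ} (e : ℕ) (G : MvPolynomial (Fin m ⊕ Fin m) K) : Prop where
  homogeneous : G.IsHomogeneous (e + 1)
  nonsing : Nonsing G
  spec_zero : spec 0 G = 0
  -- The argument is `w^e` because in the intended coordinates the leading part of `G(x, v)` is `∑
  -- v_j x_j^e`, which for `v = w^e` and `e` a power of the characteristic is `(w·x)^e`.
  spec_pow : ∀ w : Fin m → K, w ≠ 0 →
    ∃ S : Finset K, S.card = e ∧ spec (fun j => w j ^ e) G = ∏ a ∈ S, (linForm w - C a)

/-- Equality in Schwartz–Zippel for all `v` turns the leading parts into a linear system of `e`-th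
powers, and nonsingularity removes its base points. The two preceding results on such systems then
give the shape of `e`, the equality of dimensions and the coordinates. -/
theorem exists_isExtremalNormal [Fintype K] {p : ℕ} [Fact p.Prime] [CharP K p] {m N e : ℕ}
    {G : MvPolynomial (Fin (m + 1) ⊕ Fin N) K} (hm : 1 ≤ m) (hN : 1 ≤ N) (he : e ≠ 0)
    (hG : G.IsHomogeneous (e + 1)) (h0 : spec 0 G = 0) (hne : ∀ v ≠ 0, spec v G ≠ 0)
    (hns : Nonsing G) (hcount : ∀ v ≠ 0, zeroCount (spec v G) = e * Fintype.card K ^ m) :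
    N = m + 1 ∧ e ≤ Fintype.card K ∧ ∃ r, e = p ^ r ∧
      ∃ G' : MvPolynomial (Fin (m + 1) ⊕ Fin (m + 1)) K,
        LinEquivalent G G' ∧ IsExtremalNormal e G' := by
  have heq : e ≤ Fintype.card K := by
    have hv : (Pi.single ⟨0, hN⟩ 1 : Fin N → K) ≠ 0 := by simp
    have h1 := hcount _ hv
    have h2 : zeroCount (spec (Pi.single ⟨0, hN⟩ 1 : Fin N → K) G) ≤ Fintype.card K ^ (m + 1) := by
      have := Nat.card_le_card_of_injective (Subtype.val :
        {x // eval x (spec (Pi.single ⟨0, hN⟩ 1 : Fin N → K) G) = 0} → _) Subtype.val_injective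
      rwa [Nat.card_eq_fintype_card (α := Fin (m + 1) → K), Fintype.card_fun,
        Fintype.card_fin] at this
    rw [h1, pow_succ, mul_comm] at h2
    exact Nat.le_of_mul_le_mul_left h2 (pow_pos Fintype.card_pos m)
  have hprod : ∀ v ≠ 0, ∃ (c : K) (L : Fin (m + 1) → K) (S : Finset K), c ≠ 0 ∧ L ≠ 0 ∧
      S.card = e ∧ spec v G = C c * ∏ a ∈ S, (linForm L - C a) := fun v hv =>
    exists_eq_prod_of_zeroCount_eq (hne v hv) (totalDegree_spec_le hG h0 v)
      (Nat.one_le_iff_ne_zero.2 he) heq (hcount v hv)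
  let T : (Fin N → K) →ₗ[K] MvPolynomial (Fin (m + 1)) K :=
    Fintype.linearCombination K fun j => linPart j G
  have hTv : ∀ v, T v = homogeneousComponent e (spec v G) := by
    intro v
    rw [homogeneousComponent_spec hG]
    simp only [T, Fintype.linearCombination_apply, smul_eq_C_mul]
  have hTs : ∀ j, T (Pi.single j 1) = linPart j G := by
    intro j
    simp [T, Fintype.linearCombination_apply_single]
  have hT : ∀ v ≠ 0, ∃ (c : K) (L : Fin (m + 1) → K), c ≠ 0 ∧ L ≠ 0 ∧
      T v = C c * linForm L ^ e := by
    intro v hv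
    obtain ⟨c, L, S, hc, hL, hS, h⟩ := hprod v hv
    refine ⟨c, L, hc, hL, ?_⟩
    rw [hTv, h, homogeneousComponent_C_mul, ← hS, homogeneousComponent_prod_linForm]
  have hker : ∀ x ≠ 0, ∃ j, eval x (T (Pi.single j 1)) ≠ 0 := by
    intro x hx
    simpa only [hTs] using exists_eval_linPart_ne_zero hns h0 hx
  obtain ⟨r, rfl⟩ := exists_eq_prime_pow_of_linear_system (p := p) hm hN he hT hker
  obtain ⟨rfl, B, B', hB, hB', hBT⟩ := exists_coordinates_of_linear_system hT hker
  refine ⟨rfl, heq, r, rfl, lsub (Matrix.fromBlocks B 0 0 1) G, ?_, ?_⟩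
  · refine LinEquivalent.of_lsub (N := Matrix.fromBlocks B' 0 0 1) ?_ ?_ G <;>
      simp [Matrix.fromBlocks_multiply, hB, hB', Matrix.fromBlocks_one]
  have hlin : ∀ j, linPart j (lsub (Matrix.fromBlocks B 0 0 1) G) = X j ^ p ^ r := by
    intro j
    rw [linPart_lsub_fromBlocks, ← hTs, hBT, Fin.cast_eq_self]
  have hG' := isHomogeneous_lsub hG
    (Matrix.fromBlocks B 0 0 (1 : Matrix (Fin (m + 1)) (Fin (m + 1)) K))
  refine ⟨hG', ?_, ?_, fun w hw => ?_⟩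
  · refine hns.lsub (N := Matrix.fromBlocks B' 0 0 1) ?_ ?_ <;>
      simp [Matrix.fromBlocks_multiply, hB, hB', Matrix.fromBlocks_one]
  · rw [spec_lsub_fromBlocks, h0, map_zero]
  have hv : (fun j => w j ^ p ^ r) ≠ 0 := by
    intro h
    exact hw (funext fun j => pow_eq_zero_iff he |>.1 (congrFun h j))
  obtain ⟨c, L, S, hc, hL, hS, h⟩ := hprod _ hv
  obtain ⟨a, rfl⟩ := exists_pow_char_pow_eq p r c
  have ha : a ≠ 0 := by rintro rfl; exact hc (zero_pow he)
  -- The constant `a^e` is distributed over the `e` factors, which scales the linear form and the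
  -- roots by `a`. Comparing leading parts below, injectivity of Frobenius identifies the scaled
  -- form with `w`.
  have h2 : spec (fun j => w j ^ p ^ r) (lsub (Matrix.fromBlocks B 0 0 1) G)
      = ∏ b ∈ S.map ⟨(a * ·), mul_right_injective₀ ha⟩, (linForm (a • Matrix.vecMul L B) - C b) := by
    rw [spec_lsub_fromBlocks, h, Finset.prod_map, map_mul, map_prod, algHom_C, algebraMap_eq,
      ← hS, map_pow, ← Finset.prod_const, ← Finset.prod_mul_distrib]
    refine Finset.prod_congr rfl fun b _ => ?_
    rw [map_sub, lsub_linForm, algHom_C, algebraMap_eq, linForm_smul, mul_sub,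
      Function.Embedding.coeFn_mk, map_mul]
  have hS' : (S.map ⟨(a * ·), mul_right_injective₀ ha⟩).card = p ^ r := by
    rw [Finset.card_map, hS]
  refine ⟨_, hS', ?_⟩
  rw [h2]
  have h3 := homogeneousComponent_spec hG' fun j => w j ^ p ^ r
  rw [h2, ← hS', homogeneousComponent_prod_linForm, hS'] at h3
  simp only [hlin] at h3
  rw [← linForm_pow_char_pow] at h3
  have h4 : a • Matrix.vecMul L B = w := by
    funext j
    have h5 := congrArg (eval (Pi.single j 1)) h3
    simp only [map_pow, eval_linForm, dotProduct_single, mul_one] at h5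
    exact (iterateFrobenius K p r).injective h5
  rw [h4]

end Normal

/-! ### Forms of low degree and sesquilinear shapes -/

section General

variable {K : Type*} [Field K] {σ : Type*}

lemma exists_eq_sum_X_mul [Fintype σ] {F : MvPolynomial σ K} {d : ℕ} (hF : F.IsHomogeneous (d + 1)) :
    ∃ H : σ → MvPolynomial σ K, (∀ i, (H i).IsHomogeneous d) ∧ F = ∑ i, X i * H i := by
  classical
  have key : ∀ t : Finset (σ →₀ ℕ), (∀ s ∈ t, s.degree = d + 1) →
      ∃ H : σ → MvPolynomial σ K, (∀ i, (H i).IsHomogeneous d) ∧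
        ∑ s ∈ t, monomial s (coeff s F) = ∑ i, X i * H i := by
    intro t
    induction t using Finset.induction_on with
    | empty => exact fun _ => ⟨0, fun i => isHomogeneous_zero _ _ _, by simp⟩
    | insert s t hs ih =>
      intro ht
      obtain ⟨H, hH, hsum⟩ := ih fun u hu => ht u (Finset.mem_insert_of_mem hu)
      have hsd := ht s (Finset.mem_insert_self s t)
      obtain ⟨i, hi⟩ : ∃ i, s i ≠ 0 := by
        by_contra! h
        have : s = 0 := Finsupp.ext h
        rw [this, map_zero] at hsd
        omega
      have hle : Finsupp.single i 1 ≤ s := Finsupp.single_le_iff.2 (Nat.one_le_iff_ne_zero.2 hi)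
      have hsplit : Finsupp.single i 1 + (s - Finsupp.single i 1) = s := add_tsub_cancel_of_le hle
      refine ⟨H + Pi.single i (monomial (s - Finsupp.single i 1) (coeff s F)), fun j => ?_, ?_⟩
      · refine (hH j).add ?_
        rcases eq_or_ne j i with rfl | hj
        · rw [Pi.single_eq_same]
          refine isHomogeneous_monomial _ ?_
          have := congrArg Finsupp.degree hsplit
          rw [map_add, Finsupp.degree_single, hsd] at this
          omega
        · rw [Pi.single_eq_of_ne hj]
          exact isHomogeneous_zero _ _ _
      · rw [Finset.sum_insert hs, hsum]
        simp only [Pi.add_apply, mul_add, Finset.sum_add_distrib]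
        rw [add_comm, Finset.sum_eq_single (f := fun j => X j * Pi.single (M := fun _ =>
          MvPolynomial σ K) i _ j) i, Pi.single_eq_same]
        · congr 1
          conv_lhs => rw [← hsplit]
          rw [monomial_single_add, pow_one, hsplit]
        · intro j _ hj
          rw [Pi.single_eq_of_ne hj, mul_zero]
        · simp
  obtain ⟨H, hH, h⟩ := key F.support fun s hs => by
    by_contra hne
    exact (mem_support_iff.1 hs) (hF.coeff_eq_zero hne)
  exact ⟨H, hH, by rw [← h, ← F.as_sum]⟩

lemma exists_eq_C {F : MvPolynomial σ K} (hF : F.IsHomogeneous 0) : ∃ c, F = C c := by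
  rw [← totalDegree_zero_iff_isHomogeneous, totalDegree_eq_zero_iff_eq_C] at hF
  exact ⟨_, hF⟩

lemma exists_eq_linForm [Fintype σ] {F : MvPolynomial σ K} (hF : F.IsHomogeneous 1) :
    ∃ L, F = linForm L := by
  obtain ⟨H, hH, h⟩ := exists_eq_sum_X_mul hF
  choose L hL using fun i => exists_eq_C (hH i)
  exact ⟨L, by rw [h, linForm]; simp only [hL, mul_comm]⟩

lemma exists_eq_sum_of_isHomogeneous_two [Fintype σ] {F : MvPolynomial σ K}
    (hF : F.IsHomogeneous 2) :
    ∃ A : Matrix σ σ K, F = ∑ i, X i * linForm (A i) := by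
  obtain ⟨H, hH, h⟩ := exists_eq_sum_X_mul hF
  choose A hA using fun i => exists_eq_linForm (hH i)
  exact ⟨A, by rw [h]; simp only [hA]⟩

lemma eq_of_eval_eq [Fintype K] {F G : MvPolynomial σ K} {a : ℕ} (hF : F.IsHomogeneous a)
    (hG : G.IsHomogeneous a) (ha : a ≤ Fintype.card K) (h : ∀ x, eval x F = eval x G) : F = G :=
  sub_eq_zero.1 (eq_zero_of_isHomogeneous (hF.sub hG) ha fun x => by rw [map_sub, h, sub_self])

lemma aeval_algebraMap_comp (A : Type*) [CommRing A] [Algebra K A] (x : σ → K)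
    (P : MvPolynomial σ K) :
    aeval (fun i => algebraMap K A (x i)) P = algebraMap K A (eval x P) := by
  have := aeval_algebraMap_apply A x P
  rwa [aeval_eq_eval] at this

lemma Nonsing.exists_eval_pderiv_ne_zero {F : MvPolynomial σ K} (hF : Nonsing F) {x : σ → K}
    (hx : x ≠ 0) (h : eval x F = 0) : ∃ i, eval x (pderiv i F) ≠ 0 := by
  obtain ⟨i, hi⟩ := hF (fun i => algebraMap K (AlgebraicClosure K) (x i)) (fun h' => hx (funext
    fun i => (algebraMap K (AlgebraicClosure K)).injective (by
      simpa using congrFun h' i))) (by rw [aeval_algebraMap_comp, h, map_zero])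
  refine ⟨i, fun h' => hi ?_⟩
  rw [aeval_algebraMap_comp, h', map_zero]

lemma LinEquivalent.rename {τ : Type*} [Fintype σ] [Fintype τ] [DecidableEq σ] [DecidableEq τ]
    (f : σ ≃ τ) (F : MvPolynomial σ K) : LinEquivalent F (MvPolynomial.rename f F) := by
  have h : ∀ F : MvPolynomial σ K,
      FqHypersurface.lsub (f.toPEquiv.toMatrix : Matrix σ τ K) F = MvPolynomial.rename f F := by
    intro F
    have : FqHypersurface.lsub (f.toPEquiv.toMatrix : Matrix σ τ K)
        = (MvPolynomial.rename f : MvPolynomial σ K →ₐ[K] _) := by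
      apply MvPolynomial.algHom_ext
      intro i
      rw [FqHypersurface.lsub, aeval_X, rename_X, ← linForm_single]
      congr 1
      ext j
      simp [PEquiv.toMatrix_apply, Pi.single_apply, eq_comm]
    rw [this]
  rw [← h]
  refine LinEquivalent.of_lsub (N := (f.symm.toPEquiv.toMatrix : Matrix τ σ K)) ?_ ?_ F
  · rw [← PEquiv.toMatrix_trans, ← Equiv.toPEquiv_trans, Equiv.self_trans_symm,
      Equiv.toPEquiv_refl, PEquiv.toMatrix_refl]
  · rw [← PEquiv.toMatrix_trans, ← Equiv.toPEquiv_trans, Equiv.symm_trans_self,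
      Equiv.toPEquiv_refl, PEquiv.toMatrix_refl]

/-- The form `∑ A_{ij} X_i X_j^e`. -/
def sesqForm [Fintype σ] (e : ℕ) (A : Matrix σ σ K) : MvPolynomial σ K :=
  ∑ i, ∑ j, C (A i j) * X i * X j ^ e

lemma eval_sesqForm [Fintype σ] (e : ℕ) (A : Matrix σ σ K) (x : σ → K) :
    eval x (sesqForm e A) = ∑ i, ∑ j, A i j * x i * x j ^ e := by
  simp [sesqForm]

lemma eval_pderiv_sesqForm [Fintype σ] {e : ℕ} (he : (e : K) = 0) (A : Matrix σ σ K) (x : σ → K)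
    (k : σ) : eval x (pderiv k (sesqForm e A)) = ∑ j, A k j * x j ^ e := by
  classical
  have hterm : ∀ i j, eval x (pderiv k (C (A i j) * X i * X j ^ e))
      = if i = k then A i j * x j ^ e else 0 := by
    intro i j
    rw [pderiv_mul, pderiv_C_mul, pderiv_pow]
    simp only [map_add, map_mul, map_pow, map_natCast, he, eval_C, eval_X, zero_mul, mul_zero,
      add_zero]
    split_ifs with hik
    · rw [hik, pderiv_X_self, map_one, mul_one]
    · rw [pderiv_X_of_ne hik, map_zero, mul_zero, zero_mul]
  rw [sesqForm]
  simp only [map_sum, hterm]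
  rw [Finset.sum_eq_single k]
  · simp
  · intro i _ hi
    simp [hi]
  · simp

end General

/-! ### The case `e = q`: space-filling hypersurfaces -/

section SpaceFilling

variable {K : Type*} [Field K] [Fintype K] {n : ℕ}

lemma eval_spaceFilling (A : Matrix (Fin (n + 2)) (Fin (n + 2)) K) (x : Fin (n + 2) → K) :
    eval x (spaceFilling (Fintype.card K) A) = ∑ i, ∑ j, A i j * x i * x j := by
  simp [spaceFilling, FiniteField.pow_card]

theorem exists_eq_spaceFilling {F : MvPolynomial (Fin (n + 2)) K}
    (hF : F.IsHomogeneous (Fintype.card K + 1)) (hns : Nonsing F) (h0 : ∀ x, eval x F = 0) :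
    ∃ A : Matrix (Fin (n + 2)) (Fin (n + 2)) K, A.transpose = -A ∧ (∀ i, A i i = 0) ∧
      A.det ≠ 0 ∧ F = spaceFilling (Fintype.card K) A := by
  have hq : 1 < Fintype.card K := Fintype.one_lt_card
  obtain ⟨h, hdeg, hsum⟩ := exists_eq_sum_mul_of_eval_eq_zero hF.totalDegree_le h0
  choose L hL using fun i => exists_eq_linForm (homogeneousComponent_isHomogeneous 1 (h i))
  have hh : ∀ i, h i = C (coeff 0 (h i)) + linForm (L i) := by
    intro i
    rw [← hL, ← homogeneousComponent_zero]
    conv_lhs => rw [← sum_homogeneousComponent (h i)]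
    rw [Finset.sum_subset (Finset.range_mono (Nat.succ_le_succ (hdeg i))), Finset.sum_range_succ,
      Finset.sum_range_one]
    intro k _ hk
    refine homogeneousComponent_eq_zero _ _ ?_
    simpa using hk
  have hFL : F = ∑ i, linForm (L i) * X i ^ Fintype.card K := by
    have h1 : homogeneousComponent (Fintype.card K + 1) F = F :=
      (homogeneousComponent_of_mem hF).trans (if_pos rfl)
    rw [← h1]
    conv_lhs => rw [hsum]
    rw [map_sum]
    refine Finset.sum_congr rfl fun i _ => ?_
    rw [hh i]
    have e1 : (C (coeff 0 (h i)) * X i ^ Fintype.card K).IsHomogeneous (0 + 1 * Fintype.card K) :=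
      (isHomogeneous_C _ _).mul ((isHomogeneous_X _ i).pow _)
    have e2 : (C (coeff 0 (h i)) * X i).IsHomogeneous (0 + 1) :=
      (isHomogeneous_C _ _).mul (isHomogeneous_X _ i)
    have e3 : (linForm (L i) * X i ^ Fintype.card K).IsHomogeneous (1 + 1 * Fintype.card K) :=
      (isHomogeneous_linForm _).mul ((isHomogeneous_X _ i).pow _)
    have e4 : (linForm (L i) * X i).IsHomogeneous (1 + 1) :=
      (isHomogeneous_linForm _).mul (isHomogeneous_X _ i)
    rw [show (C (coeff 0 (h i)) + linForm (L i)) * (X i ^ Fintype.card K - X i)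
      = C (coeff 0 (h i)) * X i ^ Fintype.card K - C (coeff 0 (h i)) * X i
        + linForm (L i) * X i ^ Fintype.card K - linForm (L i) * X i by ring,
      map_sub, map_add, map_sub, homogeneousComponent_of_mem e1, homogeneousComponent_of_mem e2,
      homogeneousComponent_of_mem e3, homogeneousComponent_of_mem e4, if_neg (by omega),
      if_neg (by omega), if_pos (by omega), if_neg (by omega)]
    ring
  have hFA : F = spaceFilling (Fintype.card K) (Matrix.of L).transpose := by
    rw [hFL, spaceFilling, Finset.sum_comm]
    refine Finset.sum_congr rfl fun j _ => ?_
    rw [linForm, Finset.sum_mul]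
    rfl
  generalize (Matrix.of L).transpose = A at hFA
  have hev : ∀ x : Fin (n + 2) → K, ∑ i, ∑ j, A i j * x i * x j = 0 := by
    intro x
    rw [← eval_spaceFilling, ← hFA, h0]
  have hbil : ∀ x : Fin (n + 2) → K, x ⬝ᵥ A.mulVec x = 0 := by
    intro x
    rw [← hev x]
    simp only [dotProduct, Matrix.mulVec, Finset.mul_sum]
    exact Finset.sum_congr rfl fun i _ => Finset.sum_congr rfl fun j _ => by ring
  have hdiag : ∀ i, A i i = 0 := by
    intro i
    simpa using hbil (Pi.single i 1)
  refine ⟨A, ?_, hdiag, fun hdet => ?_, hFA⟩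
  · ext i j
    have h1 := hbil (Pi.single i 1 + Pi.single j 1)
    simp only [Matrix.mulVec_add, Matrix.mulVec_single_one, add_dotProduct, dotProduct_add,
      single_dotProduct, one_mul, Matrix.col_apply, hdiag, zero_add, add_zero] at h1
    rw [Matrix.transpose_apply, Matrix.neg_apply, ← add_eq_zero_iff_eq_neg]
    exact h1
  · obtain ⟨x, hx, hAx⟩ := Matrix.exists_mulVec_eq_zero_iff.2 hdet
    obtain ⟨k, hk⟩ := hns.exists_eval_pderiv_ne_zero hx (h0 x)
    apply hk
    refine Eq.trans ?_ (congrFun hAx k)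
    rw [hFA, show spaceFilling (Fintype.card K) A = sesqForm (Fintype.card K) A from rfl,
      eval_pderiv_sesqForm (FiniteField.cast_card_eq_zero K)]
    simp only [FiniteField.pow_card]
    rfl

lemma eval_spaceFilling_eq_zero {A : Matrix (Fin (n + 2)) (Fin (n + 2)) K} (hA : A.transpose = -A)
    (hA0 : ∀ i, A i i = 0) (x : Fin (n + 2) → K) :
    eval x (spaceFilling (Fintype.card K) A) = 0 := by
  classical
  rw [eval_spaceFilling, ← Finset.sum_product']
  refine Finset.sum_involution (fun p _ => p.swap) ?_ ?_ ?_ ?_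
  · rintro ⟨i, j⟩ -
    have : A j i = - A i j := congrFun (congrFun hA i) j
    simp only [Prod.swap, this]
    ring
  · rintro ⟨i, j⟩ - h h'
    simp only [Prod.swap, Prod.mk.injEq] at h'
    obtain rfl := h'.1
    simp [hA0] at h
  · simp
  · simp

end SpaceFilling

/-! ### The case `e = 1`: hyperbolic quadrics -/

section Hyperbolic

variable {K : Type*} [Field K]

/-- The split quadratic form `∑ x_j y_j`. -/
def splitQuadric (K : Type*) [Field K] (m : ℕ) : MvPolynomial (Fin m ⊕ Fin m) K :=
  ∑ j, X (Sum.inl j) * X (Sum.inr j)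

lemma eval_splitQuadric {m : ℕ} (x y : Fin m → K) :
    eval (Sum.elim x y) (splitQuadric K m) = x ⬝ᵥ y := by
  simp [splitQuadric, dotProduct]

lemma isHomogeneous_splitQuadric (m : ℕ) : (splitQuadric K m).IsHomogeneous 2 :=
  IsHomogeneous.sum _ _ _ fun _ _ => (isHomogeneous_X _ _).mul (isHomogeneous_X _ _)

/-- For `e = 1` the normal form reads `G(x, w) = x·w + Aw·w`, and the substitution `x ↦ x - Aw`
removes the second term. -/
theorem IsExtremalNormal.linEquivalent_splitQuadric [Fintype K] {m : ℕ}
    {G : MvPolynomial (Fin m ⊕ Fin m) K} (hG : IsExtremalNormal 1 G) :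
    LinEquivalent G (splitQuadric K m) := by
  have hD : (xcoeff 0 G).IsHomogeneous 2 := by
    have := isHomogeneous_xcoeff hG.homogeneous 0
    rwa [map_zero] at this
  obtain ⟨A, hA⟩ := exists_eq_sum_of_isHomogeneous_two hD
  have hval : ∀ x w, eval (Sum.elim x w) G = x ⬝ᵥ w + A.mulVec w ⬝ᵥ w := by
    intro x w
    have h1 : A.mulVec w ⬝ᵥ w = eval w (xcoeff 0 G) := by
      rw [hA]
      simp only [map_sum, map_mul, eval_X, eval_linForm, dotProduct, Matrix.mulVec]
      exact Finset.sum_congr rfl fun i _ => mul_comm _ _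
    rw [h1, ← coeff_spec, ← constantCoeff_eq, ← eval_spec]
    rcases eq_or_ne w 0 with rfl | hw
    · rw [hG.spec_zero]
      simp
    obtain ⟨S, hS, h⟩ := hG.spec_pow w hw
    obtain ⟨a, rfl⟩ := Finset.card_eq_one.1 hS
    simp only [pow_one, Finset.prod_singleton] at h
    have hl : constantCoeff (linForm w) = 0 := by
      simp [linForm]
    rw [h, map_sub, map_sub, eval_linForm, eval_C, constantCoeff_C, hl, dotProduct_comm]
    ring
  have hM : lsub (Matrix.fromBlocks 1 (-A) 0 1) G = splitQuadric K m := by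
    refine eq_of_eval_eq (isHomogeneous_lsub hG.homogeneous _) (isHomogeneous_splitQuadric m)
      Fintype.one_lt_card fun z => ?_
    obtain ⟨x, y, rfl⟩ : ∃ x y, z = Sum.elim x y := ⟨z ∘ Sum.inl, z ∘ Sum.inr, by simp⟩
    rw [eval_lsub, Matrix.fromBlocks_mulVec, Sum.elim_comp_inl, Sum.elim_comp_inr, hval,
      eval_splitQuadric, Matrix.one_mulVec, Matrix.neg_mulVec, Matrix.zero_mulVec,
      Matrix.one_mulVec, zero_add, add_dotProduct, neg_dotProduct, neg_add_cancel_right]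
  rw [← hM]
  refine LinEquivalent.of_lsub (N := Matrix.fromBlocks 1 A 0 1) ?_ ?_ G <;>
    simp [Matrix.fromBlocks_multiply, Matrix.fromBlocks_one]

lemma linEquivalent_hyperbolicQuadric {n k : ℕ} (hn : n = 2 * k) :
    LinEquivalent (splitQuadric K (k + 1)) (hyperbolicQuadric K n) := by
  subst hn
  let f : Fin (k + 1) ⊕ Fin (k + 1) → Fin (2 * k + 2) :=
    Sum.elim (fun i => Fin.ofNat _ (2 * i)) fun i => Fin.ofNat _ (2 * i + 1)
  have hf : Function.Bijective f := by
    rw [Fintype.bijective_iff_injective_and_card]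
    constructor
    · rintro (i | i) (j | j) h
      all_goals
        have hi := i.2
        have hj := j.2
        have h1 := congrArg Fin.val h
        simp only [f, Sum.elim_inl, Sum.elim_inr, Fin.ofNat] at h1
        rw [Nat.mod_eq_of_lt (by omega), Nat.mod_eq_of_lt (by omega)] at h1
      · congr 1
        ext
        omega
      · omega
      · omega
      · congr 1
        ext
        omega
    · simp only [Fintype.card_sum, Fintype.card_fin]
      ring
  have h := LinEquivalent.rename (Equiv.ofBijective f hf) (splitQuadric K (k + 1))
  have h2 : MvPolynomial.rename (Equiv.ofBijective f hf) (splitQuadric K (k + 1))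
      = hyperbolicQuadric K (2 * k) := by
    rw [splitQuadric, hyperbolicQuadric, map_sum, Nat.mul_div_cancel_left _ two_pos,
      Finset.sum_range]
    simp [f]
  rwa [h2] at h

lemma zeroCount_splitQuadric [Fintype K] (m : ℕ) :
    zeroCount (splitQuadric K (m + 1)) = Fintype.card K ^ (m + 1)
      + (Fintype.card K ^ (m + 1) - 1) * Fintype.card K ^ m := by
  classical
  have h0 : spec 0 (splitQuadric K (m + 1)) = 0 := by
    simp [spec, splitQuadric]
  rw [zeroCount_eq_add_sum h0, Finset.sum_congr rfl fun v hv => ?_, Finset.sum_const,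
    Finset.card_erase_of_mem (Finset.mem_univ _), Finset.card_univ, Fintype.card_fun,
    Fintype.card_fin, smul_eq_mul]
  rw [← card_filter_dotProduct_eq_zero (Finset.ne_of_mem_erase hv), zeroCount]
  simp only [eval_spec, eval_splitQuadric, dotProduct_comm v]
  rw [Nat.card_eq_fintype_card, Fintype.card_subtype]

end Hyperbolic

/-! ### The case `1 < e < q`: derivatives along `x`, and `q = e²` -/

section Divisibility

variable {K : Type*} [Field K] {σ : Type*}

/-- Distinct variables are coprime, so one cross relation already gives divisibility by the power;
at least two variables are needed for this. -/
lemma exists_eq_X_pow_mul {m k : ℕ} (hm : 2 ≤ m) {κ : Fin m → σ} (hκ : Function.Injective κ)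
    {A : Fin m → MvPolynomial σ K} (h : ∀ i j, X (κ i) ^ k * A j = X (κ j) ^ k * A i) :
    ∃ B, ∀ i, A i = X (κ i) ^ k * B := by
  let i₀ : Fin m := ⟨0, by omega⟩
  let i₁ : Fin m := ⟨1, by omega⟩
  have hne : κ i₀ ≠ κ i₁ := fun h => by simpa [i₀, i₁] using hκ h
  have hprime : Prime (X (κ i₀) : MvPolynomial σ K) := X_prime
  have hnd : ¬ (X (κ i₀) : MvPolynomial σ K) ∣ X (κ i₁) ^ k := by
    intro hd
    exact hne (X_dvd_X.1 (hprime.dvd_of_dvd_pow hd))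
  obtain ⟨B, hB⟩ := hprime.pow_dvd_of_dvd_mul_left k hnd ⟨_, (h i₀ i₁).symm⟩
  refine ⟨B, fun i => mul_left_cancel₀ (pow_ne_zero k hprime.ne_zero) (b := A i) ?_⟩
  rw [h i₀ i, hB]
  ring

lemma pderiv_aeval (i : σ) (ℓ : MvPolynomial σ K) (P : Polynomial K) :
    pderiv i (Polynomial.aeval ℓ P) = Polynomial.aeval ℓ (Polynomial.derivative P) * pderiv i ℓ := by
  have := Derivation.map_aeval (pderiv i) P ℓ
  rw [this, smul_eq_mul]

lemma pderiv_linForm [Fintype σ] (i : σ) (L : σ → K) :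
    pderiv i (linForm L) = C (L i) := by
  classical
  rw [linForm, map_sum, Finset.sum_eq_single i]
  · rw [pderiv_C_mul, pderiv_X_self, mul_one]
  · intro j _ hj
    rw [pderiv_C_mul, pderiv_X_of_ne hj, mul_zero]
  · simp

end Divisibility

section Derivative

variable {K : Type*} [Field K] [Fintype K] {m e f : ℕ} {G : MvPolynomial (Fin m ⊕ Fin m) K}

/-- Every `v` is an `e`-th power coordinatewise: `(v^f)^e = v^q = v`. -/
lemma IsExtremalNormal.exists_spec_eq (hG : IsExtremalNormal e G) (hef : f * e = Fintype.card K)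
    {v : Fin m → K} (hv : v ≠ 0) :
    ∃ S : Finset K, S.card = e ∧
      spec v G = ∏ a ∈ S, (linForm (fun j => v j ^ f) - C a) := by
  have hw : (fun j => v j ^ f) ≠ 0 := by
    intro h
    refine hv (funext fun j => ?_)
    have : v j ^ f = 0 := congrFun h j
    rw [← FiniteField.pow_card (v j), ← hef, pow_mul, this, zero_pow, Pi.zero_apply]
    rintro rfl
    exact Fintype.card_ne_zero (hef.symm.trans (mul_zero f))
  obtain ⟨S, hS, h⟩ := hG.spec_pow _ hw
  refine ⟨S, hS, ?_⟩
  rw [← h]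
  congr 2
  funext j
  rw [← pow_mul, hef, FiniteField.pow_card]

lemma add_le_mul_of_two_le {a b : ℕ} (ha : 2 ≤ a) (hb : 2 ≤ b) : a + b ≤ a * b := by
  nlinarith [Nat.mul_le_mul ha hb]

/-- The gradient of `G` along the `x`-coordinates is proportional to `(y_1^f, …, y_m^f)`. -/
lemma IsExtremalNormal.exists_pderiv_inl_eq (hG : IsExtremalNormal e G) (hm : 2 ≤ m) (he : 2 ≤ e)
    (hf : 2 ≤ f) (hef : f * e = Fintype.card K) :
    ∃ E, ∀ i, pderiv (Sum.inl i) G = X (Sum.inr i) ^ f * E := by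
  refine exists_eq_X_pow_mul hm Sum.inr_injective fun i j => ext_xcoeff fun s => ?_
  rw [xcoeff_X_inr_pow_mul, xcoeff_X_inr_pow_mul]
  have hhom : ∀ i j, (X i ^ f * xcoeff s (pderiv (Sum.inl j) G)).IsHomogeneous
      (1 * f + (e - s.degree)) := fun i j =>
    ((isHomogeneous_X _ i).pow f).mul (isHomogeneous_xcoeff hG.homogeneous.pderiv s)
  refine eq_of_eval_eq (hhom i j) (hhom j i) ?_ fun v => ?_
  -- The cross relation has degree at most `f + e ≤ f e = q`, low enough for its values at rational
  -- `v` to decide it. There `G(x, v) = P(v^f·x)`, and the `i`-th derivative is `v_i^f` times an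
  -- expression independent of `i`.
  · have := add_le_mul_of_two_le hf he
    omega
  rw [map_mul, map_mul, map_pow, map_pow, eval_X, eval_X, ← coeff_spec, ← coeff_spec,
    spec_pderiv_inl, spec_pderiv_inl]
  rcases eq_or_ne v 0 with rfl | hv
  · rw [hG.spec_zero]
    simp
  obtain ⟨S, hS, h⟩ := hG.exists_spec_eq hef hv
  rw [h, prod_linForm_sub_C, pderiv_aeval, pderiv_aeval, pderiv_linForm, pderiv_linForm,
    mul_comm _ (C _), mul_comm _ (C _), coeff_C_mul, coeff_C_mul]
  ring

/-- Otherwise `E` and the `m` derivatives along `y` are `m + 1 < 2m` polynomials vanishing at the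
origin. They have a common zero elsewhere, at which all derivatives of `G` vanish. The degree `e +
1` is `1` in `K`, so Euler's identity puts this point on `G = 0`, and it is singular. -/
lemma IsExtremalNormal.coeff_zero_ne_zero {K : Type*} [Field K] {m e f : ℕ}
    {G : MvPolynomial (Fin m ⊕ Fin m) K} (hG : IsExtremalNormal e G) (hm : 2 ≤ m) (he : 2 ≤ e)
    (he0 : (e : K) = 0) {E : MvPolynomial (Fin m ⊕ Fin m) K}
    (hE : ∀ i, pderiv (Sum.inl i) G = X (Sum.inr i) ^ f * E) : coeff 0 E ≠ 0 := by
  intro h0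
  let φ := map (σ := Fin m ⊕ Fin m) (algebraMap K (AlgebraicClosure K))
  have hφ : ∀ P, eval 0 (φ P) = algebraMap K (AlgebraicClosure K) (coeff 0 P) := fun P => by
    simp [φ, constantCoeff_eq]
  obtain ⟨x, hx, hzero⟩ := exists_ne_zero_common_zero (k := AlgebraicClosure K)
    (ι := Option (Fin m)) (σ := Fin m ⊕ Fin m) (by simp; omega)
    (fun o => o.elim (φ E) fun j => φ (pderiv (Sum.inr j) G)) (by
      rintro (_ | j)
      · exact (hφ E).trans (by rw [h0, map_zero])
      · refine (hφ _).trans ?_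
        rw [(hG.homogeneous.pderiv (i := Sum.inr j)).coeff_eq_zero (by rw [map_zero]; omega),
          map_zero])
  have hx1 : aeval x E = 0 := by
    have := hzero none
    simpa [φ, eval_map, aeval_def] using this
  have hx2 : ∀ j, aeval x (pderiv (Sum.inr j) G) = 0 := by
    intro j
    have := hzero (some j)
    simpa [φ, eval_map, aeval_def] using this
  have hx3 : ∀ i, aeval x (pderiv i G) = 0 := by
    rintro (i | j)
    · rw [hE, map_mul, hx1, mul_zero]
    · exact hx2 j
  have hG0 : aeval x G = 0 := by
    have h1 := congrArg (aeval x) hG.homogeneous.sum_X_mul_pderiv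
    simp only [map_sum, map_mul, hx3, mul_zero, Finset.sum_const_zero, nsmul_eq_mul,
      map_natCast] at h1
    have h2 : ((e + 1 : ℕ) : AlgebraicClosure K) = 1 := by
      have := congrArg (algebraMap K (AlgebraicClosure K)) he0
      rw [map_natCast, map_zero] at this
      rw [Nat.cast_add, this, Nat.cast_one, zero_add]
    rw [h2, one_mul] at h1
    exact h1.symm
  obtain ⟨i, hi⟩ := hG.nonsing x hx hG0
  exact hi (hx3 i)

/-- The derivative is homogeneous of degree `e` and equals `y_i^f E`, where `E` has a constant term.
Comparing degrees gives `e = f`, and then `E` is constant. -/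
lemma IsExtremalNormal.pderiv_inl_eq_C_mul (hG : IsExtremalNormal e G) (hm : 2 ≤ m) (he : 2 ≤ e)
    (hf : 2 ≤ f) (he0 : (e : K) = 0) (hef : f * e = Fintype.card K) :
    e = f ∧ ∃ c : K, c ≠ 0 ∧ ∀ i, pderiv (Sum.inl i) G = C c * X (Sum.inr i) ^ e := by
  obtain ⟨E, hE⟩ := hG.exists_pderiv_inl_eq hm he hf hef
  have h0 := hG.coeff_zero_ne_zero hm he he0 hE
  let i : Fin m := ⟨0, by omega⟩
  have hc : ∀ s, coeff s E ≠ 0 → f + s.degree = e := by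
    intro s hs
    by_contra hne
    have h1 : coeff (Finsupp.single (Sum.inr i) f + s) (pderiv (Sum.inl i) G) = 0 :=
      (hG.homogeneous.pderiv (i := Sum.inl i)).coeff_eq_zero (by
        rw [map_add, Finsupp.degree_single]
        exact hne)
    rw [hE, X_pow_eq_monomial, coeff_monomial_mul, one_mul] at h1
    exact hs h1
  have hfe : e = f := by
    have := hc 0 h0
    rw [map_zero] at this
    omega
  subst hfe
  refine ⟨rfl, coeff 0 E, h0, fun i => ?_⟩
  have : E = C (coeff 0 E) := by
    ext s
    rw [coeff_C]
    split_ifs with hs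
    · rw [hs]
    · by_contra h
      have := hc s h
      have h2 : s.degree = 0 := by omega
      exact hs ((Finsupp.degree_eq_zero_iff s).1 h2).symm
  rw [hE, mul_comm, ← this]

end Derivative

/-! ### The case `q = e²`: values of the form -/

section Coefficients

variable {K : Type*} [Field K] {σ : Type*} [DecidableEq σ]

lemma coeff_aeval_single (i : σ) (b : ℕ) (f : MvPolynomial σ K) :
    (aeval (Pi.single i Polynomial.X : σ → Polynomial K) f).coeff b
      = coeff (Finsupp.single i b) f := by
  induction f using MvPolynomial.induction_on' with
  | add p q hp hq => rw [map_add, Polynomial.coeff_add, hp, hq, coeff_add]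
  | monomial u a =>
    rw [aeval_monomial, coeff_monomial, Polynomial.algebraMap_eq, Polynomial.coeff_C_mul]
    by_cases hu : ∀ j, j ≠ i → u j = 0
    · have hu' : u = Finsupp.single i (u i) := by
        ext j
        rcases eq_or_ne j i with rfl | hj
        · simp
        · rw [hu j hj, Finsupp.single_eq_of_ne hj]
      rw [hu', Finsupp.prod_single_index (by exact pow_zero _), Pi.single_eq_same, Polynomial.coeff_X_pow]
      by_cases hb : b = u i
      · simp [hb]
      · rw [if_neg hb, if_neg, mul_zero]
        intro h
        exact hb (Finsupp.single_injective i h).symm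
    · push Not at hu
      obtain ⟨j, hj, huj⟩ := hu
      rw [if_neg, Finsupp.prod, Finset.prod_eq_zero (Finsupp.mem_support_iff.2 huj),
        Polynomial.coeff_zero, mul_zero]
      · rw [Pi.single_eq_of_ne hj, zero_pow huj]
      · rintro rfl
        rw [Finsupp.single_eq_of_ne hj] at huj
        exact huj rfl

lemma coeff_single_aeval_linForm [Fintype σ] (L : σ → K) (P : Polynomial K) (i : σ) (b : ℕ) :
    coeff (Finsupp.single i b) (Polynomial.aeval (linForm L) P) = P.coeff b * L i ^ b := by
  rw [← coeff_aeval_single, ← Polynomial.aeval_algHom_apply, aeval_linForm,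
    Finset.sum_eq_single i]
  · rw [Pi.single_eq_same, Polynomial.algebraMap_eq, ← Polynomial.comp_eq_aeval,
      Polynomial.comp_C_mul_X_coeff]
  · intro j _ hj
    rw [Pi.single_eq_of_ne hj, mul_zero]
  · simp

end Coefficients

section Values

variable {K : Type*} [Field K] [Fintype K] {m e : ℕ} {G : MvPolynomial (Fin m ⊕ Fin m) K}

/-- At `y = v` this coefficient is `v_i^(e b)` times a number independent of `i`. The cross
relations make it divisible by `y_i^(e b)`, while its degree is only `e + 1 - b < e b`. -/
lemma IsExtremalNormal.xcoeff_single_eq_zero (hG : IsExtremalNormal e G) (hm : 2 ≤ m)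
    (hee : e * e = Fintype.card K) {b : ℕ} (hb : 2 ≤ b) (hbe : b < e) (i : Fin m) :
    xcoeff (Finsupp.single i b) G = 0 := by
  have hhom : ∀ i, (xcoeff (Finsupp.single i b) G).IsHomogeneous (e + 1 - b) := by
    intro i
    have := isHomogeneous_xcoeff hG.homogeneous (Finsupp.single i b)
    rwa [Finsupp.degree_single] at this
  have hcross : ∀ i j : Fin m, X i ^ (e * b) * xcoeff (Finsupp.single j b) G
      = X j ^ (e * b) * xcoeff (Finsupp.single i b) G := by
    intro i j
    have h1 : ∀ i j : Fin m, (X i ^ (e * b) * xcoeff (Finsupp.single j b) G).IsHomogeneous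
        (1 * (e * b) + (e + 1 - b)) := fun i j => ((isHomogeneous_X _ i).pow _).mul (hhom j)
    refine eq_of_eval_eq (h1 i j) (h1 j i) ?_ fun v => ?_
    · rw [← hee]
      obtain ⟨k, rfl⟩ := Nat.exists_eq_add_of_lt hbe
      have : b + k + 1 + 1 - b = k + 2 := by omega
      rw [this]
      nlinarith
    rw [map_mul, map_mul, map_pow, map_pow, eval_X, eval_X, ← coeff_spec, ← coeff_spec]
    rcases eq_or_ne v 0 with rfl | hv
    · rw [hG.spec_zero]
      simp
    obtain ⟨S, hS, h⟩ := hG.exists_spec_eq hee hv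
    rw [h, prod_linForm_sub_C, coeff_single_aeval_linForm, coeff_single_aeval_linForm]
    ring
  obtain ⟨B, hB⟩ := exists_eq_X_pow_mul hm Function.injective_id hcross
  have hB0 : B = 0 := by
    ext s
    by_contra hs
    rw [coeff_zero] at hs
    have h1 : coeff (Finsupp.single i (e * b) + s) (xcoeff (Finsupp.single i b) G) = 0 := by
      refine (hhom i).coeff_eq_zero ?_
      rw [map_add, Finsupp.degree_single]
      have : e * 2 ≤ e * b := Nat.mul_le_mul_left e hb
      omega
    rw [hB, id, X_pow_eq_monomial, coeff_monomial_mul, one_mul] at h1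
    exact hs h1
  rw [hB, hB0, mul_zero]

/-- `G(x, v)` is a monic polynomial of degree `e` in the linear form `t = v^e·x`. Its linear
coefficient is read from the derivative, and those in degrees `2, …, e - 1` vanish by the preceding
lemma. The set `S` consists of its roots. -/
lemma IsExtremalNormal.exists_eval_eq (hG : IsExtremalNormal e G) (hm : 2 ≤ m) (he : 2 ≤ e)
    (hee : e * e = Fintype.card K) {c : K}
    (hder : ∀ i, pderiv (Sum.inl i) G = C c * X (Sum.inr i) ^ e) {v : Fin m → K} (hv : v ≠ 0) :
    ∃ (D : K) (S : Finset K), S.card = e ∧ (∀ a ∈ S, a ^ e + c * a + D = 0) ∧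
      ∀ x, ∃ t, eval (Sum.elim x v) G = t ^ e + c * t + D := by
  obtain ⟨S, hS, h⟩ := hG.exists_spec_eq hee hv
  set P := ∏ a ∈ S, (Polynomial.X - Polynomial.C a) with hP
  have hmonic : P.Monic :=
    Polynomial.monic_prod_of_monic _ _ fun a _ => Polynomial.monic_X_sub_C a
  have hdeg : P.natDegree = e := by
    rw [hP, Polynomial.natDegree_prod_of_monic _ _ fun a _ => Polynomial.monic_X_sub_C a]
    simpa using hS
  rw [prod_linForm_sub_C, ← hP] at h
  have hcoeff : ∀ i b, coeff (Finsupp.single i b) (spec v G) = P.coeff b * (v i ^ e) ^ b := by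
    intro i b
    rw [h, coeff_single_aeval_linForm]
  obtain ⟨i, hi⟩ := Function.ne_iff.1 hv
  have hie : v i ^ e ≠ 0 := pow_ne_zero e hi
  have h1 : P.coeff 1 = c := by
    have h2 := hcoeff i 1
    rw [pow_one] at h2
    have h3 := coeff_pderiv (i := i) (spec v G) 0
    rw [← spec_pderiv_inl, hder, zero_add, h2] at h3
    have h4 : spec v (C c * X (Sum.inr i) ^ e : MvPolynomial (Fin m ⊕ Fin m) K)
        = C (c * v i ^ e) := by
      simp [spec]
    rw [h4, coeff_C, if_pos rfl] at h3
    simp only [Finsupp.coe_zero, Pi.zero_apply, Nat.cast_zero, zero_add, mul_one] at h3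
    exact (mul_right_cancel₀ hie h3).symm
  have hb : ∀ b, 2 ≤ b → b < e → P.coeff b = 0 := by
    intro b hb hbe
    have h2 := hcoeff i b
    rw [coeff_spec, hG.xcoeff_single_eq_zero hm hee hb hbe, map_zero] at h2
    exact (mul_eq_zero.1 h2.symm).resolve_right (pow_ne_zero _ hie)
  have hPeq : P = Polynomial.X ^ e + Polynomial.C c * Polynomial.X + Polynomial.C (P.coeff 0) := by
    ext b
    simp only [Polynomial.coeff_add, Polynomial.coeff_X_pow, Polynomial.coeff_C_mul,
      Polynomial.coeff_X, Polynomial.coeff_C]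
    rcases Nat.lt_trichotomy b e with hbe | rfl | hbe
    · rcases Nat.lt_or_ge b 2 with hb2 | hb2
      · interval_cases b
        · simp [show e ≠ 0 by omega, eq_comm]
        · simp [show (1 : ℕ) ≠ e by omega, h1]
      · rw [hb b hb2 hbe, if_neg hbe.ne, if_neg (by omega), if_neg (by omega)]
        simp
    · have : P.coeff b = 1 := by rw [← hdeg]; exact hmonic
      rw [this, if_pos rfl, if_neg (by omega), if_neg (by omega)]
      simp
    · rw [Polynomial.coeff_eq_zero_of_natDegree_lt (by omega), if_neg hbe.ne', if_neg (by omega),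
        if_neg (by omega)]
      simp
  have heval : ∀ t, P.eval t = t ^ e + c * t + P.coeff 0 := by
    intro t
    conv_lhs => rw [hPeq]
    simp
  refine ⟨P.coeff 0, S, hS, fun a ha => ?_, fun x => ⟨eval x (linForm fun j => v j ^ e), ?_⟩⟩
  · rw [← heval, hP, Polynomial.eval_prod]
    exact Finset.prod_eq_zero ha (by simp)
  · rw [← heval, ← eval_spec, h, ← Polynomial.coe_aeval_eq_eval]
    exact (Polynomial.aeval_algHom_apply (aeval x : MvPolynomial (Fin m) K →ₐ[K] K) _ P).symm

lemma exists_pow_sub_ne_zero {K : Type*} [Field K] [Fintype K] {e : ℕ} (he : 2 ≤ e) (hee : e * e = Fintype.card K) :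
    ∃ ρ : K, ρ ^ e - ρ ≠ 0 := by
  by_contra! h
  have h1 : (Polynomial.X ^ e - Polynomial.X : Polynomial K) ≠ 0 :=
    FiniteField.X_pow_card_sub_X_ne_zero K (by omega)
  have h2 := Polynomial.card_le_degree_of_subset_roots (Z := (Finset.univ : Finset K))
    (p := Polynomial.X ^ e - Polynomial.X) (by
      intro a _
      rw [Polynomial.mem_roots h1]
      simp [h a])
  rw [FiniteField.X_pow_card_sub_X_natDegree_eq K (by omega), Finset.card_univ, ← hee] at h2
  nlinarith

/-- After rescaling, an extremal form of degree `e + 1` with `e² = q` takes values in the subfield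
with `e` elements. -/
theorem IsExtremalNormal.exists_pow_eq_self (hG : IsExtremalNormal e G) {p r : ℕ} [Fact p.Prime]
    [CharP K p] (her : e = p ^ r) (hm : 2 ≤ m) (he : 2 ≤ e) (hee : e * e = Fintype.card K) {c : K}
    (hder : ∀ i, pderiv (Sum.inl i) G = C c * X (Sum.inr i) ^ e) :
    ∃ l : K, l ≠ 0 ∧ ∀ z, (l * eval z G) ^ e = l * eval z G := by
  have hsub : ∀ a b : K, (a - b) ^ e = a ^ e - b ^ e := by
    intro a b
    rw [her, sub_pow_char_pow]
  have hqe : ∀ a : K, (a ^ e) ^ e = a := fun a => by rw [← pow_mul, hee, FiniteField.pow_card]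
  -- `b` is the difference of two roots of one polynomial `t^e + c t + D`; this makes `b^e + c b =
  -- 0`, a relation independent of `D`. Subtracting a root from `t` then removes `D` from every
  -- value of `G`.
  obtain ⟨b, hb, hbc⟩ : ∃ b : K, b ≠ 0 ∧ c * b = - b ^ e := by
    have hv : (Pi.single ⟨0, by omega⟩ 1 : Fin m → K) ≠ 0 := by simp
    obtain ⟨D, S, hS, hroot, -⟩ := hG.exists_eval_eq hm he hee hder hv
    obtain ⟨a, ha, a', ha', hne⟩ := Finset.one_lt_card.1 (hS.symm ▸ he : 1 < S.card)
    refine ⟨a - a', sub_ne_zero.2 hne, ?_⟩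
    have h1 := hroot a ha
    have h2 := hroot a' ha'
    rw [hsub]
    linear_combination h1 - h2
  have hval : ∀ z, ∃ s : K, eval z G = b ^ e * (s ^ e - s) := by
    intro z
    obtain ⟨x, v, rfl⟩ : ∃ x y, z = Sum.elim x y := ⟨z ∘ Sum.inl, z ∘ Sum.inr, by simp⟩
    rcases eq_or_ne v 0 with rfl | hv
    · refine ⟨0, ?_⟩
      rw [← eval_spec, hG.spec_zero, zero_pow (by omega)]
      simp
    obtain ⟨D, S, hS, hroot, hex⟩ := hG.exists_eval_eq hm he hee hder hv
    obtain ⟨a, ha⟩ : S.Nonempty := Finset.card_pos.1 (by omega)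
    obtain ⟨t, ht⟩ := hex x
    refine ⟨(t - a) / b, ?_⟩
    rw [ht, div_pow, hsub, mul_sub, mul_div_cancel₀ _ (pow_ne_zero e hb)]
    have h1 := hroot a ha
    have h2 : b ^ e * ((t - a) / b) = - (c * (t - a)) := by
      rw [show b ^ e = - (c * b) by rw [hbc, neg_neg]]
      field_simp
    rw [h2]
    linear_combination h1
  -- Since `q = e²`, the `e`-th power map changes the sign of each `u^e - u`, so a product of two
  -- such elements is fixed by it.
  obtain ⟨ρ, hρ⟩ : ∃ ρ : K, ρ ^ e - ρ ≠ 0 :=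
    exists_pow_sub_ne_zero he hee
  refine ⟨(ρ ^ e - ρ) / b ^ e, div_ne_zero hρ (pow_ne_zero e hb), fun z => ?_⟩
  obtain ⟨s, hs⟩ := hval z
  have h1 : (ρ ^ e - ρ) / b ^ e * eval z G = (ρ ^ e - ρ) * (s ^ e - s) := by
    rw [hs]
    field_simp
  rw [h1, mul_pow, hsub, hsub, hqe, hqe]
  ring

end Values

/-! ### Forms with values in the subfield of `e` elements are Hermitian -/

section Shape

/-- The exponent `< q = e²` with `z ^ twist e a = z ^ (e * a)` for `z ∈ 𝔽_q`, when `a ≤ e + 1`. -/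
def twist (e a : ℕ) : ℕ := if a = e then 1 else if a = e + 1 then e + 1 else e * a

lemma twist_zero {e : ℕ} (he : 2 ≤ e) : twist e 0 = 0 := by
  rw [twist, if_neg (by omega), if_neg (by omega), mul_zero]

lemma twist_injective {e : ℕ} (he : 2 ≤ e) : Function.Injective (twist e) := by
  have h1 : ∀ a, e * a ≠ 1 := fun a h => by
    have := Nat.eq_one_of_mul_eq_one_right h
    omega
  have h2 : ∀ a, e * a ≠ e + 1 := fun a h => by
    have h3 : e ∣ e + 1 := ⟨a, h.symm⟩
    have := (Nat.dvd_add_right (dvd_refl e)).1 h3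
    have := Nat.le_of_dvd one_pos this
    omega
  intro a b hab
  unfold twist at hab
  split_ifs at hab <;> first | omega | skip
  all_goals first
    | exact absurd hab (h1 _)
    | exact absurd hab.symm (h1 _)
    | exact absurd hab (h2 _)
    | exact absurd hab.symm (h2 _)
    | exact Nat.eq_of_mul_eq_mul_left (by omega) hab

lemma twist_lt {e a : ℕ} (he : 2 ≤ e) (ha : a ≤ e + 1) : twist e a < e * e := by
  unfold twist
  split_ifs with h1 h2
  · nlinarith
  · nlinarith
  · exact Nat.mul_lt_mul_of_pos_left (by omega) (by omega)

variable {K : Type*} [Field K] [Fintype K] {σ : Type*} [Fintype σ] {e : ℕ}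

lemma pow_twist (hee : e * e = Fintype.card K) (z : K) (a : ℕ) :
    z ^ twist e a = (z ^ a) ^ e := by
  unfold twist
  split_ifs with h1 h2
  · rw [h1, ← pow_mul, hee, FiniteField.pow_card, pow_one]
  · rw [h2, ← pow_mul, add_mul, hee, one_mul, pow_add z (Fintype.card K), FiniteField.pow_card,
      pow_succ, mul_comm]
  · rw [← pow_mul, mul_comm]

variable {p r : ℕ} [Fact p.Prime] [CharP K p] {H : MvPolynomial σ K}

/-- `H` and `H^e` agree as functions. Taking `e`-th powers of the terms of `H` and reducing the
exponents below `q` gives a second reduced polynomial with the same values, hence the same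
polynomial. -/
lemma coeff_mapRange_twist (her : e = p ^ r) (he : 2 ≤ e) (hee : e * e = Fintype.card K)
    (hH : H.IsHomogeneous (e + 1)) (hval : ∀ z, eval z H ^ e = eval z H) (s : σ →₀ ℕ) :
    coeff (s.mapRange (twist e) (twist_zero he)) H = coeff s H ^ e := by
  classical
  set φ : (σ →₀ ℕ) → σ →₀ ℕ := fun s => s.mapRange (twist e) (twist_zero he) with hφ
  have hφinj : Function.Injective φ := Finsupp.mapRange_injective _ _ (twist_injective he)
  let H' : MvPolynomial σ K := ∑ s ∈ H.support, monomial (φ s) (coeff s H ^ e)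
  have hle : ∀ s ∈ H.support, ∀ i, s i ≤ e + 1 := by
    intro s hs i
    have h1 : s.degree = e + 1 := by
      by_contra h
      exact mem_support_iff.1 hs (hH.coeff_eq_zero h)
    rw [← h1]
    exact Finsupp.le_degree i s
  have hq : e + 1 < Fintype.card K := by rw [← hee]; nlinarith
  have heq : H' = H := by
    refine sub_eq_zero.1 (eq_zero_of_degreeOf_lt (fun i => ?_) fun z => ?_)
    · refine (degreeOf_sub_le i H' H).trans_lt (max_lt ?_ ?_)
      · refine (degreeOf_sum_le i _ _).trans_lt ((Finset.sup_lt_iff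
          (by simp [Fintype.card_pos])).2 fun s hs => ?_)
        rw [degreeOf_monomial_eq _ _ (pow_ne_zero e (mem_support_iff.1 hs))]
        rw [← hee]
        exact twist_lt he (hle s hs i)
      · rw [degreeOf_lt_iff (by omega)]
        exact fun s hs => (hle s hs i).trans_lt hq
    · rw [map_sub, sub_eq_zero]
      refine Eq.trans ?_ (hval z)
      rw [eval_eq' z H, her, sum_pow_char_pow, ← her, map_sum]
      refine Finset.sum_congr rfl fun s _ => ?_
      rw [eval_monomial, Finsupp.prod_fintype _ _ fun i => pow_zero _, mul_pow, ← Finset.prod_pow]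
      congr 1
      exact Finset.prod_congr rfl fun i _ => pow_twist hee _ _
  have h1 : coeff (φ s) H' = coeff s H ^ e := by
    simp only [H', coeff_sum, coeff_monomial, hφinj.eq_iff, Finset.sum_ite_eq', mem_support_iff]
    split_ifs with h
    · rfl
    · rw [not_not.1 h, zero_pow (by omega)]
  rw [← h1, heq]

/-- A monomial of `H` with all exponents below `e` would be twisted to its `e`-th power, of degree
`e (e + 1)`, which is too large. So some exponent is at least `e`, and the monomial is `X_i X_j^e`.
The twist exchanges `i` and `j`, whence the Hermitian symmetry of the coefficients. -/
theorem exists_eq_sesqForm (her : e = p ^ r) (he : 2 ≤ e) (hee : e * e = Fintype.card K)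
    (hH : H.IsHomogeneous (e + 1)) (hval : ∀ z, eval z H ^ e = eval z H) :
    ∃ A : Matrix σ σ K, (∀ i j, A j i = A i j ^ e) ∧ H = sesqForm e A := by
  classical
  have hdeg : ∀ s, coeff s H ≠ 0 → s.degree = e + 1 := by
    intro s hs
    by_contra h
    exact hs (hH.coeff_eq_zero h)
  let ε : σ × σ → σ →₀ ℕ := fun ij => Finsupp.single ij.1 1 + Finsupp.single ij.2 e
  have hε : Function.Injective ε := by
    rintro ⟨i, j⟩ ⟨i', j'⟩ h
    have hj : j = j' := by
      by_contra hj
      have h1 := DFunLike.congr_fun h j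
      simp only [ε, Finsupp.coe_add, Pi.add_apply, Finsupp.single_eq_same,
        Finsupp.single_eq_of_ne hj, add_zero, Finsupp.single_apply] at h1
      split_ifs at h1 <;> omega
    subst hj
    have h1 : Finsupp.single i 1 = Finsupp.single i' 1 := add_right_cancel h
    rw [(Finsupp.single_left_inj one_ne_zero).1 h1]
  have hsupp : ∀ s, coeff s H ≠ 0 → ∃ ij, ε ij = s := by
    intro s hs
    have h1 := coeff_mapRange_twist her he hee hH hval s
    have h2 := hdeg _ (h1 ▸ pow_ne_zero e hs)
    obtain ⟨j, hj⟩ : ∃ j, e ≤ s j := by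
      by_contra! hlt
      have h3 : s.mapRange (twist e) (twist_zero he) = e • s := by
        ext i
        have := hlt i
        rw [Finsupp.mapRange_apply, twist, if_neg (by omega), if_neg (by omega)]
        rfl
      rw [h3, map_nsmul, hdeg s hs, smul_eq_mul] at h2
      nlinarith
    have h4 : s - Finsupp.single j e + Finsupp.single j e = s :=
      tsub_add_cancel_of_le (Finsupp.single_le_iff.2 hj)
    have h5 : (s - Finsupp.single j e).degree = 1 := by
      have := congrArg Finsupp.degree h4
      rw [map_add, Finsupp.degree_single, hdeg s hs] at this
      omega
    obtain ⟨i, hi⟩ := (Finsupp.sum_eq_one_iff _).1 h5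
    exact ⟨(i, j), by simp only [ε]; rw [← hi, h4]⟩
  refine ⟨Matrix.of fun i j => coeff (ε (i, j)) H, fun i j => ?_, ?_⟩
  · have h1 := coeff_mapRange_twist her he hee hH hval (ε (i, j))
    rw [Matrix.of_apply, Matrix.of_apply, ← h1]
    congr 1
    ext k
    simp only [ε, Finsupp.mapRange_apply, Finsupp.coe_add, Pi.add_apply, Finsupp.single_apply]
    unfold twist
    split_ifs <;> omega
  · have h1 : H = ∑ s ∈ Finset.univ.image ε, monomial s (coeff s H) := by
      conv_lhs => rw [H.as_sum]
      refine Finset.sum_subset (fun s hs => ?_) fun s _ hs => ?_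
      · obtain ⟨ij, h⟩ := hsupp s (mem_support_iff.1 hs)
        exact Finset.mem_image.2 ⟨ij, Finset.mem_univ _, h⟩
      · rw [notMem_support_iff.1 hs, monomial_zero]
    rw [Finset.sum_image fun a _ b _ h => hε h, Fintype.sum_prod_type] at h1
    rw [sesqForm]
    refine h1.trans (Finset.sum_congr rfl fun i _ => Finset.sum_congr rfl fun j _ => ?_)
    simp only [ε, Matrix.of_apply]
    rw [mul_assoc, ← pow_one (X i), X_pow_eq_monomial, X_pow_eq_monomial, monomial_mul, C_mul_monomial, one_mul, mul_one]

end Shape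

/-! ### The norm map and orthonormal bases -/

section Norm

variable {K : Type*} [Field K] [Fintype K] [DecidableEq K] {e : ℕ}

/-- The norm from `𝔽_{e²}` to `𝔽_e` takes each nonzero value `e + 1` times. -/
lemma card_filter_pow_succ_eq (he : 2 ≤ e) (hee : e * e = Fintype.card K) {c : K} (hc : c ≠ 0)
    (hce : c ^ e = c) : (Finset.univ.filter fun x : K => x ^ (e + 1) = c).card = e + 1 := by
  -- At most `e - 1` nonzero values, with at most `e + 1` preimages each, account for all `e * e -
  -- 1` nonzero elements; hence every fibre is full.
  let T : Finset K := Finset.univ.filter fun a => a ≠ 0 ∧ a ^ e = a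
  have hfib : ∀ a ∈ T, (Finset.univ.filter fun x : K => x ^ (e + 1) = a).card ≤ e + 1 := by
    intro a _
    have h1 : (Polynomial.X ^ (e + 1) - Polynomial.C a : Polynomial K) ≠ 0 :=
      Polynomial.X_pow_sub_C_ne_zero (by omega) a
    have h2 := Polynomial.card_le_degree_of_subset_roots
      (Z := Finset.univ.filter fun x : K => x ^ (e + 1) = a)
      (p := Polynomial.X ^ (e + 1) - Polynomial.C a) (by
        intro x hx
        have hx : x ^ (e + 1) = a := by simpa using hx
        rw [Polynomial.mem_roots h1]
        simp [hx])
    rwa [Polynomial.natDegree_X_pow_sub_C] at h2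
  have hT : T.card + 1 ≤ e := by
    have h1 : (Polynomial.X ^ e - Polynomial.X : Polynomial K) ≠ 0 :=
      FiniteField.X_pow_card_sub_X_ne_zero K (by omega)
    have h2 := Polynomial.card_le_degree_of_subset_roots (Z := insert 0 T)
      (p := Polynomial.X ^ e - Polynomial.X) (by
        intro x hx
        rw [Polynomial.mem_roots h1]
        rcases Finset.mem_insert.1 hx with rfl | hx
        · simp [show e ≠ 0 by omega]
        · simp [(Finset.mem_filter.1 hx).2.2])
    rwa [FiniteField.X_pow_card_sub_X_natDegree_eq K (by omega),
      Finset.card_insert_of_notMem (by simp [T])] at h2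
  have hsum : ∑ a ∈ T, (Finset.univ.filter fun x : K => x ^ (e + 1) = a).card + 1
      = Fintype.card K := by
    have h1 : (Finset.univ.erase (0 : K)).card
        = ∑ a ∈ T, ((Finset.univ.erase (0 : K)).filter fun x : K => x ^ (e + 1) = a).card := by
      refine Finset.card_eq_sum_card_fiberwise fun x hx => ?_
      have hx0 : x ≠ 0 := by simpa using hx
      simp only [T, Finset.coe_filter, Finset.mem_univ, true_and, Set.mem_ofPred_eq]
      refine ⟨pow_ne_zero _ hx0, ?_⟩
      rw [← pow_mul, add_mul, one_mul, hee, pow_add, FiniteField.pow_card, pow_succ, mul_comm]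
    have h2 : ∀ a ∈ T, ((Finset.univ.erase (0 : K)).filter fun x : K => x ^ (e + 1) = a)
        = Finset.univ.filter fun x : K => x ^ (e + 1) = a := by
      intro a ha
      ext x
      simp only [Finset.mem_filter, Finset.mem_erase, Finset.mem_univ, and_true, true_and,
        and_iff_right_iff_imp]
      rintro rfl rfl
      exact (Finset.mem_filter.1 ha).2.1 (zero_pow (by omega))
    rw [Finset.sum_congr rfl fun a ha => congrArg Finset.card (h2 a ha)] at h1
    rw [← h1, Finset.card_erase_add_one (Finset.mem_univ _), Finset.card_univ]
  have hcT : c ∈ T := Finset.mem_filter.2 ⟨Finset.mem_univ _, hc, hce⟩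
  refine le_antisymm (hfib c hcT) (not_lt.1 fun hlt => ?_)
  have h1 : ∑ a ∈ T, (Finset.univ.filter fun x : K => x ^ (e + 1) = a).card < ∑ a ∈ T, (e + 1) :=
    Finset.sum_lt_sum hfib ⟨c, hcT, hlt⟩
  rw [Finset.sum_const, smul_eq_mul] at h1
  obtain ⟨k, rfl⟩ : ∃ k, e = k + 1 := ⟨e - 1, by omega⟩
  have h2 : T.card * (k + 1 + 1) ≤ k * (k + 1 + 1) := Nat.mul_le_mul_right _ (by omega)
  nlinarith

end Norm

section Orthonormal

variable {K : Type*} [Field K] [Fintype K] {e p r : ℕ} [Fact p.Prime] [CharP K p]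
  {V : Type*} [AddCommGroup V] [Module K V]

/-- Nondegenerate Hermitian forms over `𝔽_{e²}` admit orthonormal families of every possible
length. The form is linear in its second argument. -/
theorem exists_orthonormal (her : e = p ^ r) (he : 2 ≤ e) (hee : e * e = Fintype.card K)
    {B : V → V →ₗ[K] K} (hherm : ∀ x y, B x y = B y x ^ e) (hnd : ∀ x, B x = 0 → x = 0) (k : ℕ)
    (hk : k ≤ Module.finrank K V) :
    ∃ b : Fin k → V, ∀ i j, B (b i) (b j) = if i = j then 1 else 0 := by
  classical
  induction k with
  | zero => exact ⟨Fin.elim0, fun i => i.elim0⟩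
  | succ k ih =>
  obtain ⟨b, hb⟩ := ih (by omega)
  have hadd : ∀ x y z, B (x + y) z = B x z + B y z := by
    intro x y z
    rw [hherm, map_add, her, add_pow_char_pow, ← her, ← hherm, ← hherm]
  have hsmul : ∀ (t : K) x z, B (t • x) z = t ^ e * B x z := by
    intro t x z
    rw [hherm, map_smul, smul_eq_mul, mul_pow, ← hherm]
  -- If the orthogonal complement of the family had only isotropic vectors, the form would vanish on
  -- it: a nonzero `B w w'` would give `u^e = -u` for all `u`. By nondegeneracy the complement is
  -- then zero and the family spans, against the dimension.
  obtain ⟨w, hw, hww⟩ : ∃ w, (∀ i, B (b i) w = 0) ∧ B w w ≠ 0 := by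
    by_contra! h
    have hzero : ∀ w w', (∀ i, B (b i) w = 0) → (∀ i, B (b i) w' = 0) → B w w' = 0 := by
      intro w w' hw hw'
      by_contra hα
      have hneg : ∀ u : K, u ^ e = -u := by
        intro u
        have h1 := h (w + (u / B w w') • w') fun i => by
          rw [map_add, map_smul, hw, hw', smul_zero, add_zero]
        rw [hadd, hsmul, map_add, map_add, map_smul, map_smul, h w hw, h w' hw', hherm w' w,
          smul_eq_mul, smul_zero, add_zero, zero_add, ← mul_pow, div_mul_cancel₀ _ hα] at h1
        exact eq_neg_of_add_eq_zero_right h1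
      obtain ⟨ρ, hρ⟩ := exists_pow_sub_ne_zero he hee
      apply hρ
      have h1 := hneg 1
      rw [one_pow] at h1
      rw [hneg, neg_eq_neg_one_mul, ← h1, one_mul, sub_self]
    have hproj : ∀ x, x = ∑ i, B (b i) x • b i := by
      intro x
      have hperp : ∀ x i, B (b i) (x - ∑ j, B (b j) x • b j) = 0 := by
        intro x i
        simp [map_sum, hb]
      refine sub_eq_zero.1 (hnd _ (LinearMap.ext fun y => ?_))
      have h1 : y = (y - ∑ j, B (b j) y • b j) + ∑ j, B (b j) y • b j := by abel
      rw [h1, map_add, hzero _ _ (hperp x) (hperp y), zero_add, map_sum, LinearMap.zero_apply]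
      refine Finset.sum_eq_zero fun j _ => ?_
      rw [map_smul, hherm _ (b j), hperp, zero_pow (by omega), smul_zero]
    have htop : Submodule.span K (Set.range b) = ⊤ := by
      rw [eq_top_iff]
      intro x _
      rw [hproj x]
      exact Submodule.sum_mem _ fun i _ =>
        Submodule.smul_mem _ _ (Submodule.subset_span ⟨i, rfl⟩)
    have h1 := finrank_range_le_card (R := K) b
    rw [Set.finrank, htop, finrank_top, Fintype.card_fin] at h1
    omega
  -- `B w w` lies in the fixed field of the `e`-th power map, so it is a norm and `w` can be
  -- normalised.
  obtain ⟨t, ht⟩ : ∃ t, t ^ (e + 1) = B w w := by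
    have h1 := card_filter_pow_succ_eq he hee hww (hherm w w).symm
    obtain ⟨t, ht⟩ := Finset.card_pos.1 (Nat.lt_of_lt_of_eq (Nat.succ_pos e) h1.symm)
    exact ⟨t, by simpa using ht⟩
  have ht0 : t ≠ 0 := by
    rintro rfl
    exact hww (ht.symm.trans (zero_pow (by omega)))
  refine ⟨Fin.snoc (α := fun _ => V) b (t⁻¹ • w), fun i j => ?_⟩
  induction i using Fin.lastCases with
  | last =>
    induction j using Fin.lastCases with
    | last =>
      rw [Fin.snoc_last, hsmul, map_smul, if_pos rfl, ← ht, smul_eq_mul, pow_succ, inv_pow]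
      field_simp
    | cast j =>
      rw [Fin.snoc_last, Fin.snoc_castSucc, hsmul, hherm, hw, zero_pow (by omega), mul_zero,
        if_neg (Fin.castSucc_lt_last j).ne']
  | cast i =>
    induction j using Fin.lastCases with
    | last =>
      rw [Fin.snoc_last, Fin.snoc_castSucc, map_smul, hw, smul_zero,
        if_neg (Fin.castSucc_lt_last i).ne]
    | cast j =>
      rw [Fin.snoc_castSucc, Fin.snoc_castSucc, hb]
      simp

variable {σ : Type*} [Fintype σ] [DecidableEq σ]

/-- As `e = 0` in `K`, the gradient of the form at a rational `x` represents the functional `B x`. A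
vector in the radical is isotropic with zero gradient, so nonsingularity makes `B` nondegenerate,
and an orthonormal basis is the required change of variables. -/
theorem linEquivalent_hermitianForm {n : ℕ} (hn : Fintype.card σ = n + 2) (her : e = p ^ r)
    (he : 2 ≤ e) (hee : e * e = Fintype.card K) {A : Matrix σ σ K}
    (hA : ∀ i j, A j i = A i j ^ e) (hns : Nonsing (sesqForm e A)) :
    LinEquivalent (sesqForm e A) (hermitianForm K n e) := by
  have hr : r ≠ 0 := by
    rintro rfl
    rw [pow_zero] at her
    omega
  have he0 : (e : K) = 0 := by
    rw [her, Nat.cast_pow, CharP.cast_eq_zero, zero_pow hr]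
  have hqe : ∀ a : K, (a ^ e) ^ e = a := fun a => by rw [← pow_mul, hee, FiniteField.pow_card]
  let B : (σ → K) → (σ → K) →ₗ[K] K := fun y =>
    Fintype.linearCombination K fun i => ∑ j, A i j * y j ^ e
  have hB : ∀ y x, B y x = ∑ i, ∑ j, A i j * x i * y j ^ e := by
    intro y x
    simp only [B, Fintype.linearCombination_apply, smul_eq_mul, Finset.mul_sum]
    exact Finset.sum_congr rfl fun i _ => Finset.sum_congr rfl fun j _ => by ring
  have hherm : ∀ x y, B x y = B y x ^ e := by
    intro x y
    rw [hB, hB, her, sum_pow_char_pow, Finset.sum_comm]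
    refine Finset.sum_congr rfl fun i _ => ?_
    rw [sum_pow_char_pow]
    refine Finset.sum_congr rfl fun j _ => ?_
    rw [← her, mul_pow, mul_pow, hqe, hA i j]
    ring
  have heval : ∀ x, eval x (sesqForm e A) = B x x := fun x => by rw [eval_sesqForm, hB]
  have hnd : ∀ x, B x = 0 → x = 0 := by
    intro x hx
    by_contra hx0
    obtain ⟨k, hk⟩ := hns.exists_eval_pderiv_ne_zero hx0 (by rw [heval, hx, LinearMap.zero_apply])
    apply hk
    rw [eval_pderiv_sesqForm he0]
    have := LinearMap.congr_fun hx (Pi.single k 1)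
    simpa [B, Fintype.linearCombination_apply_single] using this
  obtain ⟨b, hb⟩ := exists_orthonormal her he hee hherm hnd (n + 2) (by simp [hn])
  let M : Matrix σ (Fin (n + 2)) K := Matrix.of fun i j => b j i
  have hM : ∀ x, M.mulVec x = ∑ j, x j • b j := by
    intro x
    ext i
    simp [M, Matrix.mulVec, dotProduct, mul_comm]
  have hBM : ∀ i x, B (b i) (M.mulVec x) = x i := by
    intro i x
    simp [hM, map_sum, hb]
  obtain ⟨N, h₁, h₂⟩ : ∃ N : Matrix (Fin (n + 2)) σ K, M * N = 1 ∧ N * M = 1 := by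
    have h₂ : (Matrix.of fun i k => ∑ j, A k j * b i j ^ e) * M = 1 := by
      ext i k
      rw [Matrix.one_apply, ← hb i k]
      simp only [Matrix.mul_apply, Matrix.of_apply, M, B, Fintype.linearCombination_apply,
        smul_eq_mul]
      exact Finset.sum_congr rfl fun j _ => mul_comm _ _
    exact ⟨_, (Matrix.mul_eq_one_comm_of_card_eq _ _ _ (by simp [hn])).1 h₂, h₂⟩
  have hpoly : lsub M (sesqForm e A) = hermitianForm K n e := by
    have hA1 : (sesqForm e A).IsHomogeneous (e + 1) := by
      refine IsHomogeneous.sum _ _ _ fun i _ => IsHomogeneous.sum _ _ _ fun j _ => ?_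
      have := ((isHomogeneous_C σ (A i j)).mul (isHomogeneous_X K i)).mul
        ((isHomogeneous_X K j).pow e)
      rwa [zero_add, one_mul, add_comm] at this
    have hA2 : (hermitianForm K n e).IsHomogeneous (e + 1) := by
      refine IsHomogeneous.sum _ _ _ fun i _ => ?_
      have := (isHomogeneous_X K i).pow (e + 1)
      rwa [one_mul] at this
    refine eq_of_eval_eq (isHomogeneous_lsub hA1 M) hA2 (by rw [← hee]; nlinarith) fun x => ?_
    rw [eval_lsub, heval]
    conv_lhs => enter [2]; rw [hM]
    rw [map_sum, hermitianForm, map_sum]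
    refine Finset.sum_congr rfl fun i _ => ?_
    rw [map_smul, hherm, hBM, map_pow, eval_X, smul_eq_mul, pow_succ, mul_comm]
  rw [← hpoly]
  exact LinEquivalent.of_lsub h₁ h₂ _

/-- Both `e` and `q` are powers of `p`, so `e < q` makes `e` a proper divisor of `q`, with cofactor
at least `2`; the results on derivatives, values and Hermitian shape then apply in turn. -/
theorem IsExtremalNormal.linEquivalent_hermitianForm {m n : ℕ}
    {G : MvPolynomial (Fin m ⊕ Fin m) K} (hG : IsExtremalNormal e G) (hm : 2 ≤ m)
    (hn : m + m = n + 2) (her : e = p ^ r) (he : 2 ≤ e) (heq : e < Fintype.card K) :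
    e * e = Fintype.card K ∧ LinEquivalent G (hermitianForm K n e) := by
  have hp : p.Prime := Fact.out
  obtain ⟨t, -, ht⟩ := FiniteField.card K p
  have hrt : r < t := by
    rw [her, ht] at heq
    exact (Nat.pow_lt_pow_iff_right hp.one_lt).1 heq
  have hr : r ≠ 0 := by
    rintro rfl
    rw [pow_zero] at her
    omega
  have he0 : (e : K) = 0 := by
    rw [her, Nat.cast_pow, CharP.cast_eq_zero, zero_pow hr]
  have hef : p ^ (t - r) * e = Fintype.card K := by
    rw [her, ht, ← pow_add, Nat.sub_add_cancel hrt.le]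
  have hf : 2 ≤ p ^ (t - r) :=
    hp.two_le.trans (Nat.le_self_pow (Nat.sub_ne_zero_of_lt hrt) p)
  obtain ⟨hfe, c, -, hder⟩ := hG.pderiv_inl_eq_C_mul hm he hf he0 hef
  rw [← hfe] at hef
  refine ⟨hef, ?_⟩
  obtain ⟨l, hl, hval⟩ := hG.exists_pow_eq_self her hm he hef hder
  have hH : (C l * G).IsHomogeneous (e + 1) := by
    have := (isHomogeneous_C (Fin m ⊕ Fin m) l).mul hG.homogeneous
    rwa [zero_add] at this
  obtain ⟨A, hA, hHA⟩ := exists_eq_sesqForm her he hef hH fun z => by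
    rw [map_mul, eval_C, hval]
  have hns : Nonsing (C l * G) := by
    intro x hx h0
    have hl' : algebraMap K (AlgebraicClosure K) l ≠ 0 := by simpa using hl
    rw [map_mul, aeval_C] at h0
    obtain ⟨i, hi⟩ := hG.nonsing x hx ((mul_eq_zero.1 h0).resolve_left hl')
    refine ⟨i, ?_⟩
    rw [pderiv_C_mul, map_mul, aeval_C]
    exact mul_ne_zero hl' hi
  refine (LinEquivalent.of_C_mul hl G).trans ?_
  rw [hHA] at hns ⊢
  exact FqHypersurface.linEquivalent_hermitianForm (by simpa using hn) her he hef hA hns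

end Orthonormal

/-! ### Zero counts of Hermitian forms -/

section Count

variable {K : Type*} [Field K] [Fintype K] [DecidableEq K] {s p r : ℕ} [Fact p.Prime] [CharP K p]

/-- Given the other coordinates, the first must have norm minus their sum of norms: one choice if
that sum is zero, `s + 1` otherwise. -/
lemma card_hermitian_succ (her : s = p ^ r) (he : 2 ≤ s) (hee : s * s = Fintype.card K) (j : ℕ) :
    (Finset.univ.filter fun x : Fin (j + 1) → K => ∑ i, x i ^ (s + 1) = 0).card
      + s * (Finset.univ.filter fun x : Fin j → K => ∑ i, x i ^ (s + 1) = 0).card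
      = (s + 1) * Fintype.card K ^ j := by
  have hfix : ∀ x : Fin j → K, (∑ i, x i ^ (s + 1)) ^ s = ∑ i, x i ^ (s + 1) := by
    intro x
    rw [her, sum_pow_char_pow, ← her]
    refine Finset.sum_congr rfl fun i _ => ?_
    rw [← pow_mul, add_mul, hee, one_mul, pow_add, FiniteField.pow_card, pow_succ, mul_comm]
  have hneg : (-1 : K) ^ s = -1 := by
    rw [her]
    exact neg_one_pow_expChar_pow K p r
  have h1 : (Finset.univ.filter fun x : Fin (j + 1) → K => ∑ i, x i ^ (s + 1) = 0).card
      = ∑ x : Fin j → K, (Finset.univ.filter fun a : K => a ^ (s + 1) = -∑ i, x i ^ (s + 1)).card := by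
    rw [← Finset.card_sigma]
    refine Finset.card_bij' (fun x _ => ⟨Fin.tail x, x 0⟩) (fun y _ => Fin.cons y.2 y.1) ?_ ?_ ?_ ?_
    · intro x hx
      refine Finset.mem_sigma.2 ⟨Finset.mem_univ _, Finset.mem_filter.2 ⟨Finset.mem_univ _, ?_⟩⟩
      simpa [Fin.sum_univ_succ, Fin.tail, eq_neg_iff_add_eq_zero] using hx
    · rintro ⟨x, a⟩ hx
      simpa [Fin.sum_univ_succ, eq_neg_iff_add_eq_zero] using hx
    · intro x _
      exact Fin.cons_self_tail x
    · rintro ⟨x, a⟩ _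
      simp
  have h2 : ∀ x : Fin j → K,
      (Finset.univ.filter fun a : K => a ^ (s + 1) = -∑ i, x i ^ (s + 1)).card
        + (if ∑ i, x i ^ (s + 1) = 0 then s else 0) = s + 1 := by
    intro x
    split_ifs with h
    · rw [h, neg_zero, Finset.card_eq_one.2 ⟨0, ?_⟩, add_comm]
      ext a
      simp
    · rw [card_filter_pow_succ_eq he hee (neg_ne_zero.2 h), add_zero]
      rw [neg_pow, hneg, hfix, neg_one_mul]
  have h3 : s * (Finset.univ.filter fun x : Fin j → K => ∑ i, x i ^ (s + 1) = 0).card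
      = ∑ x : Fin j → K, if ∑ i, x i ^ (s + 1) = 0 then s else 0 := by
    rw [← Finset.sum_filter, Finset.sum_const, smul_eq_mul, mul_comm]
  rw [h1, h3, ← Finset.sum_add_distrib, Finset.sum_congr rfl fun x _ => h2 x, Finset.sum_const,
    Finset.card_univ, Fintype.card_fun, Fintype.card_fin, smul_eq_mul, mul_comm]

lemma card_hermitian (her : s = p ^ r) (he : 2 ≤ s) (hee : s * s = Fintype.card K) (m : ℕ) :
    (Finset.univ.filter fun x : Fin (2 * m + 2) → K => ∑ i, x i ^ (s + 1) = 0).card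
      = Fintype.card K ^ (m + 1) + (Fintype.card K ^ (m + 1) - 1) * (s * Fintype.card K ^ m) := by
  have hpos : ∀ k, 1 ≤ Fintype.card K ^ k := fun k => Nat.one_le_pow _ _ Fintype.card_pos
  induction m with
  | zero =>
    have h0 : (Finset.univ.filter fun x : Fin 0 → K => ∑ i, x i ^ (s + 1) = 0).card = 1 := by
      simp
    have h1 := card_hermitian_succ her he hee 0
    have h2 := card_hermitian_succ her he hee 1
    rw [h0] at h1
    zify [hpos 1] at h1 h2 ⊢
    simp only [zero_add, pow_zero, pow_one, mul_one] at h1 h2 ⊢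
    linear_combination h2 - s * h1
  | succ m ih =>
    have h1 := card_hermitian_succ her he hee (2 * m + 2)
    have h2 := card_hermitian_succ her he hee (2 * m + 3)
    rw [ih] at h1
    zify [hpos (m + 1), hpos (m + 2)] at h1 h2 hee ⊢
    rw [show 2 * (m + 1) + 2 = 2 * m + 3 + 1 by ring]
    linear_combination h2 - s * h1 + (-(Fintype.card K : ℤ) ^ (2 * m + 2)
      + (Fintype.card K ^ (m + 1) + (Fintype.card K ^ (m + 1) - 1) * (s * Fintype.card K ^ m))) * hee

lemma zeroCount_hermitianForm {n m : ℕ} (hn : n = 2 * m) (her : s = p ^ r) (he : 2 ≤ s)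
    (hee : s * s = Fintype.card K) : zeroCount (hermitianForm K n s)
      = Fintype.card K ^ (m + 1) + (Fintype.card K ^ (m + 1) - 1) * (s * Fintype.card K ^ m) := by
  subst hn
  rw [← card_hermitian her he hee, zeroCount, Nat.card_eq_fintype_card, Fintype.card_subtype]
  simp [hermitianForm]

end Count

/-! ### Quadratic forms: isotropic vectors and hyperbolic planes -/

section Substitution

variable {K : Type*} [Field K] {σ τ : Type*} [Fintype σ] [Fintype τ] [DecidableEq σ]
  [DecidableEq τ]

lemma exists_inverse_of_injective {M : Matrix σ τ K} (hcard : Fintype.card σ = Fintype.card τ)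
    (hinj : ∀ x, M.mulVec x = 0 → x = 0) : ∃ N : Matrix τ σ K, M * N = 1 ∧ N * M = 1 := by
  obtain ⟨g, hg⟩ := LinearMap.exists_leftInverse_of_injective M.mulVecLin
    (LinearMap.ker_eq_bot'.2 hinj)
  have h : LinearMap.toMatrix' g * M = 1 := by
    have := congrArg LinearMap.toMatrix' hg
    rwa [LinearMap.toMatrix'_comp, ← Matrix.toLin'_apply', LinearMap.toMatrix'_toLin',
      LinearMap.toMatrix'_id] at this
  exact ⟨_, (Matrix.mul_eq_one_comm_of_card_eq _ _ _ hcard.symm).1 h, h⟩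

lemma LinEquivalent.of_linearMap [Fintype K] {F : MvPolynomial σ K} {G : MvPolynomial τ K} {a : ℕ}
    (hF : F.IsHomogeneous a) (hG : G.IsHomogeneous a) (ha : a ≤ Fintype.card K)
    (hcard : Fintype.card σ = Fintype.card τ) (f : (τ → K) →ₗ[K] (σ → K))
    (hinj : ∀ x, f x = 0 → x = 0) {c : K} (hc : c ≠ 0)
    (h : ∀ x, eval (f x) F = c * eval x G) : LinEquivalent F G := by
  obtain ⟨N, h₁, h₂⟩ := exists_inverse_of_injective (M := LinearMap.toMatrix' f) hcard
    fun x hx => hinj x (by rwa [LinearMap.toMatrix'_mulVec] at hx)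
  refine ⟨_, N, h₁, h₂, c, hc, eq_of_eval_eq (isHomogeneous_lsub hF _) ?_ ha fun x => ?_⟩
  · have := (isHomogeneous_C τ c).mul hG
    rwa [zero_add] at this
  · rw [eval_lsub, LinearMap.toMatrix'_mulVec, h, map_mul, eval_C]

end Substitution

section Quadratic

variable {K : Type*} [Field K] {σ : Type*} [Fintype σ]

/-- By Chevalley–Warning the number of zeros is divisible by the characteristic, so the origin is
not the only one. -/
lemma exists_ne_zero_eval_eq_zero [Fintype K] {F : MvPolynomial σ K} (hF : F.IsHomogeneous 2)
    (hσ : 3 ≤ Fintype.card σ) : ∃ x ≠ 0, eval x F = 0 := by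
  classical
  obtain ⟨p, hp⟩ := CharP.exists K
  have hdvd := char_dvd_card_solutions p (f := F) (hF.totalDegree_le.trans_lt (by omega))
  have h0 : eval 0 F = 0 := eval_zero_of_isHomogeneous two_ne_zero hF
  by_contra! h
  have : Fintype.card {x // eval x F = 0} = 1 := by
    rw [Fintype.card_eq_one_iff]
    exact ⟨⟨0, h0⟩, fun y => Subtype.ext (by_contra fun hy => h y.1 hy y.2)⟩
  rw [this, Nat.dvd_one] at hdvd
  subst hdvd
  exact CharP.char_ne_one K 1 rfl

/-- The polar form of `F` has no isotropic rational vector of `F` in its radical. -/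
def PolarNonsing (F : MvPolynomial σ K) : Prop :=
  ∀ x ≠ 0, eval x F = 0 → ∃ w, eval (x + w) F ≠ eval x F + eval w F

lemma eval_add_of_matrix [DecidableEq σ] (A : Matrix σ σ K) (x y : σ → K) :
    eval (x + y) (∑ i, X i * linForm (A i))
      = eval x (∑ i, X i * linForm (A i)) + eval y (∑ i, X i * linForm (A i))
        + (A.mulVec x + Matrix.vecMul x A) ⬝ᵥ y := by
  have h : ∀ z : σ → K, eval z (∑ i, X i * linForm (A i)) = z ⬝ᵥ A.mulVec z := by
    intro z
    simp only [map_sum, map_mul, eval_X, eval_linForm]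
    rfl
  rw [h, h, h, Matrix.mulVec_add, add_dotProduct, dotProduct_add, dotProduct_add, add_dotProduct,
    ← Matrix.dotProduct_mulVec, dotProduct_comm (A.mulVec x) y]
  ring

lemma eval_pderiv_of_matrix [DecidableEq σ] (A : Matrix σ σ K) (x : σ → K) (k : σ) :
    eval x (pderiv k (∑ i, X i * linForm (A i))) = (A.mulVec x + Matrix.vecMul x A) k := by
  simp only [map_sum, pderiv_mul, pderiv_linForm, map_add, map_mul, eval_X, eval_linForm, eval_C,
    Finset.sum_add_distrib, Pi.add_apply]
  congr 1
  rw [Finset.sum_eq_single k]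
  · rw [pderiv_X_self, map_one, one_mul]
    rfl
  · intro i _ hi
    rw [pderiv_X_of_ne hi, map_zero, zero_mul]
  · simp

lemma Nonsing.polarNonsing {F : MvPolynomial σ K} (hF : F.IsHomogeneous 2) (hns : Nonsing F) :
    PolarNonsing F := by
  classical
  intro x hx h0
  obtain ⟨A, rfl⟩ := exists_eq_sum_of_isHomogeneous_two hF
  obtain ⟨i, hi⟩ := hns.exists_eval_pderiv_ne_zero hx h0
  refine ⟨Pi.single i 1, fun h => hi ?_⟩
  rw [eval_add_of_matrix, add_eq_left, dotProduct_single, mul_one] at h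
  rw [eval_pderiv_of_matrix, h]

variable [Fintype K] [DecidableEq σ]

/-- A quadratic form with a nonsingular rational zero splits off a hyperbolic plane. -/
theorem exists_split_hyperbolic {k : ℕ} (hσ : Fintype.card σ = k + 2) {F : MvPolynomial σ K}
    (hF : F.IsHomogeneous 2) (hns : PolarNonsing F) {P : σ → K} (hP : P ≠ 0) (hFP : eval P F = 0) :
    ∃ D : MvPolynomial (Fin k) K, D.IsHomogeneous 2 ∧
      LinEquivalent F (X (Sum.inl 0) * X (Sum.inl 1) + rename Sum.inr D :
        MvPolynomial (Fin 2 ⊕ Fin k) K) ∧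
      ∀ c ≠ 0, eval c D = 0 → ∃ u, (∀ a b : K, a • P + b • u = 0 → a = 0 ∧ b = 0) ∧
        ∀ a b : K, eval (a • P + b • u) F = 0 := by
  have hsm : ∀ (a : K) x, eval (a • x) F = a ^ 2 * eval x F := fun a x =>
    eval_smul_of_isHomogeneous hF a x
  obtain ⟨B, hB, hBsymm, hBdiag⟩ : ∃ B : (σ → K) → (σ → K) →ₗ[K] K,
      (∀ x y, eval (x + y) F = eval x F + eval y F + B x y) ∧ (∀ x y, B x y = B y x) ∧
      ∀ x, B x x = 2 * eval x F := by
    obtain ⟨A, rfl⟩ := exists_eq_sum_of_isHomogeneous_two hF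
    have hB : ∀ x y, eval (x + y) (∑ i, X i * linForm (A i))
      = eval x (∑ i, X i * linForm (A i)) + eval y (∑ i, X i * linForm (A i))
        + (dotProductBilin K K) (A.mulVec x + Matrix.vecMul x A) y :=
      eval_add_of_matrix A
    refine ⟨fun x => dotProductBilin K K (A.mulVec x + Matrix.vecMul x A), hB, ?_, ?_⟩
    · intro x y
      have h1 := hB x y
      rw [add_comm x y, hB y x] at h1
      linear_combination -h1
    · intro x
      have h1 := hB x x
      rw [← two_smul K x, hsm] at h1
      linear_combination -h1
  obtain ⟨w, hw⟩ := hns P hP hFP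
  have hPw : B P w ≠ 0 := by
    intro h
    rw [hB, h, add_zero] at hw
    exact hw rfl
  -- After scaling to `B P w = 1`, adding a multiple of the isotropic vector `P` changes `F w` by
  -- that multiple, so `w` can be made isotropic as well.
  obtain ⟨w, hPw, hFw⟩ : ∃ w, B P w = 1 ∧ eval w F = 0 := by
    refine ⟨(B P w)⁻¹ • w + (-(eval ((B P w)⁻¹ • w) F)) • P, ?_, ?_⟩
    · rw [map_add, map_smul, map_smul, hBdiag, hFP, smul_eq_mul, inv_mul_cancel₀ hPw]
      simp
    · rw [hB, hsm _ P, hFP, map_smul, hBsymm _ P, map_smul, smul_eq_mul, smul_eq_mul,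
        inv_mul_cancel₀ hPw]
      ring
  have hPP : B P P = 0 := by rw [hBdiag, hFP, mul_zero]
  have hww : B w w = 0 := by rw [hBdiag, hFw, mul_zero]
  have hwP : B w P = 1 := by rw [hBsymm, hPw]
  -- The kernel of `φ` is the orthogonal complement of the hyperbolic plane spanned by `P` and `w`.
  let φ : (σ → K) →ₗ[K] K × K := (B P).prod (B w)
  have hφ : Function.Surjective φ := by
    rintro ⟨a, b⟩
    refine ⟨a • w + b • P, ?_⟩
    simp [φ, hPw, hPP, hww, hwP]
  have hker : Module.finrank K (LinearMap.ker φ) = k := by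
    have h1 := LinearMap.finrank_range_add_finrank_ker φ
    rw [LinearMap.range_eq_top.2 hφ, finrank_top, Module.finrank_prod, Module.finrank_self,
      Module.finrank_fintype_fun_eq_card, hσ] at h1
    omega
  let u := Module.finBasisOfFinrankEq K (LinearMap.ker φ) hker
  let ι : (Fin k → K) →ₗ[K] (σ → K) := (LinearMap.ker φ).subtype ∘ₗ u.equivFun.symm.toLinearMap
  have hι : ∀ c, B P (ι c) = 0 ∧ B w (ι c) = 0 := by
    intro c
    have h1 : φ (ι c) = 0 := (u.equivFun.symm c).2
    exact ⟨congrArg Prod.fst h1, congrArg Prod.snd h1⟩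
  have hι0 : ∀ c, ι c = 0 → c = 0 := by
    intro c hc
    have h1 : u.equivFun.symm c = 0 := Subtype.ext hc
    exact (LinearEquiv.map_eq_zero_iff _).1 h1
  have hBz : ∀ (a b : K) c, B P (a • P + b • w + ι c) = b ∧ B w (a • P + b • w + ι c) = a := by
    intro a b c
    simp [hPw, hPP, hww, hwP, hι]
  have hev : ∀ (a b : K) c, eval (a • P + b • w + ι c) F = a * b + eval (ι c) F := by
    intro a b c
    have h1 : B (a • P + b • w) (ι c) = 0 := by
      rw [hBsymm, map_add, map_smul, map_smul, hBsymm, hBsymm _ w, (hι c).1, (hι c).2]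
      simp
    rw [hB, hB, hsm, hsm, hFP, hFw, h1, map_smul, hBsymm, map_smul, hwP]
    simp only [smul_eq_mul]
    ring
  have hD : (lsub (LinearMap.toMatrix' ι) F).IsHomogeneous 2 := isHomogeneous_lsub hF _
  have hDev : ∀ c, eval c (lsub (LinearMap.toMatrix' ι) F) = eval (ι c) F := by
    intro c
    rw [eval_lsub, LinearMap.toMatrix'_mulVec]
  refine ⟨lsub (LinearMap.toMatrix' ι) F, hD, ?_, ?_⟩
  · let f : (Fin 2 ⊕ Fin k → K) →ₗ[K] (σ → K) :=
      (LinearMap.proj (Sum.inl 0)).smulRight P + (LinearMap.proj (Sum.inl 1)).smulRight w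
        + ι ∘ₗ LinearMap.funLeft K K Sum.inr
    have hf : ∀ z, f z = z (Sum.inl 0) • P + z (Sum.inl 1) • w + ι (z ∘ Sum.inr) := fun z => rfl
    refine LinEquivalent.of_linearMap hF ?_ Fintype.one_lt_card (by simp [hσ, add_comm]) f
      (fun z hz => ?_) one_ne_zero fun z => ?_
    · exact ((isHomogeneous_X _ _).mul (isHomogeneous_X _ _)).add hD.rename_isHomogeneous
    · rw [hf] at hz
      have h1 := hBz (z (Sum.inl 0)) (z (Sum.inl 1)) (z ∘ Sum.inr)
      rw [hz, map_zero, map_zero] at h1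
      rw [← h1.1, ← h1.2, zero_smul, zero_smul, zero_add, zero_add] at hz
      have h2 := hι0 _ hz
      ext (i | j)
      · fin_cases i
        · exact h1.2.symm
        · exact h1.1.symm
      · exact congrFun h2 j
    · rw [hf, hev, one_mul, map_add, map_mul, eval_X, eval_X, eval_rename, hDev]
  · intro c hc h0
    rw [hDev] at h0
    have hval : ∀ a b : K, a • P + b • ι c = a • P + (0 : K) • w + ι (b • c) := by
      intro a b
      rw [map_smul, zero_smul, add_zero]
    refine ⟨ι c, fun a b hab => ?_, fun a b => ?_⟩
    · rw [hval] at hab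
      have h1 := (hBz a 0 (b • c)).2
      rw [hab, map_zero] at h1
      rw [← h1, zero_smul, zero_smul, zero_add, zero_add] at hab
      exact ⟨h1.symm, (smul_eq_zero.1 (hι0 _ hab)).resolve_right hc⟩
    · rw [hval, hev, map_smul, hsm, h0, mul_zero, mul_zero, add_zero]

end Quadratic

/-! ### Quadrics without rational lines -/

section LineFree

variable {K : Type*} [Field K] [Fintype K] {n : ℕ} {F : MvPolynomial (Fin (n + 2)) K}

/-- Vanishing at the rational points of the line is enough: a binary form of degree `2 ≤ q` with
only zero values is zero. -/
lemma one_le_thasInvariant (hF : F.IsHomogeneous 2) {P u : Fin (n + 2) → K}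
    (hind : ∀ a b : K, a • P + b • u = 0 → a = 0 ∧ b = 0)
    (h0 : ∀ a b : K, eval (a • P + b • u) F = 0) : 1 ≤ thasInvariant F := by
  let M : Matrix (Fin (n + 2)) (Fin 2) K := Matrix.of fun i => ![P i, u i]
  have hM : ∀ x, M.mulVec x = x 0 • P + x 1 • u := by
    intro x
    ext i
    simp [M, Matrix.mulVec, dotProduct, Fin.sum_univ_two, mul_comm]
  have hinj : Function.Injective M.mulVecLin := by
    rw [← LinearMap.ker_eq_bot, LinearMap.ker_eq_bot']
    intro x hx
    rw [Matrix.mulVecLin_apply, hM] at hx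
    obtain ⟨h1, h2⟩ := hind _ _ hx
    ext i
    fin_cases i
    · exact h1
    · exact h2
  refine le_thasInvariant (V := LinearMap.range M.mulVecLin) ?_ ?_
  · rw [LinearMap.finrank_range_of_inj hinj]
    simp
  · rw [containsLinear_range_iff]
    refine eq_zero_of_isHomogeneous (isHomogeneous_lsub hF M) Fintype.one_lt_card fun x => ?_
    rw [eval_lsub, hM, h0]

/-- An isotropic vector of the complement `D` would span, together with the isotropic vector `P`, a
line on the quadric. -/
theorem exists_anisotropic (hn : 1 ≤ n) (hF : F.IsHomogeneous 2) (hns : Nonsing F)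
    (hk : thasInvariant F = 0) :
    ∃ D : MvPolynomial (Fin n) K, D.IsHomogeneous 2 ∧ (∀ c ≠ 0, eval c D ≠ 0) ∧
      LinEquivalent F (X (Sum.inl 0) * X (Sum.inl 1) + rename Sum.inr D :
        MvPolynomial (Fin 2 ⊕ Fin n) K) := by
  obtain ⟨P, hP, hFP⟩ := exists_ne_zero_eval_eq_zero hF (by simp; omega)
  obtain ⟨D, hD, hequiv, han⟩ := exists_split_hyperbolic (k := n) (by simp) hF (hns.polarNonsing hF) hP hFP
  refine ⟨D, hD, fun c hc h0 => ?_, hequiv⟩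
  obtain ⟨u, hind, hu⟩ := han c hc h0
  have := one_le_thasInvariant hF hind hu
  omega

lemma le_two_of_line_free (hn : 1 ≤ n) (hF : F.IsHomogeneous 2) (hns : Nonsing F)
    (hk : thasInvariant F = 0) : n ≤ 2 := by
  obtain ⟨D, hD, han, -⟩ := exists_anisotropic hn hF hns hk
  by_contra hlt
  obtain ⟨c, hc, h0⟩ := exists_ne_zero_eval_eq_zero hD (by simp; omega)
  exact han c hc h0

end LineFree

/-! ### Conics -/

section Conic

variable {K : Type*} [Field K]

lemma PolarNonsing.of_linEquivalent {σ τ : Type*} [Fintype σ] [Fintype τ] [DecidableEq σ]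
    [DecidableEq τ] {F : MvPolynomial σ K} {G : MvPolynomial τ K} (hF : PolarNonsing F)
    (h : LinEquivalent F G) : PolarNonsing G := by
  obtain ⟨M, N, h₁, h₂, c, hc, hM⟩ := h
  have hev : ∀ x, eval (M.mulVec x) F = c * eval x G := by
    intro x
    rw [← eval_lsub, hM, map_mul, eval_C]
  intro x hx h0
  obtain ⟨w, hw⟩ := hF (M.mulVec x) (fun hx' => hx (by
    have := congrArg N.mulVec hx'
    rwa [Matrix.mulVec_mulVec, h₂, Matrix.one_mulVec, Matrix.mulVec_zero] at this))
    (by rw [hev, h0, mul_zero])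
  refine ⟨N.mulVec w, fun h => hw ?_⟩
  have hw' : M.mulVec (N.mulVec w) = w := by rw [Matrix.mulVec_mulVec, h₁, Matrix.one_mulVec]
  rw [← hw', ← Matrix.mulVec_add, hev, hev, hev, h, mul_add]

lemma isHomogeneous_evenConic : (evenConic K 1).IsHomogeneous 2 := by
  have := ((isHomogeneous_X K (0 : Fin (1 + 2))).pow 2).add
    ((isHomogeneous_X K (1 : Fin (1 + 2))).mul (isHomogeneous_X K 2))
  exact this

/-- Valid in every characteristic. Splitting off a hyperbolic plane leaves `x y + a z²`, with `a ≠
0` by nondegeneracy; replacing `x` by `a x` makes `a` an overall factor. In odd characteristic the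
sum of three squares is reached through this same conic. -/
theorem linEquivalent_evenConic [Fintype K] {F : MvPolynomial (Fin (1 + 2)) K} (hF : F.IsHomogeneous 2)
    (hns : PolarNonsing F) : LinEquivalent F (evenConic K 1) := by
  obtain ⟨P, hP, hFP⟩ := exists_ne_zero_eval_eq_zero hF (by simp)
  obtain ⟨D, hD, hequiv, -⟩ := exists_split_hyperbolic (k := 1) (by simp) hF hns hP hFP
  have hns' := hns.of_linEquivalent hequiv
  obtain ⟨A, rfl⟩ := exists_eq_sum_of_isHomogeneous_two hD
  have hDev : ∀ c : Fin 1 → K, eval c (∑ i, X i * linForm (A i)) = A 0 0 * c 0 ^ 2 := by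
    intro c
    simp [linForm]
    ring
  have ha : A 0 0 ≠ 0 := by
    intro ha
    obtain ⟨w, hw⟩ := hns' (Pi.single (Sum.inr 0) 1) (by simp) (by
      rw [map_add, eval_rename, hDev]
      simp [ha])
    apply hw
    simp only [map_add, eval_rename, hDev, ha]
    simp
  refine hequiv.trans ?_
  let f : (Fin (1 + 2) → K) →ₗ[K] (Fin 2 ⊕ Fin 1 → K) :=
    { toFun := fun z => Sum.elim ![A 0 0 * z 1, z 2] ![z 0]
      map_add' := fun x y => by
        ext (i | i) <;> fin_cases i <;> simp [mul_add]
      map_smul' := fun c x => by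
        ext (i | i) <;> fin_cases i <;> simp [mul_left_comm] }
  have hf : ∀ z, f z = Sum.elim ![A 0 0 * z 1, z 2] ![z 0] := fun z => rfl
  refine LinEquivalent.of_linearMap
    (((isHomogeneous_X _ _).mul (isHomogeneous_X _ _)).add hD.rename_isHomogeneous)
    isHomogeneous_evenConic Fintype.one_lt_card (by simp) f (fun z hz => ?_) ha fun z => ?_
  · have h1 := congrFun hz (Sum.inl 0)
    have h2 := congrFun hz (Sum.inl 1)
    have h3 := congrFun hz (Sum.inr 0)
    simp only [hf, Sum.elim_inl, Sum.elim_inr, Matrix.cons_val_zero, Matrix.cons_val_one,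
      Pi.zero_apply, mul_eq_zero, ha, false_or] at h1 h2 h3
    ext i
    fin_cases i
    · exact h3
    · exact h1
    · exact h2
  · rw [hf, map_add, eval_rename, hDev, map_mul, eval_X, eval_X]
    simp [evenConic]
    ring

lemma polarNonsing_sumSquaresConic (h2 : (2 : K) ≠ 0) : PolarNonsing (sumSquaresConic K 1) := by
  intro x hx _
  obtain ⟨i, hi⟩ := Function.ne_iff.1 hx
  refine ⟨Pi.single i 1, fun h => ?_⟩
  have hev : ∀ z, eval z (sumSquaresConic K 1) = ∑ k, z k ^ 2 := by
    intro z
    simp [sumSquaresConic, Fin.sum_univ_succ]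
    ring
  rw [hev, hev, hev, ← Finset.sum_add_distrib, ← sub_eq_zero, ← Finset.sum_sub_distrib,
    Finset.sum_eq_single i] at h
  · simp only [Pi.add_apply, Pi.single_eq_same] at h
    have : 2 * x i = 0 := by linear_combination h
    exact (mul_ne_zero h2 hi) this
  · intro j _ hj
    simp [hj]
  · simp

theorem linEquivalent_sumSquaresConic [Fintype K] (h2 : (2 : K) ≠ 0)
    {F : MvPolynomial (Fin (1 + 2)) K}
    (hF : F.IsHomogeneous 2) (hns : PolarNonsing F) : LinEquivalent F (sumSquaresConic K 1) := by
  refine (linEquivalent_evenConic hF hns).trans (linEquivalent_evenConic ?_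
    (polarNonsing_sumSquaresConic h2)).symm
  have := (((isHomogeneous_X K (0 : Fin (1 + 2))).pow 2).add
    ((isHomogeneous_X K (1 : Fin (1 + 2))).pow 2)).add ((isHomogeneous_X K (2 : Fin (1 + 2))).pow 2)
  exact this

end Conic

/-! ### Elliptic quadric surfaces -/

section Elliptic

variable {K : Type*} [Field K] [Fintype K]

/-- For `a X² + b X Y + c Y²` anisotropy gives `a, c ≠ 0`. If `b ≠ 0`, rescaling `X` by `c / b`
equalises the last two coefficients. If `b = 0`, the characteristic is odd, since in characteristic
`2` a diagonal form is a square and isotropic; a shear then creates a mixed term. -/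
lemma exists_binary_normal_form {D : MvPolynomial (Fin 2) K} (hD : D.IsHomogeneous 2)
    (han : ∀ c ≠ 0, eval c D ≠ 0) :
    ∃ (α c : K) (g : (Fin 2 → K) →ₗ[K] (Fin 2 → K)), c ≠ 0 ∧ (∀ x, g x = 0 → x = 0) ∧
      ∀ x, eval (g x) D = c * (α * x 0 ^ 2 + x 0 * x 1 + x 1 ^ 2) := by
  obtain ⟨A, hA⟩ := exists_eq_sum_of_isHomogeneous_two hD
  set a := A 0 0 with ha'
  set b := A 0 1 + A 1 0 with hb'
  set c := A 1 1 with hc'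
  have hev : ∀ z, eval z D = a * z 0 ^ 2 + b * z 0 * z 1 + c * z 1 ^ 2 := by
    intro z
    rw [hA]
    simp [linForm, Fin.sum_univ_two, ha', hb', hc']
    ring
  have ha : a ≠ 0 := by
    have := han ![1, 0] (by simp)
    simpa [hev] using this
  have hc : c ≠ 0 := by
    have := han ![0, 1] (by simp)
    simpa [hev] using this
  by_cases hb : b = 0
  · have h2 : (2 : K) ≠ 0 := by
      intro h2
      have hch : ringChar K = 2 := CharP.ringChar_of_prime_eq_zero Nat.prime_two (by exact_mod_cast h2)
      obtain ⟨s, hs⟩ := FiniteField.isSquare_of_char_two hch a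
      obtain ⟨t, ht⟩ := FiniteField.isSquare_of_char_two hch c
      refine han ![t, s] ?_ ?_
      · intro h
        have : s = 0 := by simpa using congrFun h 1
        rw [this, mul_zero] at hs
        exact ha hs
      · rw [hev, hb]
        simp only [Matrix.cons_val_zero, Matrix.cons_val_one]
        linear_combination (t ^ 2) * hs + (s ^ 2) * ht + (s * t) ^ 2 * h2
    have hac : a + c ≠ 0 := by
      have := han ![1, 1] (by simp)
      simpa [hev, hb] using this
    have h2a : 2 * a ≠ 0 := mul_ne_zero h2 ha
    -- After `X ↦ s X + Y` the mixed coefficient is `2 a s` and that of `Y²` is `a + c`; this `s`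
    -- makes them equal.
    let s := (a + c) / (2 * a)
    have hs : s ≠ 0 := div_ne_zero hac h2a
    have hs' : 2 * a * s = a + c := mul_div_cancel₀ _ h2a
    let g : (Fin 2 → K) →ₗ[K] (Fin 2 → K) :=
      { toFun := fun x => ![s * x 0 + x 1, x 1]
        map_add' := fun x y => by
          ext i
          fin_cases i
          · simp; ring
          · simp
        map_smul' := fun t x => by
          ext i
          fin_cases i
          · simp; ring
          · simp }
    refine ⟨a * s ^ 2 / (a + c), a + c, g, hac, fun x hx => ?_, fun x => ?_⟩
    · have h0 : s * x 0 + x 1 = 0 := congrFun hx 0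
      have h1 : x 1 = 0 := congrFun hx 1
      rw [h1, add_zero] at h0
      ext i
      fin_cases i
      · exact (mul_eq_zero.1 h0).resolve_left hs
      · exact h1
    · have : eval (g x) D = a * (s * x 0 + x 1) ^ 2 + c * x 1 ^ 2 := by
        rw [hev, hb]
        simp [g]
      rw [this]
      field_simp
      linear_combination (x 0 * x 1) * hs'
  · let g : (Fin 2 → K) →ₗ[K] (Fin 2 → K) :=
      { toFun := fun x => ![c / b * x 0, x 1]
        map_add' := fun x y => by
          ext i
          fin_cases i
          · simp; ring
          · simp
        map_smul' := fun t x => by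
          ext i
          fin_cases i
          · simp; ring
          · simp }
    refine ⟨a * c / b ^ 2, c, g, hc, fun x hx => ?_, fun x => ?_⟩
    · have h0 : c / b * x 0 = 0 := congrFun hx 0
      have h1 : x 1 = 0 := congrFun hx 1
      ext i
      fin_cases i
      · exact (mul_eq_zero.1 h0).resolve_left (div_ne_zero hc hb)
      · exact h1
    · have : eval (g x) D = a * (c / b * x 0) ^ 2 + b * (c / b * x 0) * x 1 + c * x 1 ^ 2 := by
        rw [hev]
        simp [g]
      rw [this]
      field_simp

/-- Additive Hilbert 90 over `𝔽_2`: an element of vanishing absolute trace has the form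
`t² + t`. -/
lemma exists_sq_add_eq_of_trace_eq_zero {r : ℕ} (hq : Fintype.card K = 2 ^ r) {α : K}
    (hα : ∑ i ∈ Finset.range r, α ^ 2 ^ i = 0) : ∃ t, t ^ 2 + t = α := by
  classical
  obtain ⟨r, rfl⟩ : ∃ k, r = k + 1 := by
    refine ⟨r - 1, ?_⟩
    have : r ≠ 0 := by
      rintro rfl
      have := Fintype.one_lt_card (α := K)
      rw [hq] at this
      simp at this
    omega
  have hchar : CharP K 2 := by
    have h0 : ((2 ^ (r + 1) : ℕ) : K) = 0 := by rw [← hq, FiniteField.cast_card_eq_zero]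
    rw [Nat.cast_pow] at h0
    have h2 : (2 : K) = 0 := by exact_mod_cast (pow_eq_zero_iff (Nat.succ_ne_zero r)).1 h0
    exact CharTwo.of_one_ne_zero_of_two_eq_zero one_ne_zero h2
  -- `T` is the absolute trace polynomial, of degree `q / 2`. The map `t ↦ t² + t` is at most
  -- two-to-one, so its image has at least `q / 2` elements; these are roots of `T`, hence all of
  -- them.
  let T : Polynomial K := ∑ i ∈ Finset.range (r + 1), Polynomial.X ^ 2 ^ i
  have hTcoeff : T.coeff (2 ^ r) = 1 := by
    simp only [T, Polynomial.finsetSum_coeff, Polynomial.coeff_X_pow]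
    rw [Finset.sum_eq_single r]
    · simp
    · intro i _ hi
      rw [if_neg]
      intro h
      exact hi (Nat.pow_right_injective le_rfl h).symm
    · simp
  have hT0 : T ≠ 0 := fun h => by simp [h] at hTcoeff
  have hTdeg : T.natDegree ≤ 2 ^ r := by
    refine Polynomial.natDegree_sum_le_of_forall_le _ _ fun i hi => ?_
    rw [Polynomial.natDegree_X_pow]
    exact Nat.pow_le_pow_right two_pos (by simpa [Nat.lt_succ_iff] using hi)
  have hTeval : ∀ x, T.eval x = ∑ i ∈ Finset.range (r + 1), x ^ 2 ^ i := by
    intro x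
    simp [T, Polynomial.eval_finsetSum]
  let I := Finset.univ.image fun t : K => t ^ 2 + t
  have hsub : I ⊆ T.roots.toFinset := by
    intro y hy
    obtain ⟨t, -, rfl⟩ := Finset.mem_image.1 hy
    rw [Multiset.mem_toFinset, Polynomial.mem_roots hT0, Polynomial.IsRoot.def, hTeval]
    have h1 : ∀ i, (t ^ 2 + t) ^ 2 ^ i = t ^ 2 ^ (i + 1) - t ^ 2 ^ i := by
      intro i
      rw [add_pow_char_pow, CharTwo.sub_eq_add, ← pow_mul, ← pow_succ']
    rw [Finset.sum_congr rfl fun i _ => h1 i, Finset.sum_range_sub (fun i => t ^ 2 ^ i), ← hq,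
      FiniteField.pow_card, pow_zero, pow_one, sub_self]
  have hcard : 2 ^ r ≤ I.card := by
    have h1 : (Finset.univ : Finset K).card ≤ 2 * I.card := by
      refine Finset.card_le_mul_card_image _ 2 fun y hy => ?_
      obtain ⟨t, -, rfl⟩ := Finset.mem_image.1 hy
      refine (Finset.card_le_card (t := {t, t + 1}) fun u hu => ?_).trans Finset.card_le_two
      have hu : u ^ 2 + u = t ^ 2 + t := by simpa using hu
      have h3 : (u - t) * (u - (t + 1)) = 0 := by
        have h4 : (2 : K) = 0 := CharTwo.two_eq_zero
        linear_combination hu + (t ^ 2 - u * t - u + t) * h4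
      rcases mul_eq_zero.1 h3 with h | h
      · simp [sub_eq_zero.1 h]
      · simp [sub_eq_zero.1 h]
    rw [Finset.card_univ, hq, pow_succ, mul_comm] at h1
    exact Nat.le_of_mul_le_mul_left h1 two_pos
  have heq : I = T.roots.toFinset := by
    refine Finset.eq_of_subset_of_card_le hsub ?_
    exact (Multiset.toFinset_card_le _).trans ((Polynomial.card_roots' T).trans
      (hTdeg.trans hcard))
  have hmem : α ∈ I := by
    rw [heq, Multiset.mem_toFinset, Polynomial.mem_roots hT0, Polynomial.IsRoot.def, hTeval, hα]
  obtain ⟨t, -, ht⟩ := Finset.mem_image.1 hmem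
  exact ⟨t, ht⟩

/-- The absolute trace equals its own square, so it is `0` or `1`. If it were `0`, then `α = t² + t`
for some `t`, a root in characteristic `2`. -/
lemma trace_eq_one_of_no_root {α : K} (hα : ∀ t : K, t ^ 2 + t + α ≠ 0) {r : ℕ}
    (hq : Fintype.card K = 2 ^ r) : ∑ i ∈ Finset.range r, α ^ 2 ^ i = 1 := by
  have hr : r ≠ 0 := by
    rintro rfl
    have := Fintype.one_lt_card (α := K)
    rw [hq] at this
    simp at this
  have h2 : (2 : K) = 0 := by
    have h0 : ((2 ^ r : ℕ) : K) = 0 := by rw [← hq, FiniteField.cast_card_eq_zero]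
    rw [Nat.cast_pow] at h0
    exact_mod_cast (pow_eq_zero_iff hr).1 h0
  have hchar : CharP K 2 := CharTwo.of_one_ne_zero_of_two_eq_zero one_ne_zero h2
  have hsq : (∑ i ∈ Finset.range r, α ^ 2 ^ i) ^ 2 = ∑ i ∈ Finset.range r, α ^ 2 ^ i := by
    have h1 := Finset.sum_range_sub (fun i => α ^ 2 ^ i) r
    rw [← hq, FiniteField.pow_card, pow_zero, pow_one, sub_self, Finset.sum_sub_distrib,
      sub_eq_zero] at h1
    rw [sum_pow_char]
    refine Eq.trans (Finset.sum_congr rfl fun i _ => ?_) h1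
    rw [← pow_mul, pow_succ]
  have h3 : (∑ i ∈ Finset.range r, α ^ 2 ^ i) * ((∑ i ∈ Finset.range r, α ^ 2 ^ i) - 1) = 0 := by
    linear_combination hsq
  rcases mul_eq_zero.1 h3 with h | h
  · obtain ⟨t, ht⟩ := exists_sq_add_eq_of_trace_eq_zero hq h
    refine absurd ?_ (hα t)
    rw [ht]
    linear_combination α * h2
  · exact sub_eq_zero.1 h

lemma not_isSquare_of_no_root {K : Type*} [Field K] {α : K} (hα : ∀ t : K, t ^ 2 + t + α ≠ 0)
    (h2 : (2 : K) ≠ 0) : ¬ IsSquare (1 - 4 * α) := by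
  rintro ⟨δ, hδ⟩
  refine hα ((-1 + δ) / 2) ?_
  field_simp
  linear_combination -hδ

theorem exists_linEquivalent_ellipticQuadric {F : MvPolynomial (Fin (2 + 2)) K}
    (hF : F.IsHomogeneous 2) (hns : Nonsing F) (hk : thasInvariant F = 0) :
    ∃ α : K, (∀ t : K, t ^ 2 + t + α ≠ 0) ∧ LinEquivalent F (ellipticQuadric 2 α) := by
  obtain ⟨D, hD, han, hequiv⟩ := exists_anisotropic one_le_two hF hns hk
  obtain ⟨α, c, g, hc, hg, hgD⟩ := exists_binary_normal_form hD han
  refine ⟨α, fun t ht => ?_, hequiv.trans ?_⟩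
  · refine han (g ![1, t]) (fun h => ?_) ?_
    · have := congrFun (hg _ h) 0
      simp at this
    · rw [hgD]
      simp only [Matrix.cons_val_zero, Matrix.cons_val_one]
      linear_combination c * ht
  · let f : (Fin (2 + 2) → K) →ₗ[K] (Fin 2 ⊕ Fin 2 → K) :=
      { toFun := fun z => Sum.elim ![c * z 2, z 3] (g ![z 0, z 1])
        map_add' := fun x y => by
          have : (![(x + y) 0, (x + y) 1] : Fin 2 → K) = ![x 0, x 1] + ![y 0, y 1] := by simp
          ext (i | i)
          · fin_cases i <;> simp [mul_add]
          · simp only [Sum.elim_inr, Pi.add_apply] at this ⊢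
            rw [this, map_add, Pi.add_apply]
        map_smul' := fun t x => by
          have : (![(t • x) 0, (t • x) 1] : Fin 2 → K) = t • ![x 0, x 1] := by simp
          ext (i | i)
          · fin_cases i <;> simp [mul_left_comm]
          · simp only [Sum.elim_inr, Pi.smul_apply] at this ⊢
            rw [this, map_smul, Pi.smul_apply, RingHom.id_apply] }
    have hf : ∀ z, f z = Sum.elim ![c * z 2, z 3] (g ![z 0, z 1]) := fun z => rfl
    have hell : (ellipticQuadric 2 α).IsHomogeneous 2 := by
      have h1 := (isHomogeneous_C (Fin (2 + 2)) α).mul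
        ((isHomogeneous_X K (0 : Fin (2 + 2))).pow 2)
      have h2 := ((h1.add ((isHomogeneous_X K (0 : Fin (2 + 2))).mul (isHomogeneous_X K 1))).add
        ((isHomogeneous_X K (1 : Fin (2 + 2))).pow 2)).add
        ((isHomogeneous_X K (2 : Fin (2 + 2))).mul (isHomogeneous_X K 3))
      exact h2
    refine LinEquivalent.of_linearMap
      (((isHomogeneous_X _ _).mul (isHomogeneous_X _ _)).add hD.rename_isHomogeneous)
      hell Fintype.one_lt_card (by simp) f (fun z hz => ?_) hc fun z => ?_
    · have h1 : c * z 2 = 0 := congrFun hz (Sum.inl 0)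
      have h2 : z 3 = 0 := congrFun hz (Sum.inl 1)
      have h3 := hg ![z 0, z 1] (funext fun i => congrFun hz (Sum.inr i))
      have h4 : z 0 = 0 := congrFun h3 0
      have h5 : z 1 = 0 := congrFun h3 1
      ext i
      fin_cases i
      · exact h4
      · exact h5
      · exact (mul_eq_zero.1 h1).resolve_left hc
      · exact h2
    · rw [hf, map_add, eval_rename, map_mul, eval_X, eval_X, Sum.elim_comp_inr, hgD]
      simp [ellipticQuadric]
      ring

end Elliptic

/-! ### The equality case with a line, and the converse counts -/

section Classification

variable {K : Type*} [Field K] [Fintype K] {n e : ℕ} {F : MvPolynomial (Fin (n + 2)) K}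

lemma zeroCount_eq_pow_iff {σ : Type*} [Fintype σ] {F : MvPolynomial σ K} :
    zeroCount F = Fintype.card K ^ Fintype.card σ ↔ ∀ x, eval x F = 0 := by
  classical
  rw [zeroCount, Nat.card_eq_fintype_card, Fintype.card_subtype, ← Fintype.card_fun,
    ← Finset.card_univ, Finset.card_filter_eq_iff]
  simp

lemma pow_add_sub_one_mul_mul (q k : ℕ) (hq : 1 ≤ q) :
    q ^ (k + 1) + (q ^ (k + 1) - 1) * (q * q ^ k) = q ^ (2 * k + 2) := by
  have : 1 ≤ q ^ (k + 1) := Nat.one_le_pow _ _ hq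
  zify [this]
  ring

/-- Equality leads to the extremal normal form, which forces `e ≤ q`. The cases `e = q`, `e = 1` and
`1 < e < q` give the three families. -/
theorem zeroCount_le_of_thasInvariant_pos (he : e ≠ 0) (hF : F.IsHomogeneous (e + 1))
    (hns : Nonsing F) (hk : 0 < thasInvariant F) :
    zeroCount F ≤ Fintype.card K ^ (thasInvariant F + 1)
      + (Fintype.card K ^ (n + 1 - thasInvariant F) - 1)
        * (e * Fintype.card K ^ thasInvariant F) ∧
    (zeroCount F = Fintype.card K ^ (thasInvariant F + 1)
      + (Fintype.card K ^ (n + 1 - thasInvariant F) - 1)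
        * (e * Fintype.card K ^ thasInvariant F) →
      n = 2 * thasInvariant F ∧
      ((e = Fintype.card K ∧ ∃ A : Matrix (Fin (n + 2)) (Fin (n + 2)) K, A.transpose = -A ∧
          (∀ i, A i i = 0) ∧ A.det ≠ 0 ∧ F = spaceFilling (Fintype.card K) A) ∨
        (e * e = Fintype.card K ∧ LinEquivalent F (hermitianForm K n e)) ∨
        (e = 1 ∧ LinEquivalent F (hyperbolicQuadric K n)))) := by
  obtain ⟨V, hV, hFV⟩ := exists_finrank_eq_of_pos hk
  have hkn := le_of_containsLinear hns.ne_zero hV hFV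
  obtain ⟨M, M', h₁, h₂, h0, -⟩ := exists_adapted_coordinates
    (show thasInvariant F + 1 + (n + 1 - thasInvariant F) = n + 2 by omega) hV hFV
  have hG := isHomogeneous_lsub hF M
  have hne : ∀ v ≠ 0, spec v (lsub M F) ≠ 0 := fun v hv => spec_ne_zero_of_maximal hF h₂ h0 hv
  have hle := zeroCount_le_and_eq_iff hG h0 hne
  have hequiv : LinEquivalent F (lsub M F) := LinEquivalent.of_lsub h₁ h₂ F
  rw [hequiv.zeroCount_eq]
  refine ⟨hle.1, fun heq => ?_⟩
  obtain ⟨p, hp⟩ := CharP.exists K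
  have hprime : Fact p.Prime := ⟨CharP.char_is_prime K p⟩
  obtain ⟨hN, heq', r, her, G', hGG', hG'⟩ := exists_isExtremalNormal (p := p) hk (by omega) he hG
    h0 hne (hns.lsub h₁ h₂) (hle.2 heq)
  have hn : n = 2 * thasInvariant F := by omega
  refine ⟨hn, ?_⟩
  rcases heq'.eq_or_lt with rfl | hlt
  · refine Or.inl ⟨rfl, exists_eq_spaceFilling hF hns (zeroCount_eq_pow_iff.1 ?_)⟩
    rw [hequiv.zeroCount_eq, heq, hN, pow_add_sub_one_mul_mul _ _ Fintype.card_pos,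
      Fintype.card_fin, ← hn]
  · rcases (Nat.one_le_iff_ne_zero.2 he).eq_or_lt with rfl | h1
    · exact Or.inr (Or.inr ⟨rfl, (hequiv.trans hGG').trans
        (hG'.linEquivalent_splitQuadric.trans (linEquivalent_hyperbolicQuadric hn))⟩)
    · obtain ⟨hee, hherm⟩ := hG'.linEquivalent_hermitianForm (n := n) (by omega) (by omega) her h1
        hlt
      exact Or.inr (Or.inl ⟨hee, (hequiv.trans hGG').trans hherm⟩)

lemma zeroCount_of_spaceFilling {k : ℕ} (hn : n = 2 * k)
    {A : Matrix (Fin (n + 2)) (Fin (n + 2)) K} (hA : A.transpose = -A) (hA0 : ∀ i, A i i = 0)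
    (hFA : SameHypersurface F (spaceFilling (Fintype.card K) A)) :
    zeroCount F = Fintype.card K ^ (k + 1)
      + (Fintype.card K ^ (k + 1) - 1) * (Fintype.card K * Fintype.card K ^ k) := by
  rw [pow_add_sub_one_mul_mul _ _ Fintype.card_pos, ← hn]
  have := (zeroCount_eq_pow_iff (F := F)).2 fun x => by
    obtain ⟨c, -, rfl⟩ := hFA
    rw [map_mul, eval_spaceFilling_eq_zero hA hA0, mul_zero]
  rwa [Fintype.card_fin] at this

lemma zeroCount_of_hermitianForm {k s : ℕ} (hn : n = 2 * k) (hs : s ^ 2 = Fintype.card K)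
    (h : LinEquivalent F (hermitianForm K n s)) :
    zeroCount F = Fintype.card K ^ (k + 1)
      + (Fintype.card K ^ (k + 1) - 1) * (s * Fintype.card K ^ k) := by
  classical
  obtain ⟨p, hp⟩ := CharP.exists K
  have hprime : Fact p.Prime := ⟨CharP.char_is_prime K p⟩
  obtain ⟨t, -, ht⟩ := FiniteField.card K p
  obtain ⟨r, -, hr⟩ := (Nat.dvd_prime_pow hprime.out).1
    (show s ∣ p ^ (t : ℕ) from ht ▸ hs ▸ dvd_pow_self s two_ne_zero)
  have h2 : 2 ≤ s := by
    have := Fintype.one_lt_card (α := K)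
    rw [← hs] at this
    by_contra h
    interval_cases s <;> omega
  rw [h.zeroCount_eq, zeroCount_hermitianForm hn hr h2 (by rw [← hs, sq])]

lemma zeroCount_of_hyperbolicQuadric {k : ℕ} (hn : n = 2 * k)
    (h : LinEquivalent F (hyperbolicQuadric K n)) :
    zeroCount F = Fintype.card K ^ (k + 1)
      + (Fintype.card K ^ (k + 1) - 1) * (1 * Fintype.card K ^ k) := by
  rw [h.zeroCount_eq, ← (linEquivalent_hyperbolicQuadric hn).zeroCount_eq, zeroCount_splitQuadric,
    one_mul]

lemma two_ne_zero_of_odd_card (h : Odd (Fintype.card K)) : (2 : K) ≠ 0 := by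
  intro h2
  have h1 : ringChar K = 2 := CharP.ringChar_of_prime_eq_zero Nat.prime_two (by exact_mod_cast h2)
  have := FiniteField.even_card_of_char_two h1
  rw [Nat.odd_iff] at h
  omega

end Classification

end

end FqHypersurface

/-! ### The theorem -/

open FqHypersurface

theorem mainTheorem5 {K : Type*} [Field K] [Fintype K] (n d q : ℕ)
    (hq : Fintype.card K = q) (hn : 1 ≤ n) (hd : 2 ≤ d)
    (F : MvPolynomial (Fin (n + 2)) K) (hF : F.IsHomogeneous d)
    (hns : FqHypersurface.IsNonsingular F) :
    FqHypersurface.numPoints F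
        ≤ FqHypersurface.theta d q n (FqHypersurface.thasInvariant F) ∧
    (FqHypersurface.numPoints F
        = FqHypersurface.theta d q n (FqHypersurface.thasInvariant F) ↔
      (n = 1 ∧ d = 2 ∧ FqHypersurface.thasInvariant F = 0 ∧
        ((Odd q ∧ FqHypersurface.ProjEquiv F (FqHypersurface.sumSquaresConic K n)) ∨
         (Even q ∧ FqHypersurface.ProjEquiv F (FqHypersurface.evenConic K n)))) ∨
      (n = 2 ∧ d = 2 ∧ FqHypersurface.thasInvariant F = 0 ∧
        ∃ α : K,
          (∀ r : ℕ, q = 2 ^ r → ∑ i ∈ Finset.range r, α ^ (2 ^ i) = 1) ∧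
          (Odd q → ¬ IsSquare (1 - 4 * α)) ∧
          FqHypersurface.ProjEquiv F (FqHypersurface.ellipticQuadric n α)) ∨
      (2 ≤ n ∧ Even n ∧ FqHypersurface.thasInvariant F = n / 2 ∧
        ((d = q + 1 ∧ ∃ A : Matrix (Fin (n + 2)) (Fin (n + 2)) K,
            A.transpose = -A ∧ (∀ i, A i i = 0) ∧ A.det ≠ 0 ∧
            FqHypersurface.SameHypersurface F (FqHypersurface.spaceFilling q A)) ∨
         (∃ s : ℕ, s ^ 2 = q ∧ d = s + 1 ∧
            FqHypersurface.ProjEquiv F (FqHypersurface.hermitianForm K n s)) ∨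
         (d = 2 ∧ FqHypersurface.ProjEquiv F (FqHypersurface.hyperbolicQuadric K n))))) := by
  subst hq
  have hns : Nonsing F := hns
  have hd0 : d ≠ 0 := by omega
  have hq1 : 1 ≤ Fintype.card K := Fintype.card_pos
  simp only [projEquiv_iff]
  rcases Nat.eq_zero_or_pos (thasInvariant F) with hk | hk
  · rw [hk, numPoints_le_iff hd0 hF, numPoints_eq_iff hd0 hF]
    obtain ⟨e, rfl⟩ : ∃ e, d = e + 2 := ⟨d - 2, by omega⟩
    have hth : theta (e + 2) (Fintype.card K) n 0 * (Fintype.card K - 1) + 1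
        = lineFreeBound (Fintype.card K) n e := theta_zero_mul_add_one hq1 hn
    rw [hth]
    rcases Nat.eq_zero_or_pos e with rfl | he
    -- For a quadric without lines both sides of the equivalence hold: a rational point exists and
    -- forces equality, and the classification applies with `n ≤ 2`.
    · obtain ⟨P, hP, hFP⟩ := exists_ne_zero_eval_eq_zero hF (by simp; omega)
      have heq := zeroCount_eq_of_point hF hns hk hP hFP
      refine ⟨heq.le, iff_of_true heq ?_⟩
      have hn2 := le_two_of_line_free hn hF hns hk
      interval_cases n
      · refine Or.inl ⟨rfl, rfl, rfl, ?_⟩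
        rcases Nat.even_or_odd (Fintype.card K) with hev | hodd
        · exact Or.inr ⟨hev, linEquivalent_evenConic hF (hns.polarNonsing hF)⟩
        · exact Or.inl ⟨hodd, linEquivalent_sumSquaresConic (two_ne_zero_of_odd_card hodd) hF
            (hns.polarNonsing hF)⟩
      · obtain ⟨α, hα, hequiv⟩ := exists_linEquivalent_ellipticQuadric hF hns hk
        exact Or.inr (Or.inl ⟨rfl, rfl, rfl, α, fun r hr => trace_eq_one_of_no_root hα hr,
          fun hodd => not_isSquare_of_no_root hα (two_ne_zero_of_odd_card hodd), hequiv⟩)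
    -- For `d ≥ 3` and `k_X = 0` no listed case can occur: the first two need `d = 2`, the third `n
    -- / 2 = 0` with `n ≥ 2`.
    · have hright : ∀ {p₁ p₂ p₃ : Prop}, ¬ ((n = 1 ∧ e + 2 = 2 ∧ p₁) ∨ (n = 2 ∧ e + 2 = 2 ∧ p₂) ∨
          (2 ≤ n ∧ Even n ∧ 0 = n / 2 ∧ p₃)) := by
        rintro p₁ p₂ p₃ (⟨-, h, -⟩ | ⟨-, h, -⟩ | ⟨h, -, h', -⟩) <;> omega
      by_cases hpt : ∃ P ≠ 0, MvPolynomial.eval P F = 0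
      · obtain ⟨P, hP, hFP⟩ := hpt
        exact ⟨zeroCount_le_of_point hF hns hk hP hFP,
          iff_of_false (zeroCount_ne_of_line_free hn he hF hns hk hP hFP) hright⟩
      · push Not at hpt
        -- Without rational points the cone is the origin alone, strictly below the bound.
        have h1 : zeroCount F = 1 := by
          rw [zeroCount, Nat.card_eq_one_iff_exists]
          exact ⟨⟨0, eval_zero_of_isHomogeneous hd0 hF⟩, fun y =>
            Subtype.ext (by_contra fun hy => hpt y.1 hy y.2)⟩
        have h2 : 1 < lineFreeBound (Fintype.card K) n e := by
          have := Fintype.one_lt_card (α := K)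
          unfold lineFreeBound
          omega
        rw [h1]
        exact ⟨h2.le, iff_of_false h2.ne hright⟩
  · obtain ⟨e, rfl⟩ : ∃ e, d = e + 1 := ⟨d - 1, by omega⟩
    obtain ⟨V, hV, hFV⟩ := exists_finrank_eq_of_pos hk
    have hkn := le_of_containsLinear hns.ne_zero hV hFV
    rw [numPoints_le_iff hd0 hF, numPoints_eq_iff hd0 hF, theta_mul_add_one hq1 hk hkn]
    obtain ⟨hle, hcl⟩ := zeroCount_le_of_thasInvariant_pos (by omega) hF hns hk
    refine ⟨hle, fun heq => ?_, ?_⟩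
    · obtain ⟨hn2, h⟩ := hcl heq
      refine Or.inr (Or.inr ⟨by omega, ⟨_, hn2.trans (two_mul _)⟩, by omega, ?_⟩)
      rcases h with ⟨rfl, A, h1, h2, h3, h4⟩ | ⟨hee, h⟩ | ⟨rfl, h⟩
      · exact Or.inl ⟨rfl, A, h1, h2, h3, 1, one_ne_zero, by rw [h4, map_one, one_mul]⟩
      · exact Or.inr (Or.inl ⟨e, by rw [sq, hee], rfl, h⟩)
      · exact Or.inr (Or.inr ⟨rfl, h⟩)
    · rintro (⟨-, -, h, -⟩ | ⟨-, -, h, -⟩ | ⟨-, hev, hkn2, h⟩)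
      · omega
      · omega
      have hn2 : n = 2 * thasInvariant F := by
        obtain ⟨t, ht⟩ := hev
        omega
      rw [show n + 1 - thasInvariant F = thasInvariant F + 1 by omega]
      rcases h with ⟨he, A, h1, h2, -, h3⟩ | ⟨s, hs, he, h⟩ | ⟨he, h⟩
      · obtain rfl : e = Fintype.card K := by omega
        exact zeroCount_of_spaceFilling hn2 h1 h2 h3
      · obtain rfl : e = s := by omega
        exact zeroCount_of_hermitianForm hn2 hs h
      · obtain rfl : e = 1 := by omega
        exact zeroCount_of_hyperbolicQuadric hn2 h
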